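/- Let $(\varepsilon_k)_{k\in\mathbb Z}$ be i.i.d. real random variables and $(a_i)_{i\ge 0}$ real coefficients with $a_0=1$ such that the causal linear process $X_k=\sum_{i=0}^\infty a_i\varepsilon_{k-i}$, $k\in\mathbb Z$, converges almost surely. Suppose that $\varepsilon_0$ has a twice differentiable density $f_\varepsilon$ with $\sup_x[f_\varepsilon(x)+|f_\varepsilon'(x)|]<\infty$ and $\sup_x|f_\varepsilon''(x)|<\infty$, and that there are $\alpha>0$ and $q\ge 2$ with $\mathbb E|\varepsilon_0|^\alpha<\infty$ and $\sum_{i=1}^\infty|a_i|^{\min(\alpha/q,1)}<\infty$. Let $F(x)=\mathbb P(X_0\le x)$, $f=F'$ (the continuous density of $X_0$), $\xi_p=\inf\{x:F(x)\ge p\}$, $F_n(x)=n^{-1}\sum_{i=1}^n\mathbf 1_{X_i\le x}$ and $\xi_{n,p}=\inf\{x:F_n(x)\ge p\}$. Let $0<p_0<p_1<1$ be such that $\inf_{p_0\le p\le p_1}f(\xi_p)>0$, and put $\iota_q(n)=(\log n)^{1/q}(\log\log n)^{2/q}$ if $q>2$ and $\iota_2(n)=(\log n)^{3/2}\log\log n$.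 Then (i) $\sup_{p_0\le p\le p_1}|\xi_{n,p}-\xi_p|=o_{\mathrm{a.s.}}\big(\iota_q(n)/\sqrt n\big)$, and (ii) $$\sup_{p_0\le p\le p_1}\left|\xi_{n,p}-\xi_p-\frac{p-F_n(\xi_p)}{f(\xi_p)}\right|=O_{\mathrm{a.s.}}\big[n^{-3/4}(\iota_q(n)\log n)^{1/2}\big].$$ Here $Z_n=o_{\mathrm{a.s.}}(r_n)$ means that $Z_n/r_n\to0$ almost surely, and $Z_n=O_{\mathrm{a.s.}}(r_n)$ means that almost surely $Z_n/r_n$ is bounded for all large $n$ (by a constant that may be random). -/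

import Mathlib

open MeasureTheory ProbabilityTheory Filter Topology
open scoped ENNReal NNReal

noncomputable section

namespace Bahadur

/-- `X` is (a version of) the causal linear process `X_k = ∑_{i ≥ 0} a_i ε_{k-i}`, `k ∈ ℤ`, with
i.i.d. innovations `ε_k` and real coefficients `a_i`, normalised by `a_0 = 1`. The series is only
required to converge almost surely (as the limit of its partial sums). -/
structure IsLinearProcess {Ω : Type*} [MeasurableSpace Ω] (μ : Measure Ω)
    (a : ℕ → ℝ) (ε X : ℤ → Ω → ℝ) : Prop where
  measurable : ∀ k, Measurable (ε k)
  indep : iIndepFun ε μ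
  ident : ∀ k, IdentDistrib (ε k) (ε 0) μ μ
  coeff_zero : a 0 = 1
  series : ∀ k : ℤ, ∀ᵐ ω ∂μ,
    Tendsto (fun N : ℕ => ∑ i ∈ Finset.range N, a i * ε (k - (i : ℤ)) ω) atTop (𝓝 (X k ω))

/-- `g` is a probability density of the real random variable `Y`. -/
def IsDensity {Ω : Type*} [MeasurableSpace Ω] (μ : Measure Ω) (Y : Ω → ℝ) (g : ℝ → ℝ) : Prop :=
  Measurable g ∧ (∀ x, 0 ≤ g x) ∧
    μ.map Y = (volume : Measure ℝ).withDensity (fun x => ENNReal.ofReal (g x))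

/-- The marginal distribution function `F(x) = P(X_0 ≤ x)`; the process is stationary, so the
index `0` may be replaced by any other. -/
def margCDF {Ω : Type*} [MeasurableSpace Ω] (μ : Measure Ω) (X : ℤ → Ω → ℝ) (x : ℝ) : ℝ :=
  μ.real {ω | X 0 ω ≤ x}

/-- The marginal density `f = F'`. When the innovations have a bounded continuous density, `F` is
everywhere differentiable and this is the continuous version of the density of `X_0`. -/
def margDensity {Ω : Type*} [MeasurableSpace Ω] (μ : Measure Ω) (X : ℤ → Ω → ℝ) (x : ℝ) : ℝ :=
  deriv (margCDF μ X) x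

/-- The `p`-th quantile `inf {x : G(x) ≥ p}` of a distribution function `G`. -/
def quantile (G : ℝ → ℝ) (p : ℝ) : ℝ :=
  sInf {x | p ≤ G x}

/-- The empirical distribution function `F_n(x) = n⁻¹ ∑_{i=1}^n 1_{X_i ≤ x}`. -/
def empCDF {Ω : Type*} (X : ℤ → Ω → ℝ) (n : ℕ) (ω : Ω) (x : ℝ) : ℝ :=
  (1 / (n : ℝ)) * ∑ i ∈ Finset.Icc 1 n, Set.indicator {y : ℝ | y ≤ x} 1 (X (i : ℤ) ω)

/-- The population quantile `ξ_p`. -/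
def popQuantile {Ω : Type*} [MeasurableSpace Ω] (μ : Measure Ω) (X : ℤ → Ω → ℝ) (p : ℝ) : ℝ :=
  quantile (margCDF μ X) p

/-- The sample quantile `ξ_{n,p}`. -/
def sampleQuantile {Ω : Type*} (X : ℤ → Ω → ℝ) (n : ℕ) (p : ℝ) (ω : Ω) : ℝ :=
  quantile (empCDF X n ω) p

/-- `ι_q(n) = (log n)^{1/q} (log log n)^{2/q}` for `q > 2` and
`ι_2(n) = (log n)^{3/2} (log log n)`. -/
def iota (q : ℝ) (n : ℕ) : ℝ :=
  if q = 2 then Real.log n ^ (3 / 2 : ℝ) * Real.log (Real.log n)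
  else Real.log n ^ (1 / q) * Real.log (Real.log n) ^ (2 / q)

/-- `Z_n = o_{a.s.}(r_n)`, for an eventually positive sequence `r_n`: almost surely,
`Z_n / r_n → 0`. The `Z_n` take values in `[0, ∞]`, so that suprema need no side condition. -/
def IsLittleOAS {Ω : Type*} [MeasurableSpace Ω] (μ : Measure Ω)
    (Z : ℕ → Ω → ℝ≥0∞) (r : ℕ → ℝ) : Prop :=
  ∀ᵐ ω ∂μ, Tendsto (fun n => Z n ω / ENNReal.ofReal (r n)) atTop (𝓝 0)

/-- `Z_n = O_{a.s.}(r_n)`, for an eventually positive sequence `r_n`: almost surely, `Z_n / r_n`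
is bounded, for all large `n`, by a finite (random) constant. -/
def IsBigOAS {Ω : Type*} [MeasurableSpace Ω] (μ : Measure Ω)
    (Z : ℕ → Ω → ℝ≥0∞) (r : ℕ → ℝ) : Prop :=
  ∀ᵐ ω ∂μ, ∃ C : ℝ≥0, ∀ᶠ n in atTop, Z n ω ≤ (C : ℝ≥0∞) * ENNReal.ofReal (r n)

end Bahadur

end

noncomputable section

namespace Bahadur

/-! ### Conditional expectation and independent enlargement -/

section CondExp

variable {Ω : Type*} {m0 : MeasurableSpace Ω} {μ : Measure Ω}

/-! Write `X_i = Y_i + ε_i`, where `Y_i` (`pastPart`) depends only on innovations before time `i`,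
and let `G` be the innovation distribution function. Then `n (F_n - F)(x) = M_n(x) + N_n(x)`
(`empCDF_sub_margCDF`). Here `M_n(x)` sums the martingale differences `1_{X_i ≤ x} - G(x - Y_i)`,
and `N_n(x)` sums the centred variables `G(x - Y_i)`. The first part is rough in `x` but a
martingale with bounded increments; the second is dependent but smooth in `x`.

Martingale part. Conditioning on the past gives a Bernstein-type exponential bound
(`lintegral_exp_sum_le`), for single points and for increments in `x`, whose conditional variance is
of order `x' - x`. It yields moments of every order, and chaining over a grid turns these into an
`L^Q` bound of order `√n` for the supremum over a compact interval. The same bound with a union over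
grid pairs and Borel–Cantelli gives the modulus `√(n b log n)` at scale `b` (`ae_oscillation`).

Smooth part. An `L^q` Efron–Stein inequality is applied by deleting one innovation at a time. A
bounded Lipschitz function is Hölder of exponent `γ = min(α/q, 1)`, and `γ q ≤ α`, so deleting one
innovation costs at most a constant multiple of `∑ |a_i|^γ`. Block sums therefore have `L^q` norm of
order `√n` (`hasMomentBound`). The supremum over `x` is bounded by the value at `0` plus the
integral of the absolute derivative, which is a sum of the same type because the density is also
smooth.

From moments to almost sure rates. A dyadic maximal inequality in `n` costs a factor `D + 1` at
scale `2^D` when `q = 2` and a constant when `q > 2`; `ι_q` is what makes the resulting normalised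
`q`-th moments summable (`summable_chainFactor_div`). Hence both parts are `o(√n ι_q(n))` uniformly
on compacts.

Quantiles. With `b_n = ι_q(n)/√n`, the uniform bound `o(b_n)` and a density bounded below at the
quantiles force `F_n` to cross level `p` within `o(b_n)` of `ξ_p`, which is (i). For (ii), Taylor
expansion of `F` costs `O(b_n²)`, and replacing `F_n - F` at the sample quantile by its value at
`ξ_p` costs its oscillation at scale `b_n`. The martingale contribution is `n⁻¹ √(n b_n log n) =
n^{-3/4} (ι_q(n) log n)^{1/2}`; the smooth contribution, through the derivative sum, is at most
`b_n²` and is negligible (`eventually_sq_le_rate`). -/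

lemma isPiSystem_image2_inter (F G : MeasurableSpace Ω) :
    IsPiSystem (Set.image2 (fun s t : Set Ω => s ∩ t) {s | MeasurableSet[F] s}
      {t | MeasurableSet[G] t}) := by
  rintro _ ⟨s, hs, t, ht, rfl⟩ _ ⟨s', hs', t', ht', rfl⟩ -
  exact ⟨s ∩ s', MeasurableSet.inter hs hs', t ∩ t', MeasurableSet.inter ht ht',
    by simp only; rw [Set.inter_inter_inter_comm]⟩

lemma sup_eq_generateFrom_image2_inter (F G : MeasurableSpace Ω) :
    F ⊔ G = MeasurableSpace.generateFrom
      (Set.image2 (fun s t : Set Ω => s ∩ t) {s | MeasurableSet[F] s} {t | MeasurableSet[G] t}) := by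
  apply le_antisymm
  · refine sup_le (fun s hs => ?_) (fun s hs => ?_)
    · exact MeasurableSpace.measurableSet_generateFrom
        ⟨s, hs, Set.univ, MeasurableSet.univ, by simp⟩
    · exact MeasurableSpace.measurableSet_generateFrom
        ⟨Set.univ, MeasurableSet.univ, s, hs, by simp⟩
  · refine MeasurableSpace.generateFrom_le ?_
    rintro _ ⟨s, hs, t, ht, rfl⟩
    exact MeasurableSet.inter ((le_sup_left : F ≤ F ⊔ G) s hs) ((le_sup_right : G ≤ F ⊔ G) t ht)

/-- Enlarging the conditioning σ-algebra by one that is independent of everything in sight does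
not change a conditional expectation. -/
lemma condExp_sup_of_indep [IsProbabilityMeasure μ] {F G H : MeasurableSpace Ω}
    (hH : H ≤ m0) (hG : G ≤ m0) (hFH : F ≤ H) (hind : Indep H G μ) {W : Ω → ℝ}
    (hW : StronglyMeasurable[H] W) (hint : Integrable W μ) :
    μ[W | F ⊔ G] =ᵐ[μ] μ[W | F] := by
  have hF : F ≤ m0 := hFH.trans hH
  have hFG : F ⊔ G ≤ m0 := sup_le hF hG
  -- Stated for arbitrary `V` since it is needed both for `W` and for `μ[W | F]`: on a generating
  -- set `B ∩ C` the two integrals then carry the same factor `μ C`.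
  have key : ∀ V : Ω → ℝ, StronglyMeasurable[H] V → Integrable V μ → ∀ B C : Set Ω,
      MeasurableSet[F] B → MeasurableSet[G] C →
      ∫ x in B ∩ C, V x ∂μ = μ.real C * ∫ x in B, V x ∂μ := by
    intro V hV hVi B C hB hC
    have hBV : StronglyMeasurable[H] (B.indicator V) := hV.indicator (hFH _ hB)
    have h1 := condExp_indep_eq hH hG hBV hind
    have h2 := setIntegral_condExp hG (hVi.indicator (hF _ hB)) hC
    rw [setIntegral_congr_ae (g := fun _ => ∫ x, B.indicator V x ∂μ) (hG _ hC)
      (by filter_upwards [h1] with x hx _ using hx)] at h2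
    rw [setIntegral_const, integral_indicator (hF _ hB), setIntegral_indicator (hF _ hB)] at h2
    rw [Set.inter_comm, ← h2, smul_eq_mul]
  have hgm : AEStronglyMeasurable[F ⊔ G] (μ[W | F]) μ :=
    (StronglyMeasurable.mono stronglyMeasurable_condExp
      (le_sup_left : F ≤ F ⊔ G)).aestronglyMeasurable
  refine (ae_eq_condExp_of_forall_setIntegral_eq hFG hint
    (fun s _ _ => integrable_condExp.integrableOn) ?_
    hgm).symm
  intro s hs _
  induction s, hs using MeasurableSpace.induction_on_inter
    (sup_eq_generateFrom_image2_inter F G) (isPiSystem_image2_inter F G) with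
  | empty => simp
  | basic t ht =>
    obtain ⟨B, hB, C, hC, rfl⟩ := ht
    simp only
    rw [key W hW hint B C hB hC, key _ (stronglyMeasurable_condExp.mono hFH) integrable_condExp
      B C hB hC, setIntegral_condExp hF hint hB]
  | compl t ht ih =>
    have h1 := integral_add_compl (hFG _ ht) hint
    have h2 := integral_add_compl (hFG _ ht) (integrable_condExp (μ := μ) (f := W) (m := F))
    have h3 := integral_condExp (μ := μ) (f := W) hF
    have h4 := ih (measure_lt_top _ _)
    linarith
  | iUnion f hd hf ih =>
    rw [integral_iUnion (fun i => hFG _ (hf i)) hd integrable_condExp.integrableOn,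
      integral_iUnion (fun i => hFG _ (hf i)) hd hint.integrableOn]
    exact tsum_congr fun i => ih i (measure_lt_top _ _)

end CondExp

/-! ### Pointwise expansions of `|x|^(2r)` -/

section Inequalities

lemma exp_le_one_add_add_sq (v : ℝ) : Real.exp v ≤ 1 + v + v ^ 2 * Real.exp |v| := by
  have he : 1 ≤ Real.exp |v| := Real.one_le_exp (abs_nonneg v)
  rcases le_or_gt |v| 1 with h | h
  · have h1 := abs_le.1 (Real.abs_exp_sub_one_sub_id_le h)
    nlinarith [sq_nonneg v]
  · rcases le_or_gt 0 v with hv | hv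
    · rw [abs_of_nonneg hv] at h ⊢
      have h1 : 1 ≤ v ^ 2 := by nlinarith
      have h2 := mul_le_mul_of_nonneg_right h1 (Real.exp_pos v).le
      linarith
    · have h2 : Real.exp v ≤ 1 := Real.exp_le_one_iff.2 hv.le
      rw [abs_of_neg hv] at h he ⊢
      nlinarith [sq_nonneg v]

/-- For `|u| ≤ 1/2`, use `(1 + u)² ≤ e^{2u}` and expand the exponential to second order. For `|u| >
1/2`, `|1 + u| ≤ 3|u|` gives the factor `9^r`, while `4 r u²` compensates a negative linear term.
The form `(y²)^r` encodes `|y|^{2r}`. -/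
lemma one_add_sq_rpow_le {r : ℝ} (hr : 1 ≤ r) (u : ℝ) :
    ((1 + u) ^ 2) ^ r ≤ 1 + 2 * r * u
      + (4 * r ^ 2 * Real.exp (2 * r) + 9 ^ r + 4 * r) * (u ^ 2 + (u ^ 2) ^ r) := by
  have h0 : 0 ≤ (u ^ 2) ^ r := Real.rpow_nonneg (sq_nonneg u) r
  have h9 : (0:ℝ) < 9 ^ r := by positivity
  have hE : 0 < Real.exp (2 * r) := Real.exp_pos _
  have hu2 := sq_nonneg u
  rcases le_or_gt |u| (1/2) with h | h
  · have hu := abs_le.1 h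
    have h1 : ((1 + u) ^ 2) ^ r ≤ Real.exp (2 * r * u) := by
      have : (1 + u) ^ 2 ≤ Real.exp (2 * u) := by
        have := Real.add_one_le_exp u
        have h3 : Real.exp (2 * u) = Real.exp u ^ 2 := by rw [← Real.exp_nat_mul]; norm_num
        rw [h3]; exact pow_le_pow_left₀ (by linarith) (by linarith) 2
      calc ((1 + u) ^ 2) ^ r ≤ (Real.exp (2 * u)) ^ r :=
            Real.rpow_le_rpow (sq_nonneg _) this (by linarith)
        _ = _ := by rw [← Real.exp_mul]; ring_nf
    have h2 := exp_le_one_add_add_sq (2 * r * u)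
    have h3 : Real.exp |2 * r * u| ≤ Real.exp (2 * r) := by
      rw [Real.exp_le_exp, abs_mul, abs_of_pos (by linarith : 0 < 2 * r)]
      nlinarith
    have h4 : (2 * r * u) ^ 2 * Real.exp |2 * r * u| ≤ 4 * r ^ 2 * Real.exp (2 * r) * u ^ 2 := by
      have := mul_le_mul_of_nonneg_left h3 (sq_nonneg (2 * r * u))
      nlinarith
    have h5 : 0 ≤ (9 ^ r + 4 * r) * (u ^ 2 + (u ^ 2) ^ r) := by positivity
    have h6 : 0 ≤ 4 * r ^ 2 * Real.exp (2 * r) * (u ^ 2) ^ r := by positivity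
    nlinarith
  · have h1 : ((1 + u) ^ 2) ^ r ≤ 9 ^ r * (u ^ 2) ^ r := by
      rw [← Real.mul_rpow (by norm_num) hu2]
      apply Real.rpow_le_rpow (sq_nonneg _) _ (by linarith)
      have : |1 + u| ≤ 3 * |u| := by
        have := abs_add_le 1 u
        rw [abs_one] at this
        linarith
      calc (1 + u) ^ 2 = |1 + u| ^ 2 := (sq_abs _).symm
        _ ≤ (3 * |u|) ^ 2 := pow_le_pow_left₀ (abs_nonneg _) this 2
        _ = _ := by rw [mul_pow, sq_abs]; norm_num
    have h2 : 0 ≤ 1 + 2 * r * u + 4 * r * u ^ 2 := by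
      have h3 : -|u| ≤ u := neg_abs_le u
      have h4 : u ^ 2 = |u| ^ 2 := (sq_abs u).symm
      have h5 : 0 ≤ r * (|u| * (2 * |u| - 1)) := by
        have : 0 ≤ |u| * (2 * |u| - 1) := mul_nonneg (abs_nonneg u) (by linarith)
        positivity
      nlinarith
    have h5 : 0 ≤ (4 * r ^ 2 * Real.exp (2 * r)) * (u ^ 2 + (u ^ 2) ^ r) := by positivity
    have h6 : 0 ≤ 9 ^ r * u ^ 2 := by positivity
    have h7 : 0 ≤ 4 * r * (u ^ 2) ^ r := by positivity
    nlinarith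

/-- The constant in the second order expansion of `x ↦ |x| ^ (2 * r)`. -/
def rpowConst (r : ℝ) : ℝ := 4 * r ^ 2 * Real.exp (2 * r) + 9 ^ r + 4 * r

lemma one_le_rpowConst {r : ℝ} (hr : 1 ≤ r) : 1 ≤ rpowConst r := by
  have h9 : (0:ℝ) < 9 ^ r := by positivity
  have hE : 0 ≤ 4 * r ^ 2 * Real.exp (2 * r) := by positivity
  unfold rpowConst
  linarith

/-- Both sides are homogeneous of degree `2r`, so for `x ≠ 0` this is the case `1 + u` with `u = d /
x`. -/
lemma add_sq_rpow_le {r : ℝ} (hr : 1 ≤ r) (x d : ℝ) :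
    ((x + d) ^ 2) ^ r ≤ (x ^ 2) ^ r + 2 * r * ((x ^ 2) ^ (r - 1) * x) * d
      + rpowConst r * ((x ^ 2) ^ (r - 1) * d ^ 2 + (d ^ 2) ^ r) := by
  have hC := one_le_rpowConst hr
  rcases eq_or_ne x 0 with rfl | hx
  · have h1 : (0:ℝ) ^ r = 0 := Real.zero_rpow (by linarith)
    have h2 : 0 ≤ (0:ℝ) ^ (r - 1) := Real.rpow_nonneg le_rfl _
    have h3 : 0 ≤ (d ^ 2) ^ r := Real.rpow_nonneg (sq_nonneg d) r
    have h4 : 0 ≤ (0:ℝ) ^ (r - 1) * d ^ 2 := by positivity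
    simp only [zero_add, ne_eq, OfNat.ofNat_ne_zero, not_false_eq_true, zero_pow, h1, mul_zero,
      zero_mul]
    nlinarith
  · obtain ⟨u, rfl⟩ : ∃ u, d = x * u := ⟨d / x, by field_simp⟩
    have hx2 : 0 < x ^ 2 := by positivity
    have h1 := mul_le_mul_of_nonneg_left (one_add_sq_rpow_le hr u) (Real.rpow_nonneg hx2.le r)
    have h2 : (x ^ 2) ^ r = (x ^ 2) ^ (r - 1) * x ^ 2 := by
      rw [Real.rpow_sub_one hx2.ne']; field_simp
    have h3 : ((x + x * u) ^ 2) ^ r = (x ^ 2) ^ r * ((1 + u) ^ 2) ^ r := by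
      rw [← Real.mul_rpow hx2.le (sq_nonneg _)]; ring_nf
    have h4 : ((x * u) ^ 2) ^ r = (x ^ 2) ^ r * (u ^ 2) ^ r := by
      rw [← Real.mul_rpow hx2.le (sq_nonneg _)]; ring_nf
    rw [h3, h4]
    refine h1.trans (le_of_eq ?_)
    unfold rpowConst
    linear_combination (2 * r * u + u ^ 2 * (4 * r ^ 2 * Real.exp (2 * r) + 9 ^ r + 4 * r)) * h2

/-- A crude Young inequality: replace the smaller of the two variables by the larger. -/
lemma rpow_sub_one_mul_le {r t s : ℝ} (hr : 1 ≤ r) (ht : 0 ≤ t) (hs : 0 ≤ s) :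
    t ^ (r - 1) * s ≤ t ^ r + s ^ r := by
  have ht' := Real.rpow_nonneg ht r
  have hs' := Real.rpow_nonneg hs r
  have aux : ∀ y : ℝ, 0 ≤ y → y ^ (r - 1) * y = y ^ r := by
    intro y hy
    rcases hy.eq_or_lt with rfl | hy
    · rw [mul_zero, Real.zero_rpow (by linarith)]
    · rw [Real.rpow_sub_one hy.ne']; field_simp
  rcases le_total s t with h | h
  · have := mul_le_mul_of_nonneg_left h (Real.rpow_nonneg ht (r - 1))
    rw [aux t ht] at this
    linarith
  · have := mul_le_mul_of_nonneg_right (Real.rpow_le_rpow ht h (by linarith : 0 ≤ r - 1)) hs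
    rw [aux s hs] at this
    linarith

/-- With `y = a + 3Cb`, write `y^r = y^{r-1} y` and use that `y` dominates both `a` and `b`. This
closes the martingale induction: bounds for squared `L^{2r}` norms simply add, up to the factor
`3C`. -/
lemma rpow_add_mul_ge {r C a b : ℝ} (hr : 1 ≤ r) (hC : 1 ≤ C) (ha : 0 < a) (hb : 0 ≤ b) :
    a ^ r + C * (2 * (a ^ (r - 1) * b) + b ^ r) ≤ (a + 3 * C * b) ^ r := by
  have hy : 0 < a + 3 * C * b := by positivity
  have h1 : (a + 3 * C * b) ^ r = (a + 3 * C * b) ^ (r - 1) * (a + 3 * C * b) := by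
    rw [Real.rpow_sub_one hy.ne']; field_simp
  have h2 : a ^ (r - 1) ≤ (a + 3 * C * b) ^ (r - 1) :=
    Real.rpow_le_rpow ha.le (by nlinarith) (by linarith)
  have h3 : b ^ (r - 1) ≤ (a + 3 * C * b) ^ (r - 1) :=
    Real.rpow_le_rpow hb (by nlinarith) (by linarith)
  have h4 : a ^ r = a ^ (r - 1) * a := by rw [Real.rpow_sub_one ha.ne']; field_simp
  have h5 : b ^ r ≤ (a + 3 * C * b) ^ (r - 1) * b := by
    rcases hb.eq_or_lt with rfl | hb'
    · rw [Real.zero_rpow (by linarith)]; simp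
    · have : b ^ r = b ^ (r - 1) * b := by rw [Real.rpow_sub_one hb'.ne']; field_simp
      rw [this]; exact mul_le_mul_of_nonneg_right h3 hb
  have h6 := mul_le_mul_of_nonneg_right h2 hb
  have h7 := mul_le_mul_of_nonneg_right h2 ha.le
  rw [h1, h4]
  nlinarith

end Inequalities

/-! ### Moment bounds for bounded martingales -/

section Martingale

variable {Ω : Type*} {m0 : MeasurableSpace Ω} {μ : Measure Ω} [IsProbabilityMeasure μ]

lemma integrable_sq_rpow_of_bound {r B : ℝ} (hr : 0 ≤ r) {f : Ω → ℝ}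
    (hf : AEStronglyMeasurable f μ) (hb : ∀ᵐ ω ∂μ, |f ω| ≤ B) :
    Integrable (fun ω => (f ω ^ 2) ^ r) μ := by
  refine Integrable.of_bound (C := (B ^ 2) ^ r)
    ((hf.aemeasurable.pow_const 2).pow_const r).aestronglyMeasurable ?_
  filter_upwards [hb] with ω hω
  rw [Real.norm_of_nonneg (Real.rpow_nonneg (sq_nonneg _) _)]
  refine Real.rpow_le_rpow (sq_nonneg _) ?_ hr
  rw [← sq_abs]
  exact pow_le_pow_left₀ (abs_nonneg _) hω 2

/-- One step of the `L^{2r}` bound for a martingale with bounded increments. -/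
lemma integral_add_sq_rpow_le {r a b B : ℝ} (hr : 1 ≤ r) (ha : 0 < a) (hb : 0 ≤ b)
    {m : MeasurableSpace Ω} (hm : m ≤ m0) {T D : Ω → ℝ} (hT : StronglyMeasurable[m] T)
    (hD : AEStronglyMeasurable[m0] D μ) (hTB : ∀ᵐ ω ∂μ, |T ω| ≤ B) (hDB : ∀ᵐ ω ∂μ, |D ω| ≤ B)
    (hmart : μ[D | m] =ᵐ[μ] 0) (hTa : ∫ ω, (T ω ^ 2) ^ r ∂μ ≤ a ^ r)
    (hDb : ∫ ω, (D ω ^ 2) ^ r ∂μ ≤ b ^ r) :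
    ∫ ω, ((T ω + D ω) ^ 2) ^ r ∂μ ≤ (a + 3 * rpowConst r * b) ^ r := by
  have hC := one_le_rpowConst hr
  have hr0 : 0 ≤ r := by linarith
  have hTm : AEStronglyMeasurable[m0] T μ := (hT.mono hm).aestronglyMeasurable
  have iT := integrable_sq_rpow_of_bound hr0 hTm hTB
  have iD := integrable_sq_rpow_of_bound hr0 hD hDB
  -- The case `b = 0` is split off because the cross term below is normalised by `b^r`.
  rcases hb.eq_or_lt with rfl | hb
  · have h0 : ∫ ω, (D ω ^ 2) ^ r ∂μ = 0 := by
      refine le_antisymm (hDb.trans_eq (Real.zero_rpow (by linarith))) ?_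
      exact integral_nonneg fun ω => Real.rpow_nonneg (sq_nonneg _) _
    have h1 := (integral_eq_zero_iff_of_nonneg
      (fun ω => Real.rpow_nonneg (sq_nonneg (D ω)) r) iD).1 h0
    have h2 : ∀ᵐ ω ∂μ, ((T ω + D ω) ^ 2) ^ r = (T ω ^ 2) ^ r := by
      filter_upwards [h1] with ω hω
      have h3 : (D ω ^ 2) ^ r = 0 := hω
      rw [Real.rpow_eq_zero (sq_nonneg _) (by linarith)] at h3
      rw [pow_eq_zero_iff (by norm_num)] at h3
      rw [h3, add_zero]
    rw [integral_congr_ae h2]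
    simpa using hTa
  · have iTD : Integrable (fun ω => (T ω ^ 2) ^ (r - 1) * D ω ^ 2) μ := by
      refine (Integrable.mul_bdd (c := B ^ 2) (integrable_sq_rpow_of_bound (by linarith) hTm hTB)
        (hD.aemeasurable.pow_const 2).aestronglyMeasurable ?_)
      filter_upwards [hDB] with ω hω
      rw [Real.norm_of_nonneg (sq_nonneg _), ← sq_abs]
      exact pow_le_pow_left₀ (abs_nonneg _) hω 2
    have iφ : Integrable (fun ω => (T ω ^ 2) ^ (r - 1) * T ω) μ :=
      (integrable_sq_rpow_of_bound (by linarith) hTm hTB).mul_bdd (c := B) hTm hTB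
    have mφ : StronglyMeasurable[m] (fun ω => (T ω ^ 2) ^ (r - 1) * T ω) := by
      have h := hT.measurable
      exact (((h.pow_const 2).pow_const (r - 1)).mul h).stronglyMeasurable
    have iDD : Integrable D μ := Integrable.of_bound (C := B) hD hDB
    have iφD : Integrable (fun ω => ((T ω ^ 2) ^ (r - 1) * T ω) * D ω) μ :=
      iφ.mul_bdd (c := B) hD hDB
    have h0 : ∫ ω, ((T ω ^ 2) ^ (r - 1) * T ω) * D ω ∂μ = 0 := by
      have h1 := condExp_mul_of_stronglyMeasurable_left mφ iφD iDD
      rw [← integral_condExp hm]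
      have h2 : μ[fun ω => ((T ω ^ 2) ^ (r - 1) * T ω) * D ω | m] =ᵐ[μ] 0 := by
        refine h1.trans ?_
        filter_upwards [hmart] with ω hω
        simp [hω]
      rw [integral_congr_ae h2]; simp
    have hstep : ∫ ω, ((T ω + D ω) ^ 2) ^ r ∂μ ≤ ∫ ω, ((T ω ^ 2) ^ r
        + 2 * r * (((T ω ^ 2) ^ (r - 1) * T ω) * D ω)
        + rpowConst r * ((T ω ^ 2) ^ (r - 1) * D ω ^ 2 + (D ω ^ 2) ^ r)) ∂μ := by
      refine integral_mono_of_nonneg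
        (Eventually.of_forall fun ω => Real.rpow_nonneg (sq_nonneg _) _)
        ((iT.add (iφD.const_mul _)).add ((iTD.add iD).const_mul _))
        (Eventually.of_forall fun ω => ?_)
      refine (add_sq_rpow_le hr (T ω) (D ω)).trans (le_of_eq ?_)
      ring
    -- Young's inequality applied to `T²/a` and `D²/b`, each of whose `r`-th moments is at most one,
    -- replaces Hölder's inequality.
    have hcross : ∫ ω, (T ω ^ 2) ^ (r - 1) * D ω ^ 2 ∂μ ≤ 2 * (a ^ (r - 1) * b) := by
      have hpt : ∀ ω, (T ω ^ 2) ^ (r - 1) * D ω ^ 2 ≤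
          a ^ (r - 1) * b * ((T ω ^ 2) ^ r / a ^ r + (D ω ^ 2) ^ r / b ^ r) := by
        intro ω
        have h := rpow_sub_one_mul_le hr (div_nonneg (sq_nonneg (T ω)) ha.le)
          (div_nonneg (sq_nonneg (D ω)) hb.le)
        rw [Real.div_rpow (sq_nonneg _) ha.le, Real.div_rpow (sq_nonneg _) ha.le,
          Real.div_rpow (sq_nonneg _) hb.le] at h
        have h' := mul_le_mul_of_nonneg_left h
          (by positivity : 0 ≤ a ^ (r - 1) * b)
        refine le_trans (le_of_eq ?_) h'
        have : a ^ (r - 1) ≠ 0 := by positivity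
        field_simp
      calc ∫ ω, (T ω ^ 2) ^ (r - 1) * D ω ^ 2 ∂μ
          ≤ ∫ ω, a ^ (r - 1) * b * ((T ω ^ 2) ^ r / a ^ r + (D ω ^ 2) ^ r / b ^ r) ∂μ :=
            integral_mono iTD (((iT.div_const _).add (iD.div_const _)).const_mul _) hpt
        _ = a ^ (r - 1) * b * ((∫ ω, (T ω ^ 2) ^ r ∂μ) / a ^ r
              + (∫ ω, (D ω ^ 2) ^ r ∂μ) / b ^ r) := by
            rw [integral_const_mul, integral_add (iT.div_const _) (iD.div_const _),
              integral_div, integral_div]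
        _ ≤ a ^ (r - 1) * b * (1 + 1) := by
            have h1 : (∫ ω, (T ω ^ 2) ^ r ∂μ) / a ^ r ≤ 1 := (div_le_one (by positivity)).2 hTa
            have h2 : (∫ ω, (D ω ^ 2) ^ r ∂μ) / b ^ r ≤ 1 := (div_le_one (by positivity)).2 hDb
            gcongr
        _ = _ := by ring
    have heq : ∫ ω, ((T ω ^ 2) ^ r + 2 * r * (((T ω ^ 2) ^ (r - 1) * T ω) * D ω)
        + rpowConst r * ((T ω ^ 2) ^ (r - 1) * D ω ^ 2 + (D ω ^ 2) ^ r)) ∂μ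
        = ∫ ω, (T ω ^ 2) ^ r ∂μ + 2 * r * 0 + rpowConst r *
          (∫ ω, (T ω ^ 2) ^ (r - 1) * D ω ^ 2 ∂μ + ∫ ω, (D ω ^ 2) ^ r ∂μ) := by
      have i1 : Integrable (fun ω => (T ω ^ 2) ^ r
        + 2 * r * (((T ω ^ 2) ^ (r - 1) * T ω) * D ω)) μ := iT.add (iφD.const_mul _)
      have i2 : Integrable (fun ω => rpowConst r *
        ((T ω ^ 2) ^ (r - 1) * D ω ^ 2 + (D ω ^ 2) ^ r)) μ := (iTD.add iD).const_mul _
      rw [integral_add i1 i2, integral_add iT (iφD.const_mul _), integral_const_mul, integral_const_mul,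
        integral_add iTD iD, h0]
    rw [heq] at hstep
    refine hstep.trans ?_
    have := rpow_add_mul_ge hr hC ha hb.le
    have h3 : rpowConst r * (∫ ω, (T ω ^ 2) ^ (r - 1) * D ω ^ 2 ∂μ + ∫ ω, (D ω ^ 2) ^ r ∂μ)
        ≤ rpowConst r * (2 * (a ^ (r - 1) * b) + b ^ r) :=
      mul_le_mul_of_nonneg_left (by linarith) (by linarith)
    linarith

/-- `L^{2r}` bound for a bounded martingale in terms of its increments. -/
lemma integral_condExp_sub_sq_rpow_le {r η B : ℝ} (hr : 1 ≤ r) (hη : 0 < η)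
    (ℱ : Filtration ℕ m0) (hbot : ℱ 0 = ⊥) {S : Ω → ℝ} (hS : AEStronglyMeasurable S μ)
    (hSB : ∀ ω, |S ω| ≤ B) {σ : ℕ → ℝ} (hσ : ∀ k, 0 ≤ σ k)
    (hD : ∀ k, ∫ ω, ((μ[S | ℱ (k + 1)] ω - μ[S | ℱ k] ω) ^ 2) ^ r ∂μ ≤ (σ k) ^ r) (N : ℕ) :
    ∫ ω, ((μ[S | ℱ N] ω - ∫ ω', S ω' ∂μ) ^ 2) ^ r ∂μ
      ≤ (η + 3 * rpowConst r * ∑ k ∈ Finset.range N, σ k) ^ r := by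
  have hSi : Integrable S μ := Integrable.of_bound (C := B) hS (Eventually.of_forall hSB)
  have hcb : ∀ k, ∀ᵐ ω ∂μ, |μ[S | ℱ k] ω| ≤ B := fun k =>
    ae_bdd_abs_condExp_of_ae_bdd_abs (Eventually.of_forall hSB)
  have hmb : |∫ ω', S ω' ∂μ| ≤ B := by
    have := norm_integral_le_of_norm_le_const (μ := μ) (f := S) (Eventually.of_forall hSB)
    simpa using this
  induction N with
  | zero =>
    rw [hbot, condExp_bot]
    -- At time `0` the centred martingale vanishes; `η` is there only because the one-step bound
    -- divides by `a`, which must be positive from the start.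
    simp only [sub_self, ne_eq, OfNat.ofNat_ne_zero, not_false_eq_true, zero_pow,
      Finset.range_zero, Finset.sum_empty, mul_zero, add_zero]
    rw [Real.zero_rpow (by linarith)]
    simp only [integral_zero]
    positivity
  | succ N ih =>
    have hC := one_le_rpowConst hr
    have hsum : 0 ≤ ∑ k ∈ Finset.range N, σ k := Finset.sum_nonneg fun k _ => hσ k
    have h := integral_add_sq_rpow_le (B := 2 * B) (μ := μ)
      (T := fun ω => μ[S | ℱ N] ω - ∫ ω', S ω' ∂μ)
      (D := fun ω => μ[S | ℱ (N + 1)] ω - μ[S | ℱ N] ω) hr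
      (by positivity : 0 < η + 3 * rpowConst r * ∑ k ∈ Finset.range N, σ k) (hσ N) (ℱ.le N)
      (stronglyMeasurable_condExp.sub stronglyMeasurable_const)
      ((integrable_condExp (m := ℱ (N + 1)) (f := S)).sub
        (integrable_condExp (m := ℱ N) (f := S))).aestronglyMeasurable ?_ ?_ ?_ ih (hD N)
    · rw [Finset.sum_range_succ]
      refine le_trans (le_of_eq ?_) (h.trans (le_of_eq ?_))
      · congr 1; ext ω; congr 2; ring
      · congr 1; ring
    · filter_upwards [hcb N] with ω h1
      have := abs_sub (μ[S | ℱ N] ω) (∫ ω', S ω' ∂μ)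
      linarith
    · filter_upwards [hcb N, hcb (N + 1)] with ω h1 h2
      have := abs_sub (μ[S | ℱ (N + 1)] ω) (μ[S | ℱ N] ω)
      linarith
    · have h1 := condExp_sub (μ := μ) (integrable_condExp (m := ℱ (N + 1)) (f := S))
        (integrable_condExp (m := ℱ N) (f := S)) (ℱ N)
      have h2 := condExp_condExp_of_le (μ := μ) (f := S) (ℱ.mono (Nat.le_succ N)) (ℱ.le (N + 1))
      have h3 := condExp_condExp_of_le (μ := μ) (f := S) (le_refl (ℱ N)) (ℱ.le N)
      refine h1.trans ?_
      filter_upwards [h2, h3] with ω h2 h3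
      simp only [Pi.sub_apply, Pi.zero_apply]
      rw [h2, h3, sub_self]

end Martingale

/-! ### An Efron–Stein inequality in `L^q` -/

section EfronStein

variable {Ω : Type*} {m0 : MeasurableSpace Ω} {μ : Measure Ω} [IsProbabilityMeasure μ]

lemma sq_rpow_half (x q : ℝ) : (x ^ 2) ^ (q / 2) = |x| ^ q := by
  rw [← sq_abs, ← Real.rpow_natCast, ← Real.rpow_mul (abs_nonneg x)]
  congr 1; push_cast; ring

lemma eLpNorm_le_ofReal_iff {q σ B : ℝ} (hq : 1 ≤ q) (hσ : 0 ≤ σ) {f : Ω → ℝ}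
    (hf : AEStronglyMeasurable f μ) (hb : ∀ᵐ ω ∂μ, |f ω| ≤ B) :
    eLpNorm f (ENNReal.ofReal q) μ ≤ ENNReal.ofReal σ ↔
      ∫ ω, (f ω ^ 2) ^ (q / 2) ∂μ ≤ (σ ^ 2) ^ (q / 2) := by
  have hmem : MemLp f (ENNReal.ofReal q) μ := MemLp.of_bound hf B hb
  have hq0 : 0 < q := by linarith
  have hp : ENNReal.ofReal q ≠ 0 := by simpa using hq0
  rw [hmem.eLpNorm_eq_integral_rpow_norm hp ENNReal.ofReal_ne_top,
    ENNReal.ofReal_le_ofReal_iff hσ, ENNReal.toReal_ofReal hq0.le]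
  have h0 : 0 ≤ ∫ ω, ‖f ω‖ ^ q ∂μ := integral_nonneg fun ω => Real.rpow_nonneg (norm_nonneg _) _
  rw [Real.rpow_inv_le_iff_of_pos h0 hσ hq0]
  simp only [sq_rpow_half, abs_of_nonneg hσ, Real.norm_eq_abs]

/-- The σ-algebra generated by the `e l` with `l ∈ s`. -/
abbrev sigmaOf {ι : Type*} (e : ι → Ω → ℝ) (s : Set ι) : MeasurableSpace Ω :=
  ⨆ l ∈ s, MeasurableSpace.comap (e l) inferInstance

lemma sigmaOf_le {ι : Type*} {e : ι → Ω → ℝ} (he : ∀ l, Measurable (e l)) (s : Set ι) :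
    sigmaOf e s ≤ m0 :=
  iSup₂_le fun l _ => (he l).comap_le

lemma sigmaOf_mono {ι : Type*} (e : ι → Ω → ℝ) {s t : Set ι} (h : s ⊆ t) :
    sigmaOf e s ≤ sigmaOf e t :=
  biSup_mono h

lemma measurable_sigmaOf {ι : Type*} (e : ι → Ω → ℝ) {s : Set ι} {l : ι} (hl : l ∈ s) :
    Measurable[sigmaOf e s] (e l) := by
  have h : MeasurableSpace.comap (e l) inferInstance ≤ sigmaOf e s :=
    le_iSup₂_of_le (f := fun l (_ : l ∈ s) => MeasurableSpace.comap (e l) inferInstance) l hl le_rfl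
  exact (comap_measurable (e l)).mono h le_rfl

lemma indep_sigmaOf {ι : Type*} {e : ι → Ω → ℝ} (he : ∀ l, Measurable (e l))
    (hind : iIndepFun e μ) {s t : Set ι} (h : Disjoint s t) :
    Indep (sigmaOf e s) (sigmaOf e t) μ :=
  indep_iSup_of_disjoint (fun l => (he l).comap_le) hind h

/-- The filtration generated by a sequence, shifted so that it starts with the trivial
σ-algebra. -/
def pastFiltration (e : ℕ → Ω → ℝ) (he : ∀ l, Measurable (e l)) : Filtration ℕ m0 where
  seq k := sigmaOf e {l | l < k}
  mono' _ _ hjk := sigmaOf_mono e fun _ hl => lt_of_lt_of_le hl hjk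
  le' _ := sigmaOf_le he _

/-- An `L^q` version of the Efron–Stein inequality for bounded functions of independent
variables. -/
lemma eLpNorm_sub_integral_le_of_indep {q η B : ℝ} (hq : 2 ≤ q) (hη : 0 < η) {e : ℕ → Ω → ℝ}
    (he : ∀ l, Measurable (e l)) (hind : iIndepFun e μ) {N : ℕ} {S : Ω → ℝ}
    (hS : StronglyMeasurable[sigmaOf e {l | l < N}] S) (hSB : ∀ ω, |S ω| ≤ B) {W : ℕ → Ω → ℝ}
    (hW : ∀ k, StronglyMeasurable[sigmaOf e {l | l ≠ k}] (W k)) (hWB : ∀ k ω, |W k ω| ≤ B)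
    {σ : ℕ → ℝ} (hσ : ∀ k, 0 ≤ σ k)
    (hSW : ∀ k, eLpNorm (fun ω => S ω - W k ω) (ENNReal.ofReal q) μ ≤ ENNReal.ofReal (σ k)) :
    eLpNorm (fun ω => S ω - ∫ ω', S ω' ∂μ) (ENNReal.ofReal q) μ ≤
      ENNReal.ofReal (Real.sqrt
        (η + 12 * rpowConst (q / 2) * ∑ k ∈ Finset.range N, σ k ^ 2)) := by
  set ℱ := pastFiltration e he with hℱ
  have hq1 : 1 ≤ q := by linarith
  have hC := one_le_rpowConst (by linarith : 1 ≤ q / 2)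
  have hp1 : 1 ≤ ENNReal.ofReal q := by
    rw [← ENNReal.ofReal_one]; exact ENNReal.ofReal_le_ofReal hq1
  have hSm : AEStronglyMeasurable[m0] S μ := (hS.mono (sigmaOf_le he _)).aestronglyMeasurable
  have hWm : ∀ k, AEStronglyMeasurable[m0] (W k) μ := fun k =>
    ((hW k).mono (sigmaOf_le he _)).aestronglyMeasurable
  have hSi : Integrable S μ := Integrable.of_bound (C := B) hSm (Eventually.of_forall hSB)
  have hWi : ∀ k, Integrable (W k) μ := fun k =>
    Integrable.of_bound (C := B) (hWm k) (Eventually.of_forall (hWB k))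
  have hcb : ∀ k, ∀ᵐ ω ∂μ, |μ[S | ℱ k] ω| ≤ B := fun k =>
    ae_bdd_abs_condExp_of_ae_bdd_abs (Eventually.of_forall hSB)
  have hbot : ℱ 0 = ⊥ := by
    change sigmaOf e {l | l < 0} = ⊥
    simp [sigmaOf]
  have hsucc : ∀ k, ℱ (k + 1) = ℱ k ⊔ sigmaOf e {k} := by
    intro k
    change sigmaOf e {l | l < k + 1} = sigmaOf e {l | l < k} ⊔ sigmaOf e {k}
    rw [sigmaOf, sigmaOf, sigmaOf, ← iSup_union]
    congr! 3 with l
    simp only [Set.mem_ofPred_eq, Set.union_singleton, Set.mem_insert_iff]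
    omega
  have hDk : ∀ k, eLpNorm (fun ω => μ[S | ℱ (k + 1)] ω - μ[S | ℱ k] ω) (ENNReal.ofReal q) μ
      ≤ ENNReal.ofReal (2 * σ k) := by
    intro k
    -- `W k` does not involve `e k`, so revealing `e k` does not change its prediction. The
    -- martingale increment of `S` is thus that of `S - W k`, of `L^q` norm at most `2 σ k`; this is
    -- the source of `12 = 3 · 2²` in the statement.
    have hWeq : μ[W k | ℱ (k + 1)] =ᵐ[μ] μ[W k | ℱ k] := by
      rw [hsucc k]
      refine condExp_sup_of_indep (sigmaOf_le he {l | l ≠ k}) (sigmaOf_le he {k}) ?_ ?_ (hW k)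
        (hWi k)
      · exact sigmaOf_mono e fun l hl => ne_of_lt hl
      · exact indep_sigmaOf he hind (by simp)
    have h1 := condExp_sub (μ := μ) hSi (hWi k) (ℱ (k + 1))
    have h2 := condExp_sub (μ := μ) hSi (hWi k) (ℱ k)
    have h3 : (fun ω => μ[S | ℱ (k + 1)] ω - μ[S | ℱ k] ω) =ᵐ[μ]
        (μ[S - W k | ℱ (k + 1)] - μ[S - W k | ℱ k]) := by
      filter_upwards [h1, h2, hWeq] with ω h1 h2 h3
      simp only [Pi.sub_apply] at h1 h2 ⊢
      rw [h1, h2, h3]; ring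
    rw [eLpNorm_congr_ae h3]
    refine (eLpNorm_sub_le integrable_condExp.aestronglyMeasurable
      integrable_condExp.aestronglyMeasurable hp1).trans ?_
    rw [two_mul, ENNReal.ofReal_add (hσ k) (hσ k)]
    exact add_le_add ((eLpNorm_condExp_le_eLpNorm _ hp1).trans (hSW k))
      ((eLpNorm_condExp_le_eLpNorm _ hp1).trans (hSW k))
  have hD' : ∀ k, ∫ ω, ((μ[S | ℱ (k + 1)] ω - μ[S | ℱ k] ω) ^ 2) ^ (q / 2) ∂μ
      ≤ (4 * σ k ^ 2) ^ (q / 2) := by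
    intro k
    have h := (eLpNorm_le_ofReal_iff (B := 2 * B) hq1 (mul_nonneg zero_le_two (hσ k))
      ((integrable_condExp (m := ℱ (k + 1)) (f := S)).sub
        (integrable_condExp (m := ℱ k) (f := S))).aestronglyMeasurable ?_).1 (hDk k)
    · refine h.trans (le_of_eq ?_)
      congr 1; ring
    · filter_upwards [hcb k, hcb (k + 1)] with ω h1 h2
      have := abs_sub (μ[S | ℱ (k + 1)] ω) (μ[S | ℱ k] ω)
      simp only [Pi.sub_apply]
      linarith
  have hmain := integral_condExp_sub_sq_rpow_le (by linarith : 1 ≤ q / 2) hη ℱ hbot hSm hSB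
    (σ := fun k => 4 * σ k ^ 2) (fun k => by positivity) hD' N
  have hSN : μ[S | ℱ N] = S := condExp_of_stronglyMeasurable (ℱ.le N) hS hSi
  rw [hSN] at hmain
  have hmb : |∫ ω', S ω' ∂μ| ≤ B := by
    have := norm_integral_le_of_norm_le_const (μ := μ) (f := S) (Eventually.of_forall hSB)
    simpa using this
  have hsum : 0 ≤ ∑ k ∈ Finset.range N, σ k ^ 2 := Finset.sum_nonneg fun k _ => sq_nonneg _
  refine (eLpNorm_le_ofReal_iff (B := 2 * B) hq1 (Real.sqrt_nonneg _)
    (hSm.sub aestronglyMeasurable_const) ?_).2 ?_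
  rotate_left
  · rw [Real.sq_sqrt (by positivity)]
    refine hmain.trans (le_of_eq ?_)
    rw [← Finset.mul_sum]; congr 1; ring
  · refine Eventually.of_forall fun ω => ?_
    have := abs_sub (S ω) (∫ ω', S ω' ∂μ)
    change |S ω - ∫ ω', S ω' ∂μ| ≤ 2 * B
    linarith [hSB ω]

end EfronStein

/-! ### Sums of Hölder functions along a linear process -/

section LinearSums

variable {Ω : Type*} {m0 : MeasurableSpace Ω} {μ : Measure Ω} [IsProbabilityMeasure μ]

/-- At most one `m` satisfies `c = k + 1 + m`, so the two arguments of `h` differ in at most one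
summand. The condition expresses `c - 1 - m = k` without truncated subtraction. -/
lemma abs_sub_le_sum_ite {h : ℝ → ℝ} {H γ : ℝ} (hH : 0 ≤ H) 
    (hh : ∀ x y, |h x - h y| ≤ H * |x - y| ^ γ) (J c : ℕ) (k : ℕ) (b z : ℕ → ℝ) :
    |h (∑ m ∈ Finset.range J, b m * z m)
      - h (∑ m ∈ Finset.range J, if c = k + 1 + m then 0 else b m * z m)|
      ≤ ∑ m ∈ Finset.range J, if c = k + 1 + m then H * (|b m| ^ γ * |z m| ^ γ) else 0 := by
  by_cases hex : ∃ m ∈ Finset.range J, c = k + 1 + m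
  · obtain ⟨m, hm, hc⟩ := hex
    have hne : ∀ i, i ≠ m → c ≠ k + 1 + i := fun i hi h => hi (by omega)
    rw [Finset.sum_eq_single_of_mem (f := fun m => if c = k + 1 + m then
      H * (|b m| ^ γ * |z m| ^ γ) else 0) m hm (fun i _ hi => if_neg (hne i hi)), if_pos hc]
    refine (hh _ _).trans (le_of_eq ?_)
    rw [← Real.mul_rpow (abs_nonneg _) (abs_nonneg _), ← abs_mul, ← Finset.sum_sub_distrib,
      Finset.sum_eq_single_of_mem m hm, if_pos hc, sub_zero]
    intro i _ hi
    rw [if_neg (hne i hi), sub_self]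
  · push Not at hex
    have h1 : ∑ m ∈ Finset.range J, (if c = k + 1 + m then 0 else b m * z m)
        = ∑ m ∈ Finset.range J, b m * z m :=
      Finset.sum_congr rfl fun m hm => if_neg (hex m hm)
    rw [h1, sub_self, abs_zero]
    refine Finset.sum_nonneg fun m _ => ?_
    split_ifs <;> positivity

/-- A Schur-type estimate for a Toeplitz array: once `k` and `m` (or `j` and `m`) are fixed, the
remaining index is determined. Hence each row sum is at most `∑ β`, the total is at most `n ∑ β`,
and `∑ σ² ≤ (max σ) ∑ σ`. -/
lemma sum_sq_le_of_shift (β : ℕ → ℝ) (hβ : ∀ m, 0 ≤ β m) (hs : Summable β) (n J N : ℕ) :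
    ∑ k ∈ Finset.range N, (∑ j ∈ Finset.range n, ∑ m ∈ Finset.range J,
      if j + J = k + 1 + m then β m else 0) ^ 2 ≤ n * (∑' m, β m) ^ 2 := by
  set Θ := ∑' m, β m with hΘ
  have hΘ0 : 0 ≤ Θ := tsum_nonneg hβ
  have hJ : ∑ m ∈ Finset.range J, β m ≤ Θ := hs.sum_le_tsum _ fun m _ => hβ m
  set σ : ℕ → ℝ := fun k => ∑ j ∈ Finset.range n, ∑ m ∈ Finset.range J,
      if j + J = k + 1 + m then β m else 0 with hσ
  have hσ0 : ∀ k, 0 ≤ σ k := fun k => Finset.sum_nonneg fun j _ => Finset.sum_nonneg fun m _ => by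
    split_ifs <;> simp [hβ]
  have one : ∀ (s : Finset ℕ) (m : ℕ) (p : ℕ → Prop) [DecidablePred p],
      (∀ x y, p x → p y → x = y) → ∑ x ∈ s, (if p x then β m else 0) ≤ β m := by
    intro s m p _ hp
    rw [← Finset.sum_filter, Finset.sum_const]
    have : (s.filter p).card ≤ 1 := Finset.card_le_one.2 fun x hx y hy =>
      hp x y (Finset.mem_filter.1 hx).2 (Finset.mem_filter.1 hy).2
    have h2 : ((s.filter p).card : ℝ) ≤ 1 := by exact_mod_cast this
    rw [nsmul_eq_mul]
    nlinarith [hβ m]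
  have hmax : ∀ k, σ k ≤ Θ := by
    intro k
    simp only [hσ]
    rw [Finset.sum_comm]
    exact (Finset.sum_le_sum fun m _ => one _ m _ (fun x y hx hy => by omega)).trans hJ
  have htot : ∑ k ∈ Finset.range N, σ k ≤ n * Θ := by
    simp only [hσ]
    rw [Finset.sum_comm]
    calc _ ≤ ∑ j ∈ Finset.range n, Θ := by
          refine Finset.sum_le_sum fun j _ => ?_
          rw [Finset.sum_comm]
          exact (Finset.sum_le_sum fun m _ => one _ m _ (fun x y hx hy => by omega)).trans hJ
      _ = n * Θ := by simp
  calc ∑ k ∈ Finset.range N, σ k ^ 2 ≤ ∑ k ∈ Finset.range N, Θ * σ k := by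
        refine Finset.sum_le_sum fun k _ => ?_
        rw [sq]; exact mul_le_mul_of_nonneg_right (hmax k) (hσ0 k)
    _ = Θ * ∑ k ∈ Finset.range N, σ k := by rw [Finset.mul_sum]
    _ ≤ Θ * (n * Θ) := mul_le_mul_of_nonneg_left htot hΘ0
    _ = _ := by ring

/-- The constant in the moment bound for sums of functions of a linear process. -/
def momentConst (q c Θ : ℝ) : ℝ := Real.sqrt (1 + 12 * rpowConst (q / 2) * (c * Θ) ^ 2)

/-- Efron–Stein, where `W k` is obtained by setting the `k`-th innovation to zero in every summand.
Truncation at `J` terms leaves finitely many innovations, relabelled from `0` to `n + J - 1`. -/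
lemma eLpNorm_truncated_sum_le {q γ H A : ℝ} (hq : 2 ≤ q) (hH : 0 ≤ H) (hA : 0 ≤ A)
    {ε : ℤ → Ω → ℝ} (hε : ∀ k, Measurable (ε k)) (hind : iIndepFun ε μ)
    (hεA : ∀ k, eLpNorm (fun ω => |ε k ω| ^ γ) (ENNReal.ofReal q) μ ≤ ENNReal.ofReal A)
    {b : ℕ → ℝ} (hb : Summable fun m => |b m| ^ γ) {h : ℝ → ℝ} (hm : Measurable h)
    (hhH : ∀ x, |h x| ≤ H) (hh : ∀ x y, |h x - h y| ≤ H * |x - y| ^ γ) (s n J : ℕ) (hn : 0 < n) :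
    eLpNorm (fun ω => ∑ j ∈ Finset.range n,
        h (∑ m ∈ Finset.range J, b m * ε (((s + j : ℕ) : ℤ) - 1 - m) ω)
      - ∫ ω', ∑ j ∈ Finset.range n,
        h (∑ m ∈ Finset.range J, b m * ε (((s + j : ℕ) : ℤ) - 1 - m) ω') ∂μ)
      (ENNReal.ofReal q) μ
      ≤ ENNReal.ofReal (momentConst q (H * A) (∑' m, |b m| ^ γ) * Real.sqrt n) := by
  have hp1 : 1 ≤ ENNReal.ofReal q := by
    rw [← ENNReal.ofReal_one]; exact ENNReal.ofReal_le_ofReal (by linarith)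
  set e : ℕ → Ω → ℝ := fun l => ε ((s : ℤ) - J + l) with he
  have hem : ∀ l, Measurable (e l) := fun l => hε _
  have hinj : Function.Injective (fun l : ℕ => (s : ℤ) - J + l) := fun x y hxy => by
    simp only at hxy; omega
  have heind : iIndepFun e μ := hind.precomp hinj
  have hidx : ∀ j m : ℕ, m < J → ε (((s + j : ℕ) : ℤ) - 1 - m) = e (j + J - 1 - m) := by
    intro j m hmJ
    simp only [he]
    congr 1
    omega
  set σ : ℕ → ℝ := fun k => ∑ j ∈ Finset.range n, ∑ m ∈ Finset.range J,
    if j + J = k + 1 + m then (H * A) * |b m| ^ γ else 0 with hσ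
  have hterm : ∀ k j m : ℕ, 0 ≤ (if j + J = k + 1 + m then (H * A) * |b m| ^ γ else 0) := by
    intro k j m; split_ifs <;> positivity
  have hσ0 : ∀ k, 0 ≤ σ k := fun k => Finset.sum_nonneg fun j _ => Finset.sum_nonneg fun m _ =>
    hterm k j m
  set S : Ω → ℝ := fun ω => ∑ j ∈ Finset.range n,
    h (∑ m ∈ Finset.range J, b m * ε (((s + j : ℕ) : ℤ) - 1 - m) ω) with hS
  set W : ℕ → Ω → ℝ := fun k ω => ∑ j ∈ Finset.range n,
    h (∑ m ∈ Finset.range J, if j + J = k + 1 + m then 0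
      else b m * ε (((s + j : ℕ) : ℤ) - 1 - m) ω) with hW
  have hbd : ∀ g : ℕ → ℝ, |∑ j ∈ Finset.range n, h (g j)| ≤ n * H := by
    intro g
    refine (Finset.abs_sum_le_sum_abs _ _).trans ?_
    refine (Finset.sum_le_sum fun j _ => hhH (g j)).trans (le_of_eq (by simp))
  have hSm : Measurable[sigmaOf e {l | l < n + J}] S := by
    refine Finset.measurable_fun_sum _ fun j hj => hm.comp ?_
    refine Finset.measurable_fun_sum _ fun m hmJ => ?_
    rw [Finset.mem_range] at hj hmJ
    rw [hidx j m hmJ]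
    exact (measurable_sigmaOf e (by simp only [Set.mem_ofPred_eq]; omega)).const_mul _
  have hWm : ∀ k, Measurable[sigmaOf e {l | l ≠ k}] (W k) := by
    intro k
    refine Finset.measurable_fun_sum _ fun j hj => hm.comp ?_
    refine Finset.measurable_fun_sum _ fun m hmJ => ?_
    rw [Finset.mem_range] at hj hmJ
    split_ifs with hc
    · exact measurable_const
    · rw [hidx j m hmJ]
      exact (measurable_sigmaOf e (by simp only [Set.mem_ofPred_eq]; omega)).const_mul _
  have hSW : ∀ k, eLpNorm (fun ω => S ω - W k ω) (ENNReal.ofReal q) μ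
      ≤ ENNReal.ofReal (σ k) := by
    intro k
    set f : ℕ → ℕ → Ω → ℝ := fun j m ω => if j + J = k + 1 + m then
      H * (|b m| ^ γ * |ε (((s + j : ℕ) : ℤ) - 1 - m) ω| ^ γ) else 0 with hf
    have hfm : ∀ j m, AEStronglyMeasurable (f j m) μ := by
      intro j m
      simp only [hf]
      split_ifs
      · exact ((((hε _).norm.pow_const γ).const_mul _).const_mul _).aestronglyMeasurable
      · exact aestronglyMeasurable_const
    have h1 : eLpNorm (fun ω => S ω - W k ω) (ENNReal.ofReal q) μ ≤
        eLpNorm (∑ j ∈ Finset.range n, ∑ m ∈ Finset.range J, f j m) (ENNReal.ofReal q) μ := by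
      refine eLpNorm_mono_real fun ω => ?_
      simp only [hS, hW, Finset.sum_apply, Real.norm_eq_abs]
      rw [← Finset.sum_sub_distrib]
      refine (Finset.abs_sum_le_sum_abs _ _).trans (Finset.sum_le_sum fun j _ => ?_)
      exact abs_sub_le_sum_ite hH hh J (j + J) k b _
    refine h1.trans ?_
    refine (eLpNorm_sum_le (fun j _ => Finset.aestronglyMeasurable_sum _ fun m _ => hfm j m)
      hp1).trans ?_
    simp only [hσ]
    rw [ENNReal.ofReal_sum_of_nonneg (fun j _ => Finset.sum_nonneg fun m _ => hterm k j m)]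
    refine Finset.sum_le_sum fun j _ => ?_
    refine (eLpNorm_sum_le (fun m _ => hfm j m) hp1).trans ?_
    rw [ENNReal.ofReal_sum_of_nonneg (fun m _ => hterm k j m)]
    refine Finset.sum_le_sum fun m _ => ?_
    simp only [hf]
    split_ifs
    · have : (fun ω => H * (|b m| ^ γ * |ε (((s + j : ℕ) : ℤ) - 1 - m) ω| ^ γ))
          = (H * |b m| ^ γ) • fun ω => |ε (((s + j : ℕ) : ℤ) - 1 - m) ω| ^ γ := by
        ext ω; simp [mul_assoc]
      rw [this, eLpNorm_const_smul, Real.enorm_of_nonneg (by positivity)]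
      refine (mul_le_mul_right (hεA _) _).trans (le_of_eq ?_)
      rw [← ENNReal.ofReal_mul (by positivity)]
      congr 1; ring
    · simp
  -- Taking `η = n` lets `√n` factor out exactly; it is the `1` under the root in `momentConst`.
  have hmain := eLpNorm_sub_integral_le_of_indep hq (η := n) (B := n * H) (by exact_mod_cast hn)
    hem heind (N := n + J) hSm.stronglyMeasurable (fun ω => hbd _)
    (fun k => (hWm k).stronglyMeasurable) (fun k ω => hbd _) hσ0 hSW
  refine hmain.trans (ENNReal.ofReal_le_ofReal ?_)
  have hC := one_le_rpowConst (by linarith : 1 ≤ q / 2)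
  have hsq := sum_sq_le_of_shift (fun m => (H * A) * |b m| ^ γ) (fun m => by positivity)
    (hb.mul_left _) n J (n + J)
  rw [tsum_mul_left] at hsq
  rw [momentConst, ← Real.sqrt_mul (by positivity)]
  apply Real.sqrt_le_sqrt
  have := mul_le_mul_of_nonneg_left hsq (by positivity : 0 ≤ 12 * rpowConst (q / 2))
  refine (add_le_add_right this _).trans (le_of_eq ?_)
  ring

/-- `L^q` bound for the centred partial sums `∑ h(Y_i)` along a causal linear process, for
bounded Hölder functions `h`. -/
lemma eLpNorm_sum_comp_linear_le {q γ H A : ℝ} (hq : 2 ≤ q) (hH : 0 ≤ H) (hA : 0 ≤ A)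
    {ε Y : ℤ → Ω → ℝ} (hε : ∀ k, Measurable (ε k)) (hind : iIndepFun ε μ)
    (hεA : ∀ k, eLpNorm (fun ω => |ε k ω| ^ γ) (ENNReal.ofReal q) μ ≤ ENNReal.ofReal A)
    {b : ℕ → ℝ} (hb : Summable fun m => |b m| ^ γ)
    (hY : ∀ i, ∀ᵐ ω ∂μ, Tendsto (fun J : ℕ => ∑ m ∈ Finset.range J, b m * ε (i - 1 - m) ω)
      atTop (𝓝 (Y i ω)))
    {h : ℝ → ℝ} (hcont : Continuous h)
    (hhH : ∀ x, |h x| ≤ H) (hh : ∀ x y, |h x - h y| ≤ H * |x - y| ^ γ) (s n : ℕ) :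
    eLpNorm (fun ω => ∑ j ∈ Finset.range n, h (Y ((s + j : ℕ) : ℤ) ω)
      - ∫ ω', ∑ j ∈ Finset.range n, h (Y ((s + j : ℕ) : ℤ) ω') ∂μ) (ENNReal.ofReal q) μ
      ≤ ENNReal.ofReal (momentConst q (H * A) (∑' m, |b m| ^ γ) * Real.sqrt n) := by
  rcases Nat.eq_zero_or_pos n with rfl | hn
  · simp
  set S : ℕ → Ω → ℝ := fun J ω => ∑ j ∈ Finset.range n,
    h (∑ m ∈ Finset.range J, b m * ε (((s + j : ℕ) : ℤ) - 1 - m) ω) with hS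
  have hSm : ∀ J, AEStronglyMeasurable (S J) μ := by
    intro J
    refine (Finset.measurable_fun_sum _ fun j _ => hcont.measurable.comp ?_).aestronglyMeasurable
    exact Finset.measurable_fun_sum _ fun m _ => (hε _).const_mul _
  have hbd : ∀ g : ℕ → ℝ, |∑ j ∈ Finset.range n, h (g j)| ≤ n * H := by
    intro g
    refine (Finset.abs_sum_le_sum_abs _ _).trans ?_
    refine (Finset.sum_le_sum fun j _ => hhH (g j)).trans (le_of_eq (by simp))
  have hlim : ∀ᵐ ω ∂μ, Tendsto (fun J => S J ω) atTop
      (𝓝 (∑ j ∈ Finset.range n, h (Y ((s + j : ℕ) : ℤ) ω))) := by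
    filter_upwards [ae_all_iff.2 hY] with ω hω
    exact tendsto_finsetSum _ fun j _ => (hcont.tendsto _).comp (hω _)
  have hint : Tendsto (fun J => ∫ ω, S J ω ∂μ) atTop
      (𝓝 (∫ ω, ∑ j ∈ Finset.range n, h (Y ((s + j : ℕ) : ℤ) ω) ∂μ)) :=
    tendsto_integral_of_dominated_convergence (fun _ => n * H) hSm (integrable_const _)
      (fun J => Eventually.of_forall fun ω => hbd _) hlim
  -- The truncated bound does not depend on `J`, so Fatou's lemma transfers it to the full series.
  refine (Lp.eLpNorm_lim_le_liminf_eLpNorm (f := fun J ω => S J ω - ∫ ω', S J ω' ∂μ)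
    (fun J => (hSm J).sub aestronglyMeasurable_const) _ ?_).trans ?_
  · filter_upwards [hlim] with ω hω using hω.sub hint
  · refine Filter.liminf_le_of_le (by isBoundedDefault) ?_
    intro B hB
    obtain ⟨J, hJ⟩ := hB.exists
    exact hJ.trans (eLpNorm_truncated_sum_le hq hH hA hε hind hεA hb hcont.measurable hhH hh s n J
      hn)

end LinearSums

/-! ### Exponential bounds for martingale sums -/

section Exponential

variable {Ω : Type*} {m0 : MeasurableSpace Ω} {μ : Measure Ω} [IsProbabilityMeasure μ]

/-- Bernstein's argument: `e^y ≤ 1 + y + y²` for `|y| ≤ 1`, the linear term has mean zero, and `1 +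
y ≤ e^y`. -/
lemma lintegral_exp_mul_le {P : Measure ℝ} [IsProbabilityMeasure P] {g : ℝ → ℝ} {t v : ℝ}
    (hg : Measurable g) (hb : ∀ e, |g e| ≤ 1) (h0 : ∫ e, g e ∂P = 0) (hv : ∫ e, g e ^ 2 ∂P ≤ v)
    (ht : |t| ≤ 1) :
    ∫⁻ e, ENNReal.ofReal (Real.exp (t * g e)) ∂P ≤ ENNReal.ofReal (Real.exp (t ^ 2 * v)) := by
  have habs : ∀ e, |t * g e| ≤ 1 := fun e => by
    rw [abs_mul]; exact mul_le_one₀ ht (abs_nonneg _) (hb e)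
  have hi : Integrable g P :=
    Integrable.of_bound (C := 1) hg.aestronglyMeasurable (Eventually.of_forall hb)
  have hi2 : Integrable (fun e => g e ^ 2) P := by
    refine Integrable.of_bound (C := 1) (hg.pow_const 2).aestronglyMeasurable
      (Eventually.of_forall fun e => ?_)
    rw [Real.norm_of_nonneg (sq_nonneg _), ← sq_abs]
    exact pow_le_one₀ (abs_nonneg _) (hb e)
  have hie : Integrable (fun e => Real.exp (t * g e)) P := by
    refine Integrable.of_bound (C := Real.exp 1)
      (Real.measurable_exp.comp (hg.const_mul t)).aestronglyMeasurable
      (Eventually.of_forall fun e => ?_)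
    rw [Real.norm_of_nonneg (Real.exp_pos _).le, Real.exp_le_exp]
    exact (abs_le.1 (habs e)).2
  have i1 : Integrable (fun e => 1 + t * g e) P := (integrable_const 1).add (hi.const_mul t)
  rw [← ofReal_integral_eq_lintegral_ofReal hie
    (Eventually.of_forall fun e => (Real.exp_pos _).le)]
  apply ENNReal.ofReal_le_ofReal
  calc ∫ e, Real.exp (t * g e) ∂P ≤ ∫ e, (1 + t * g e + t ^ 2 * g e ^ 2) ∂P := by
        refine integral_mono hie (i1.add (hi2.const_mul _)) fun e => ?_
        have := (abs_le.1 (Real.abs_exp_sub_one_sub_id_le (habs e))).2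
        simp only
        nlinarith
    _ = 1 + t ^ 2 * ∫ e, g e ^ 2 ∂P := by
        rw [integral_add i1 (hi2.const_mul _), integral_add (integrable_const 1) (hi.const_mul t),
          integral_const_mul, integral_const_mul, h0]
        simp
    _ ≤ 1 + t ^ 2 * v := by
        have := mul_le_mul_of_nonneg_left hv (sq_nonneg t)
        linarith
    _ ≤ _ := by linarith [Real.add_one_le_exp (t ^ 2 * v)]

/-- A function of the innovation and the past with conditional mean zero and conditional
variance at most `v`. -/
structure IsInnovation (P : Measure ℝ) (v : ℝ) (φ : ℝ → ℝ → ℝ) : Prop where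
  measurable : Measurable (Function.uncurry φ)
  abs_le_one : ∀ e y, |φ e y| ≤ 1
  integral_eq_zero : ∀ y, ∫ e, φ e y ∂P = 0
  integral_sq_le : ∀ y, ∫ e, φ e y ^ 2 ∂P ≤ v

variable {ε Y : ℤ → Ω → ℝ}

/-- The last innovation is independent of the pair formed by the earlier sum and the current past,
so Tonelli allows integrating it out first; each step contributes a factor `e^{t² v}`. -/
lemma lintegral_exp_sum_le (hε : ∀ k, Measurable (ε k)) (hind : iIndepFun ε μ)
    (hid : ∀ k, IdentDistrib (ε k) (ε 0) μ μ)
    (hY : ∀ i, Measurable[sigmaOf ε {l | l < i}] (Y i)) {v t : ℝ} {φ : ℝ → ℝ → ℝ}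
    (hφ : IsInnovation (μ.map (ε 0)) v φ) (ht : |t| ≤ 1) (s n : ℕ) :
    ∫⁻ ω, ENNReal.ofReal (Real.exp (t * ∑ j ∈ Finset.range n,
        φ (ε ((s + j : ℕ) : ℤ) ω) (Y ((s + j : ℕ) : ℤ) ω))) ∂μ
      ≤ ENNReal.ofReal (Real.exp (t ^ 2 * v * n)) := by
  have hYm : ∀ i, Measurable (Y i) := fun i => (hY i).mono (sigmaOf_le hε _) le_rfl
  induction n with
  | zero => simp
  | succ n ih =>
    set k : ℤ := ((s + n : ℕ) : ℤ) with hk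
    set Z : Ω → ℝ := fun ω => ∑ j ∈ Finset.range n,
        φ (ε ((s + j : ℕ) : ℤ) ω) (Y ((s + j : ℕ) : ℤ) ω) with hZ
    have hZm : Measurable[sigmaOf ε {l | l < k}] Z := by
      refine Finset.measurable_fun_sum _ fun j hj => ?_
      rw [Finset.mem_range] at hj
      have h1 : Measurable[sigmaOf ε {l | l < k}] (ε ((s + j : ℕ) : ℤ)) :=
        measurable_sigmaOf ε (by simp only [Set.mem_ofPred_eq, hk]; omega)
      have h2 : Measurable[sigmaOf ε {l | l < k}] (Y ((s + j : ℕ) : ℤ)) := by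
        refine (hY _).mono (sigmaOf_mono ε fun l hl => ?_) le_rfl
        simp only [Set.mem_ofPred_eq, hk] at hl ⊢; omega
      exact hφ.measurable.comp (h1.prodMk h2)
    have hZm' : Measurable Z := hZm.mono (sigmaOf_le hε _) le_rfl
    set U : Ω → ℝ × ℝ := fun ω => (Z ω, Y k ω) with hU
    have hUm : Measurable U := hZm'.prodMk (hYm k)
    have hUε : IndepFun U (ε k) μ := by
      have h1 : Indep (sigmaOf ε {l | l < k}) (sigmaOf ε {k}) μ :=
        indep_sigmaOf hε hind (by simp)
      rw [IndepFun_iff_Indep]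
      refine indep_of_indep_of_le_right (indep_of_indep_of_le_left h1 ?_) ?_
      · exact (hZm.prodMk (hY k)).comap_le
      · exact (measurable_sigmaOf ε (Set.mem_singleton k)).comap_le
    have hmap := (indepFun_iff_map_prod_eq_prod_map_map hUm.aemeasurable
      (hε k).aemeasurable).1 hUε
    rw [(hid k).map_eq] at hmap
    have : IsProbabilityMeasure (μ.map (ε 0)) := Measure.isProbabilityMeasure_map (hε 0).aemeasurable
    set G : (ℝ × ℝ) × ℝ → ℝ≥0∞ := fun z => ENNReal.ofReal (Real.exp (t * z.1.1)) *
      ENNReal.ofReal (Real.exp (t * φ z.2 z.1.2)) with hG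
    have hGm1 : Measurable fun z : ℝ × ℝ => ENNReal.ofReal (Real.exp (t * z.1)) :=
      (Real.measurable_exp.comp (measurable_fst.const_mul t)).ennreal_ofReal
    have hGm : Measurable G := by
      refine (hGm1.comp measurable_fst).mul ?_
      refine (Real.measurable_exp.comp (Measurable.const_mul ?_ t)).ennreal_ofReal
      exact hφ.measurable.comp (measurable_snd.prodMk (measurable_snd.comp measurable_fst))
    calc ∫⁻ ω, ENNReal.ofReal (Real.exp (t * ∑ j ∈ Finset.range (n + 1),
        φ (ε ((s + j : ℕ) : ℤ) ω) (Y ((s + j : ℕ) : ℤ) ω))) ∂μ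
        = ∫⁻ ω, G (U ω, ε k ω) ∂μ := by
          refine lintegral_congr fun ω => ?_
          simp only [hG, hU, hZ]
          rw [← ENNReal.ofReal_mul (Real.exp_pos _).le, ← Real.exp_add, Finset.sum_range_succ,
            mul_add]
      _ = ∫⁻ z, G z ∂(μ.map (fun ω => (U ω, ε k ω))) :=
          (lintegral_map hGm (hUm.prodMk (hε k))).symm
      _ = ∫⁻ u, ∫⁻ e, G (u, e) ∂(μ.map (ε 0)) ∂(μ.map U) := by
          rw [hmap, lintegral_prod _ hGm.aemeasurable]
      _ ≤ ∫⁻ u, ENNReal.ofReal (Real.exp (t * u.1)) * ENNReal.ofReal (Real.exp (t ^ 2 * v))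
            ∂(μ.map U) := by
          refine lintegral_mono fun u => ?_
          simp only [hG]
          rw [lintegral_const_mul']
          · refine mul_le_mul_right ?_ _
            exact lintegral_exp_mul_le (hφ.measurable.comp (measurable_id.prodMk measurable_const))
              (fun e => hφ.abs_le_one e u.2) (hφ.integral_eq_zero u.2) (hφ.integral_sq_le u.2) ht
          · exact ENNReal.ofReal_ne_top
      _ = (∫⁻ ω, ENNReal.ofReal (Real.exp (t * Z ω)) ∂μ)
            * ENNReal.ofReal (Real.exp (t ^ 2 * v)) := by
          rw [lintegral_mul_const _ hGm1, lintegral_map hGm1 hUm]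
      _ ≤ ENNReal.ofReal (Real.exp (t ^ 2 * v * n)) * ENNReal.ofReal (Real.exp (t ^ 2 * v)) :=
          mul_le_mul_left ih _
      _ = _ := by
          rw [← ENNReal.ofReal_mul (Real.exp_pos _).le, ← Real.exp_add]
          congr 2; push_cast; ring

lemma measure_le_abs_le_of_lintegral_exp {Z : Ω → ℝ} (hZ : Measurable Z) {c t : ℝ}
    (h : ∀ u : ℝ, |u| ≤ 1 → ∫⁻ ω, ENNReal.ofReal (Real.exp (u * Z ω)) ∂μ
      ≤ ENNReal.ofReal (Real.exp (u ^ 2 * c))) (ht0 : 0 ≤ t) (ht : t ≤ 1) (x : ℝ) :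
    μ {ω | x ≤ |Z ω|} ≤ ENNReal.ofReal (2 * Real.exp (t ^ 2 * c - t * x)) := by
  have key : ∀ u : ℝ, |u| = t → μ {ω | t * x ≤ u * Z ω} ≤
      ENNReal.ofReal (Real.exp (t ^ 2 * c - t * x)) := by
    intro u hu
    have hm : Measurable fun ω => ENNReal.ofReal (Real.exp (u * Z ω)) :=
      (Real.measurable_exp.comp (hZ.const_mul u)).ennreal_ofReal
    have h1 := mul_meas_ge_le_lintegral (μ := μ) hm (ENNReal.ofReal (Real.exp (t * x)))
    have h2 := h1.trans (h u (hu.le.trans ht))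
    have h3 : {ω | t * x ≤ u * Z ω} = {ω | ENNReal.ofReal (Real.exp (t * x)) ≤
        ENNReal.ofReal (Real.exp (u * Z ω))} := by
      ext ω
      simp only [Set.mem_ofPred_eq]
      rw [ENNReal.ofReal_le_ofReal_iff (Real.exp_pos _).le, Real.exp_le_exp]
    rw [h3, sub_eq_add_neg, Real.exp_add, Real.exp_neg, ENNReal.ofReal_mul (Real.exp_pos _).le,
      ENNReal.ofReal_inv_of_pos (Real.exp_pos _), ← div_eq_mul_inv,
      ENNReal.le_div_iff_mul_le (Or.inl (by simp [Real.exp_pos]))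
        (Or.inl ENNReal.ofReal_ne_top), mul_comm]
    rwa [← sq_abs, hu] at h2
  have hsub : {ω | x ≤ |Z ω|} ⊆ {ω | t * x ≤ t * Z ω} ∪ {ω | t * x ≤ (-t) * Z ω} := by
    intro ω hω
    simp only [Set.mem_ofPred_eq, Set.mem_union] at hω ⊢
    rcases le_abs.1 hω with h | h
    · exact Or.inl (mul_le_mul_of_nonneg_left h ht0)
    · right
      have := mul_le_mul_of_nonneg_left h ht0
      linarith
  refine (measure_mono hsub).trans ((measure_union_le _ _).trans ?_)
  rw [two_mul, ENNReal.ofReal_add (Real.exp_pos _).le (Real.exp_pos _).le]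
  exact add_le_add (key t (abs_of_nonneg ht0)) (key (-t) (by rw [abs_neg, abs_of_nonneg ht0]))

/-- Use `y^Q / Q! ≤ e^y` with `y = |Z|/σ`, `σ = √c + 1`. The added `1` keeps `1/σ` in the range `|u|
≤ 1` where the exponential bound is assumed, and `σ² ≥ c` bounds the exponent by one. -/
lemma eLpNorm_le_of_lintegral_exp {Z : Ω → ℝ} (hZ : Measurable Z) {c : ℝ} (hc : 0 ≤ c)
    (h : ∀ u : ℝ, |u| ≤ 1 → ∫⁻ ω, ENNReal.ofReal (Real.exp (u * Z ω)) ∂μ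
      ≤ ENNReal.ofReal (Real.exp (u ^ 2 * c))) {Q : ℕ} (hQ : 1 ≤ Q) :
    eLpNorm Z (ENNReal.ofReal Q) μ ≤
      ENNReal.ofReal (2 * Real.exp 1 * Q.factorial * (Real.sqrt c + 1)) := by
  set σ := Real.sqrt c + 1 with hσ
  have hs0 := Real.sqrt_nonneg c
  have hσ1 : 1 ≤ σ := by linarith
  have hσ0 : 0 < σ := by linarith
  have hQ0 : (0 : ℝ) < Q := by exact_mod_cast hQ
  have hcσ : (σ⁻¹) ^ 2 * c ≤ 1 := by
    rw [inv_pow, inv_mul_le_iff₀ (by positivity), mul_one]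
    calc c = Real.sqrt c ^ 2 := (Real.sq_sqrt hc).symm
      _ ≤ σ ^ 2 := pow_le_pow_left₀ hs0 (by linarith) 2
  have hpt : ∀ ω, ‖Z ω‖ₑ ^ (Q : ℝ) ≤ ENNReal.ofReal (Q.factorial * σ ^ Q) *
      (ENNReal.ofReal (Real.exp (σ⁻¹ * Z ω)) + ENNReal.ofReal (Real.exp (-σ⁻¹ * Z ω))) := by
    intro ω
    rw [← ENNReal.ofReal_add (Real.exp_pos _).le (Real.exp_pos _).le,
      ← ENNReal.ofReal_mul (by positivity), ← ofReal_norm,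
      ENNReal.ofReal_rpow_of_nonneg (norm_nonneg _) hQ0.le]
    apply ENNReal.ofReal_le_ofReal
    rw [Real.rpow_natCast, Real.norm_eq_abs]
    have h1 := Real.pow_div_factorial_le_exp (x := |Z ω| / σ) (by positivity) Q
    have h2 : Real.exp (|Z ω| / σ) ≤ Real.exp (σ⁻¹ * Z ω) + Real.exp (-σ⁻¹ * Z ω) := by
      rcases abs_cases (Z ω) with ⟨h, _⟩ | ⟨h, _⟩
      · rw [h, show Z ω / σ = σ⁻¹ * Z ω by ring]
        linarith [Real.exp_pos (-σ⁻¹ * Z ω)]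
      · rw [h, show -Z ω / σ = -σ⁻¹ * Z ω by ring]
        linarith [Real.exp_pos (σ⁻¹ * Z ω)]
    have h3 := mul_le_mul_of_nonneg_left (h1.trans h2)
      (by positivity : (0:ℝ) ≤ Q.factorial * σ ^ Q)
    refine le_trans (le_of_eq ?_) h3
    rw [div_pow]
    field_simp
  have hinv : |σ⁻¹| ≤ 1 := by
    rw [abs_of_pos (by positivity)]; exact inv_le_one_of_one_le₀ hσ1
  have hbound : ∀ u : ℝ, |u| = σ⁻¹ → ∫⁻ ω, ENNReal.ofReal (Real.exp (u * Z ω)) ∂μ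
      ≤ ENNReal.ofReal (Real.exp 1) := by
    intro u hu
    refine (h u (by rw [hu]; rwa [abs_of_pos (by positivity)] at hinv)).trans ?_
    apply ENNReal.ofReal_le_ofReal
    rw [Real.exp_le_exp, ← sq_abs, hu]
    exact hcσ
  have hm : ∀ u : ℝ, Measurable fun ω => ENNReal.ofReal (Real.exp (u * Z ω)) := fun u =>
    (Real.measurable_exp.comp (hZ.const_mul u)).ennreal_ofReal
  have hint : ∫⁻ ω, ‖Z ω‖ₑ ^ (Q : ℝ) ∂μ
      ≤ ENNReal.ofReal ((2 * Real.exp 1 * Q.factorial * σ) ^ Q) := by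
    calc ∫⁻ ω, ‖Z ω‖ₑ ^ (Q : ℝ) ∂μ ≤ _ := lintegral_mono hpt
      _ = ENNReal.ofReal (Q.factorial * σ ^ Q) *
          (∫⁻ ω, ENNReal.ofReal (Real.exp (σ⁻¹ * Z ω)) ∂μ
            + ∫⁻ ω, ENNReal.ofReal (Real.exp (-σ⁻¹ * Z ω)) ∂μ) := by
          rw [lintegral_const_mul' _ _ ENNReal.ofReal_ne_top, lintegral_add_left (hm _)]
      _ ≤ ENNReal.ofReal (Q.factorial * σ ^ Q) *
          (ENNReal.ofReal (Real.exp 1) + ENNReal.ofReal (Real.exp 1)) := by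
          refine mul_le_mul_right (add_le_add (hbound _ (abs_of_pos (by positivity)))
            (hbound _ (by rw [abs_neg, abs_of_pos (by positivity)]))) _
      _ ≤ _ := by
          rw [← ENNReal.ofReal_add (Real.exp_pos _).le (Real.exp_pos _).le,
            ← ENNReal.ofReal_mul (by positivity)]
          apply ENNReal.ofReal_le_ofReal
          have h1 : (1:ℝ) ≤ 2 * Real.exp 1 * Q.factorial := by
            have h2 : (1:ℝ) ≤ Q.factorial := by 
              exact_mod_cast Nat.one_le_iff_ne_zero.2 (Nat.factorial_ne_zero Q)
            have h3 : 1 ≤ Real.exp 1 := Real.one_le_exp zero_le_one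
            nlinarith
          rw [mul_pow]
          have h2 := le_self_pow₀ h1 (by omega : Q ≠ 0)
          have h3 := mul_le_mul_of_nonneg_right h2 (by positivity : 0 ≤ σ ^ Q)
          linarith
  rw [eLpNorm_eq_lintegral_rpow_enorm_toReal (by simp; omega) ENNReal.ofReal_ne_top,
    ENNReal.toReal_ofReal hQ0.le]
  calc (∫⁻ ω, ‖Z ω‖ₑ ^ (Q : ℝ) ∂μ) ^ (1 / (Q : ℝ))
      ≤ (ENNReal.ofReal ((2 * Real.exp 1 * Q.factorial * σ) ^ Q)) ^ (1 / (Q : ℝ)) :=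
        ENNReal.rpow_le_rpow hint (by positivity)
    _ = _ := by
        rw [← Real.rpow_natCast, ← ENNReal.ofReal_rpow_of_nonneg (by positivity) hQ0.le,
          ← ENNReal.rpow_mul, mul_one_div_cancel hQ0.ne', ENNReal.rpow_one]

end Exponential

/-! ### Dyadic chaining -/

section Chaining

variable {Ω : Type*} {m0 : MeasurableSpace Ω} {μ : Measure Ω}

lemma eLpNorm_ennreal_le_iff {q : ℝ} (hq : 0 < q) (f : Ω → ℝ≥0∞) (u : ℝ≥0∞) :
    eLpNorm f (ENNReal.ofReal q) μ ≤ u ↔ ∫⁻ ω, f ω ^ q ∂μ ≤ u ^ q := by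
  rw [eLpNorm_eq_lintegral_rpow_enorm_toReal (by simpa using hq) ENNReal.ofReal_ne_top,
    ENNReal.toReal_ofReal hq.le, one_div, ENNReal.rpow_inv_le_iff hq]
  simp only [enorm_eq_self]

/-- Since `max(f, g)^q ≤ f^q + g^q`, a maximum costs only `2^{1/q}`. This is at most `√2`, the
growth of the norm bound under doubling, exactly when `q ≥ 2`. -/
lemma eLpNorm_max_le {q : ℝ} (hq : 0 < q) {f g : Ω → ℝ≥0∞} (hf : Measurable f) {u : ℝ≥0∞}
    (hfu : eLpNorm f (ENNReal.ofReal q) μ ≤ u) (hgu : eLpNorm g (ENNReal.ofReal q) μ ≤ u) :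
    eLpNorm (fun ω => max (f ω) (g ω)) (ENNReal.ofReal q) μ ≤ ENNReal.ofReal (2 ^ (1 / q)) * u := by
  rw [eLpNorm_ennreal_le_iff hq] at *
  rw [ENNReal.mul_rpow_of_nonneg _ _ hq.le,
    ENNReal.ofReal_rpow_of_nonneg (by positivity) hq.le, ← Real.rpow_mul (by norm_num),
    one_div_mul_cancel hq.ne', Real.rpow_one, ENNReal.ofReal_ofNat, two_mul]
  calc ∫⁻ ω, max (f ω) (g ω) ^ q ∂μ ≤ ∫⁻ ω, (f ω ^ q + g ω ^ q) ∂μ := by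
        refine lintegral_mono fun ω => ?_
        rcases le_total (f ω) (g ω) with h | h
        · simp [max_eq_right h]
        · simp [max_eq_left h]
    _ = ∫⁻ ω, f ω ^ q ∂μ + ∫⁻ ω, g ω ^ q ∂μ := lintegral_add_left (hf.pow_const q) _
    _ ≤ _ := add_le_add hfu hgu

/-- The chaining majorant of a sequence whose increments over the blocks `[s, s + 2 ^ d)` are
bounded by `B d s`. -/
def chainMax (B : ℕ → ℕ → Ω → ℝ≥0∞) : ℕ → ℕ → Ω → ℝ≥0∞
  | 0, s => B 0 s
  | d + 1, s => fun ω => B d s ω + max (chainMax B d s ω) (chainMax B d (s + 2 ^ d) ω)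

/-- Bisection: either `n` lies in the left half block, or one crosses that half entirely and
continues in the right one. The argument is pathwise, so one majorant serves every sequence `w` that
it dominates. -/
lemma enorm_sub_le_chainMax {B : ℕ → ℕ → Ω → ℝ≥0∞} {ω : Ω} {w : ℕ → ℝ}
    (hw : ∀ d s, ‖w (s + 2 ^ d) - w s‖ₑ ≤ B d s ω) (d : ℕ) :
    ∀ s n, n ≤ 2 ^ d → ‖w (s + n) - w s‖ₑ ≤ chainMax B d s ω := by
  induction d with
  | zero =>
    intro s n hn
    have : n = 0 ∨ n = 1 := by simp at hn; omega
    rcases this with rfl | rfl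
    · simp
    · simpa [chainMax] using hw 0 s
  | succ d ih =>
    intro s n hn
    simp only [chainMax]
    rcases le_or_gt n (2 ^ d) with h | h
    · exact (ih s n h).trans ((le_max_left _ _).trans (self_le_add_left _ _))
    · obtain ⟨k, rfl⟩ := Nat.exists_eq_add_of_lt h
      have h1 := ih (s + 2 ^ d) (k + 1) (by rw [pow_succ] at hn; omega)
      have h2 : w (s + (2 ^ d + k + 1)) - w s
          = (w (s + 2 ^ d) - w s) + (w (s + 2 ^ d + (k + 1)) - w (s + 2 ^ d)) := by
        rw [show s + (2 ^ d + k + 1) = s + 2 ^ d + (k + 1) by ring]; ring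
      rw [h2]
      exact (enorm_add_le _ _).trans (add_le_add (hw d s) (h1.trans (le_max_right _ _)))

lemma measurable_chainMax {B : ℕ → ℕ → Ω → ℝ≥0∞} (hB : ∀ d s, Measurable (B d s)) (d : ℕ) :
    ∀ s, Measurable (chainMax B d s) := by
  induction d with
  | zero => exact fun s => hB 0 s
  | succ d ih => exact fun s => (hB d s).add ((ih s).max (ih _))

/-- The loss in the chaining bound: logarithmic for `q = 2`, bounded for `q > 2`. -/
def chainFactor (q : ℝ) (D : ℕ) : ℝ :=
  if q = 2 then D + 1 else 1 + 1 / (Real.sqrt 2 - 2 ^ (1 / q))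

lemma two_rpow_one_div_lt {q : ℝ} (hq : 2 < q) : (2:ℝ) ^ (1 / q) < Real.sqrt 2 := by
  rw [Real.sqrt_eq_rpow]
  apply Real.rpow_lt_rpow_of_exponent_lt (by norm_num)
  exact one_div_lt_one_div_of_lt (by norm_num) hq

lemma one_le_chainFactor {q : ℝ} (hq : 2 ≤ q) (D : ℕ) : 1 ≤ chainFactor q D := by
  unfold chainFactor
  split_ifs with h
  · have : (0:ℝ) ≤ D := Nat.cast_nonneg D
    linarith
  · have := two_rpow_one_div_lt (lt_of_le_of_ne hq (Ne.symm h))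
    have : 0 ≤ 1 / (Real.sqrt 2 - 2 ^ (1 / q)) := by
      apply one_div_nonneg.2; linarith
    linarith

/-- The recursion behind `chainFactor`: after division by `√2` it is a strict contraction for `q >
2`, hence bounded, whereas for `q = 2` each level adds a constant. -/
lemma chainFactor_succ {q : ℝ} (hq : 2 ≤ q) (D : ℕ) :
    1 + 2 ^ (1 / q) * chainFactor q D ≤ chainFactor q (D + 1) * Real.sqrt 2 := by
  have h1 : 1 ≤ Real.sqrt 2 := Real.one_le_sqrt.2 (by norm_num)
  unfold chainFactor
  split_ifs with h
  · rw [h, ← Real.sqrt_eq_rpow]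
    push_cast
    linarith
  · have h2 := two_rpow_one_div_lt (lt_of_le_of_ne hq (Ne.symm h))
    have h3 : 0 < Real.sqrt 2 - 2 ^ (1 / q) := by linarith
    have h4 : (Real.sqrt 2 - 2 ^ (1 / q)) * (1 / (Real.sqrt 2 - 2 ^ (1 / q))) = 1 :=
      mul_one_div_cancel h3.ne'
    nlinarith

lemma eLpNorm_chainMax_le {q K : ℝ} (hq : 2 ≤ q) (hK : 0 ≤ K) {B : ℕ → ℕ → Ω → ℝ≥0∞}
    (hBm : ∀ d s, Measurable (B d s))
    (hB : ∀ d s, eLpNorm (B d s) (ENNReal.ofReal q) μ ≤ ENNReal.ofReal (K * Real.sqrt (2 ^ d)))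
    (D : ℕ) : ∀ s, eLpNorm (chainMax B D s) (ENNReal.ofReal q) μ
      ≤ ENNReal.ofReal (K * chainFactor q D * Real.sqrt (2 ^ D)) := by
  induction D with
  | zero =>
    intro s
    refine (hB 0 s).trans (ENNReal.ofReal_le_ofReal ?_)
    have := one_le_chainFactor hq 0
    simp only [pow_zero, Real.sqrt_one, mul_one]
    nlinarith
  | succ D ih =>
    intro s
    have hf := one_le_chainFactor hq D
    have hp1 : 1 ≤ ENNReal.ofReal q := by
      rw [← ENNReal.ofReal_one]; exact ENNReal.ofReal_le_ofReal (by linarith)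
    have hm := measurable_chainMax hBm D
    have h1 : eLpNorm (chainMax B (D + 1) s) (ENNReal.ofReal q) μ ≤
        eLpNorm (B D s) (ENNReal.ofReal q) μ
        + eLpNorm (fun ω => max (chainMax B D s ω) (chainMax B D (s + 2 ^ D) ω))
          (ENNReal.ofReal q) μ :=
      eLpNorm_add_le (hBm D s).aestronglyMeasurable
        ((hm s).max (hm _)).aestronglyMeasurable hp1
    refine h1.trans ?_
    refine (add_le_add (hB D s) (eLpNorm_max_le (by linarith) (hm s) (ih s) (ih _))).trans ?_
    rw [← ENNReal.ofReal_mul (by positivity), ← ENNReal.ofReal_add (by positivity) (by positivity)]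
    apply ENNReal.ofReal_le_ofReal
    have h2 := mul_le_mul_of_nonneg_left (chainFactor_succ hq D)
      (by positivity : 0 ≤ K * Real.sqrt (2 ^ D))
    have h3 : Real.sqrt (2 ^ (D + 1)) = Real.sqrt (2 ^ D) * Real.sqrt 2 := by
      rw [pow_succ, Real.sqrt_mul (by positivity)]
    rw [h3]
    linarith

end Chaining

/-! ### The normalisation `ι_q` at dyadic scales -/

section Rates

/-- Cauchy condensation reduces this to `∑ 1/k²`. The shift in `log (n + 1)` keeps the denominator
positive at `n = 1`. -/
lemma summable_one_div_mul_log_sq :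
    Summable fun n : ℕ => 1 / ((n : ℝ) * Real.log (n + 1) ^ 2) := by
  rw [← summable_condensed_iff_of_nonneg]
  · refine Summable.of_nonneg_of_le
      (f := fun k : ℕ => (4 / Real.log 2 ^ 2) * (1 / ((k + 1 : ℕ) : ℝ) ^ 2))
      (fun k => by positivity) (fun k => ?_)
      (((summable_nat_add_iff 1).2 (Real.summable_one_div_nat_pow.2 (by norm_num))).mul_left _)
    have h2 : (0:ℝ) < Real.log 2 := Real.log_pos (by norm_num)
    have hk : (1:ℝ) ≤ 2 ^ k := one_le_pow₀ (by norm_num)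
    have h3 : Real.log 2 ≤ Real.log (2 ^ k + 1) := Real.log_le_log (by norm_num) (by linarith)
    have h4 : k * Real.log 2 ≤ Real.log (2 ^ k + 1) := by
      rw [← Real.log_pow]; exact Real.log_le_log (by positivity) (by linarith)
    have h5 : (k + 1) / 2 * Real.log 2 ≤ Real.log (2 ^ k + 1) := by linarith
    have h6 : ((k + 1) / 2 * Real.log 2) ^ 2 ≤ Real.log (2 ^ k + 1) ^ 2 :=
      pow_le_pow_left₀ (by positivity) h5 2
    push_cast
    calc (2:ℝ) ^ k * (1 / (2 ^ k * Real.log (2 ^ k + 1) ^ 2))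
        = 1 / Real.log (2 ^ k + 1) ^ 2 := by field_simp
      _ ≤ 1 / ((k + 1) / 2 * Real.log 2) ^ 2 := one_div_le_one_div_of_le (by positivity) h6
      _ = _ := by field_simp; norm_num
  · intro n; positivity
  · intro m n hm hmn
    have hm' : (0:ℝ) < m := by exact_mod_cast hm
    have hmn' : (m:ℝ) ≤ n := by exact_mod_cast hmn
    have h1 : 0 < Real.log (m + 1) := Real.log_pos (by linarith)
    have h2 : Real.log (m + 1) ≤ Real.log (n + 1) := Real.log_le_log (by linarith) (by linarith)
    gcongr

lemma iota_rpow {q : ℝ} (hq : 2 ≤ q) {n : ℕ} (h1 : 0 ≤ Real.log n)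
    (h2 : 0 ≤ Real.log (Real.log n)) :
    iota q n ^ q = (if q = 2 then Real.log n ^ 3 else Real.log n) * Real.log (Real.log n) ^ 2 := by
  unfold iota
  split_ifs with h
  · subst h
    rw [Real.mul_rpow (by positivity) h2, ← Real.rpow_mul h1]
    norm_num
  · have hq0 : q ≠ 0 := by linarith
    rw [Real.mul_rpow (by positivity) (by positivity), ← Real.rpow_mul h1, ← Real.rpow_mul h2,
      one_div_mul_cancel hq0, div_mul_cancel₀ _ hq0, Real.rpow_one]
    norm_num

lemma tendsto_log_nat : Tendsto (fun n : ℕ => Real.log n) atTop atTop :=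
  Real.tendsto_log_atTop.comp tendsto_natCast_atTop_atTop

lemma tendsto_log_log_nat : Tendsto (fun n : ℕ => Real.log (Real.log n)) atTop atTop :=
  Real.tendsto_log_atTop.comp tendsto_log_nat

lemma eventually_one_le_iota {q : ℝ} (hq : 2 ≤ q) : ∀ᶠ n : ℕ in atTop, 1 ≤ iota q n := by
  filter_upwards [tendsto_log_nat.eventually_ge_atTop 1,
    tendsto_log_log_nat.eventually_ge_atTop 1] with n h1 h2
  unfold iota
  split_ifs
  · exact one_le_mul_of_one_le_of_one_le (Real.one_le_rpow h1 (by norm_num)) h2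
  · exact one_le_mul_of_one_le_of_one_le (Real.one_le_rpow h1 (by positivity))
      (Real.one_le_rpow h2 (by positivity))

lemma iota_nonneg {q : ℝ} {n : ℕ} (hn : 3 ≤ n) : 0 ≤ iota q n := by
  have h1 : 1 ≤ Real.log n := by
    rw [Real.le_log_iff_exp_le (by positivity)]
    exact Real.exp_one_lt_three.le.trans (by exact_mod_cast hn)
  have h2 : 0 ≤ Real.log (Real.log n) := Real.log_nonneg h1
  unfold iota
  split_ifs <;> positivity

lemma iota_mono {q : ℝ} (hq : 2 ≤ q) {m n : ℕ} (hm : 3 ≤ m) (hmn : m ≤ n) :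
    iota q m ≤ iota q n := by
  have h1 : 1 ≤ Real.log m := by
    rw [Real.le_log_iff_exp_le (by positivity)]
    exact Real.exp_one_lt_three.le.trans (by exact_mod_cast hm)
  have h2 : 0 ≤ Real.log (Real.log m) := Real.log_nonneg h1
  have h3 : Real.log m ≤ Real.log n := Real.log_le_log (by positivity) (by exact_mod_cast hmn)
  have h4 : Real.log (Real.log m) ≤ Real.log (Real.log n) := Real.log_le_log (by positivity) h3
  unfold iota
  split_ifs <;> gcongr

/-- The normalisation at the dyadic scale `2 ^ D`. -/
def dyadicRate (q : ℝ) (D : ℕ) : ℝ := max 1 (iota q (2 ^ (D - 1)))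

lemma one_le_dyadicRate (q : ℝ) (D : ℕ) : 1 ≤ dyadicRate q D := le_max_left _ _

/-- This is where the form of `ι_q` comes from. At `n = 2^{D-1}`, `ι_q(n)^q` is of order `D (log
D)²` for `q > 2` and `D³ (log D)²` for `q = 2`. Against a numerator that is constant, respectively
`(D + 1)²`, both cases leave `1/(D (log D)²)`. -/
lemma summable_chainFactor_div {q : ℝ} (hq : 2 ≤ q) :
    Summable fun D : ℕ => (chainFactor q D / dyadicRate q D) ^ q := by
  set C : ℝ := chainFactor q 0 with hC
  have hC1 : 1 ≤ C := one_le_chainFactor hq 0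
  have hq0 : 0 < q := by linarith
  refine Summable.of_norm_bounded_eventually_nat
    (g := fun n : ℕ => (128 + 8 * C ^ q) * (1 / ((n : ℝ) * Real.log (n + 1) ^ 2)))
    (summable_one_div_mul_log_sq.mul_left _) ?_
  filter_upwards [eventually_ge_atTop 8] with D hD
  have hD8 : (8:ℝ) ≤ D := by exact_mod_cast hD
  have hcf := one_le_chainFactor hq D
  have hdr := one_le_dyadicRate q D
  rw [Real.norm_of_nonneg (by positivity)]
  set L := Real.log ((2 ^ (D - 1) : ℕ) : ℝ) with hL
  have hLD : (D:ℝ) / 2 ≤ L := by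
    have : ((D - 1 : ℕ) : ℝ) = D - 1 := by rw [Nat.cast_sub (by omega)]; simp
    rw [hL, Nat.cast_pow, Real.log_pow, this]
    have := Real.log_two_gt_d9
    push_cast
    nlinarith
  set l := Real.log ((D:ℝ) + 1) with hl
  have hl0 : 0 < l := Real.log_pos (by linarith)
  have hlL : l / 2 ≤ Real.log L := by
    have h1 : Real.log ((D:ℝ) / 2) ≤ Real.log L := Real.log_le_log (by positivity) hLD
    have h2 : l ≤ 2 * Real.log ((D:ℝ) / 2) := by
      have : 2 * Real.log ((D:ℝ) / 2) = Real.log (((D:ℝ) / 2) ^ 2) := by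
        rw [Real.log_pow]; norm_num
      rw [this]
      exact Real.log_le_log (by positivity) (by nlinarith)
    linarith
  have hL0 : 0 ≤ L := by linarith
  have hLL0 : 0 ≤ Real.log L := by linarith
  have hio := iota_rpow hq hL0 hLL0
  have hio0 : 0 ≤ iota q (2 ^ (D - 1)) := by
    have h3 : 3 ≤ 2 ^ (D - 1) := by
      calc 3 ≤ 2 ^ 2 := by norm_num
        _ ≤ 2 ^ (D - 1) := Nat.pow_le_pow_right (by norm_num) (by omega)
    exact iota_nonneg h3
  have hden : iota q (2 ^ (D - 1)) ^ q ≤ dyadicRate q D ^ q :=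
    Real.rpow_le_rpow hio0 (le_max_right _ _) hq0.le
  rw [hio, ← hL] at hden
  rw [Real.div_rpow (by linarith) (by linarith)]
  have hCq : 0 ≤ C ^ q := by positivity
  have hsq : (l / 2) ^ 2 ≤ Real.log L ^ 2 := pow_le_pow_left₀ (by positivity) hlL 2
  split_ifs at hden with h
  · have h3 : ((D:ℝ) / 2) ^ 3 * (l / 2) ^ 2 ≤ dyadicRate q D ^ q :=
      le_trans (by gcongr) hden
    have h4 : chainFactor q D ^ q = (D + 1) ^ 2 := by
      rw [chainFactor, if_pos h, h]; norm_cast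
    rw [h4]
    calc ((D:ℝ) + 1) ^ 2 / dyadicRate q D ^ q ≤ (2 * D) ^ 2 / (((D:ℝ) / 2) ^ 3 * (l / 2) ^ 2) := by
          gcongr; linarith
      _ = 128 * (1 / (D * l ^ 2)) := by field_simp; norm_num
      _ ≤ _ := by
          apply mul_le_mul_of_nonneg_right _ (by positivity)
          linarith
  · have h3 : ((D:ℝ) / 2) * (l / 2) ^ 2 ≤ dyadicRate q D ^ q :=
      le_trans (by gcongr) hden
    have h4 : chainFactor q D = C := by rw [hC, chainFactor, chainFactor, if_neg h, if_neg h]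
    rw [h4]
    calc C ^ q / dyadicRate q D ^ q ≤ C ^ q / (((D:ℝ) / 2) * (l / 2) ^ 2) := by gcongr
      _ = 8 * C ^ q * (1 / (D * l ^ 2)) := by field_simp; norm_num
      _ ≤ _ := by
          apply mul_le_mul_of_nonneg_right _ (by positivity)
          linarith

/-- For `Q > 2` the chaining factor is constant, and since the rate is at least one, raising its
inverse to the larger power `Q` only helps. Used for the martingale part, which has moments of every
order. -/
lemma summable_chainFactor_div_of_le {q Q : ℝ} (hq : 2 ≤ q) (hQ : 2 < Q) (hqQ : q ≤ Q) :
    Summable fun D : ℕ => (chainFactor Q D / dyadicRate q D) ^ Q := by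
  set C : ℝ := chainFactor Q 0 with hC
  have hC1 : 1 ≤ C := one_le_chainFactor hQ.le 0
  refine Summable.of_nonneg_of_le (fun D => ?_) (fun D => ?_)
    ((summable_chainFactor_div hq).mul_left (C ^ Q))
  · have := one_le_chainFactor hQ.le D
    have := one_le_dyadicRate q D
    positivity
  · have hdr := one_le_dyadicRate q D
    have h4 : chainFactor Q D = C := by
      rw [hC, chainFactor, chainFactor, if_neg hQ.ne', if_neg hQ.ne']
    have hcf := one_le_chainFactor hq D
    rw [h4, Real.div_rpow (by linarith) (by linarith), div_eq_mul_inv,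
      ← Real.inv_rpow (by linarith)]
    apply mul_le_mul_of_nonneg_left _ (by positivity)
    calc (dyadicRate q D)⁻¹ ^ Q ≤ (dyadicRate q D)⁻¹ ^ q :=
          Real.rpow_le_rpow_of_exponent_ge (by positivity) (inv_le_one_of_one_le₀ hdr) hqQ
      _ ≤ _ := by
          apply Real.rpow_le_rpow (by positivity) _ (by linarith)
          rw [inv_eq_one_div]
          gcongr

end Rates

/-! ### From dyadic moments to almost sure rates -/

section AlmostSure

variable {Ω : Type*} {m0 : MeasurableSpace Ω} {μ : Measure Ω}

/-- The `Q`-th moments of the normalised maxima are summable, so the sum of their `Q`-th powers is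
almost surely finite and its terms tend to zero. -/
lemma ae_tendsto_chainMax_div {Q K : ℝ} (hQ : 2 ≤ Q) (hK : 0 ≤ K) {B : ℕ → ℕ → Ω → ℝ≥0∞}
    (hBm : ∀ d s, Measurable (B d s))
    (hB : ∀ d s, eLpNorm (B d s) (ENNReal.ofReal Q) μ ≤ ENNReal.ofReal (K * Real.sqrt (2 ^ d)))
    {ρ : ℕ → ℝ} (hρ : ∀ D, 0 < ρ D) (hs : Summable fun D => (chainFactor Q D / ρ D) ^ Q) :
    ∀ᵐ ω ∂μ, Tendsto (fun D => chainMax B D 0 ω / ENNReal.ofReal (Real.sqrt (2 ^ D) * ρ D))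
      atTop (𝓝 0) := by
  have hQ0 : 0 < Q := by linarith
  set Z : ℕ → Ω → ℝ≥0∞ := fun D ω =>
    (chainMax B D 0 ω / ENNReal.ofReal (Real.sqrt (2 ^ D) * ρ D)) ^ Q with hZ
  have hZm : ∀ D, Measurable (Z D) := fun D =>
    ((measurable_chainMax hBm D 0).div_const _).pow_const _
  have hZi : ∀ D, ∫⁻ ω, Z D ω ∂μ ≤ ENNReal.ofReal (K ^ Q * (chainFactor Q D / ρ D) ^ Q) := by
    intro D
    have hcf := one_le_chainFactor hQ D
    have hρD := hρ D
    have h1 := (eLpNorm_ennreal_le_iff hQ0 _ _).1 (eLpNorm_chainMax_le hQ hK hBm hB D 0)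
    have hpos : 0 < Real.sqrt (2 ^ D) * ρ D := by positivity
    have h2 : ∀ ω, Z D ω = chainMax B D 0 ω ^ Q
        * (ENNReal.ofReal (Real.sqrt (2 ^ D) * ρ D) ^ Q)⁻¹ := by
      intro ω
      simp only [hZ]
      rw [ENNReal.div_rpow_of_nonneg _ _ hQ0.le, div_eq_mul_inv]
    simp only [h2]
    rw [lintegral_mul_const _ ((measurable_chainMax hBm D 0).pow_const _)]
    refine (mul_le_mul_left h1 _).trans (le_of_eq ?_)
    rw [ENNReal.ofReal_rpow_of_nonneg (by positivity) hQ0.le,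
      ENNReal.ofReal_rpow_of_nonneg (by positivity) hQ0.le,
      ← ENNReal.ofReal_inv_of_pos (by positivity), ← ENNReal.ofReal_mul (by positivity),
      ← Real.mul_rpow hK (by positivity), ← div_eq_mul_inv, ← Real.div_rpow (by positivity) hpos.le]
    congr 2
    field_simp
  have hfin : ∫⁻ ω, ∑' D, Z D ω ∂μ ≠ ∞ := by
    rw [lintegral_tsum fun D => (hZm D).aemeasurable]
    refine ne_top_of_le_ne_top ?_ (ENNReal.tsum_le_tsum hZi)
    exact (hs.mul_left _).tsum_ofReal_ne_top
  filter_upwards [ae_lt_top (Measurable.tsum hZm) hfin] with ω hω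
  have h1 := ENNReal.tendsto_atTop_zero_of_tsum_ne_top hω.ne
  have h2 := ((ENNReal.continuous_rpow_const (y := Q⁻¹)).tendsto 0).comp h1
  rw [ENNReal.zero_rpow_of_pos (by positivity)] at h2
  refine h2.congr fun D => ?_
  simp only [hZ, Function.comp]
  rw [← ENNReal.rpow_mul, mul_inv_cancel₀ hQ0.ne', ENNReal.rpow_one]

/-- If the increments of a family of sequences over dyadic blocks of length `2 ^ d` are dominated
by random variables with `L^Q` norm of order `2 ^ (d / 2)`, then the sequences are
`o(√n ι_q(n))`, uniformly over the family. -/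
lemma ae_eventually_abs_sub_le {q Q K : ℝ} (hq : 2 ≤ q) (hQ : 2 ≤ Q) (hK : 0 ≤ K)
    {B : ℕ → ℕ → Ω → ℝ≥0∞} (hBm : ∀ d s, Measurable (B d s))
    (hB : ∀ d s, eLpNorm (B d s) (ENNReal.ofReal Q) μ ≤ ENNReal.ofReal (K * Real.sqrt (2 ^ d)))
    (hs : Summable fun D => (chainFactor Q D / dyadicRate q D) ^ Q) :
    ∀ᵐ ω ∂μ, ∀ δ : ℝ, 0 < δ → ∀ᶠ n : ℕ in atTop, ∀ w : ℕ → ℝ,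
      (∀ d s, ‖w (s + 2 ^ d) - w s‖ₑ ≤ B d s ω) →
      |w n - w 0| ≤ δ * (Real.sqrt n * iota q n) := by
  filter_upwards [ae_tendsto_chainMax_div hQ hK hBm hB
    (fun D => lt_of_lt_of_le one_pos (one_le_dyadicRate q D)) hs] with ω hω δ hδ
  have h1 : ∀ᶠ D in atTop, chainMax B D 0 ω / ENNReal.ofReal (Real.sqrt (2 ^ D) * dyadicRate q D)
      ≤ ENNReal.ofReal (δ / 2) :=
    hω.eventually_le_const (ENNReal.ofReal_pos.2 (by positivity))
  have hlog : Tendsto (fun n : ℕ => Nat.log 2 n + 1) atTop atTop := by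
    refine tendsto_atTop.2 fun b => ?_
    filter_upwards [eventually_ge_atTop (2 ^ b)] with n hn
    exact (Nat.le_log_of_pow_le (by norm_num) hn).trans (Nat.le_succ _)
  filter_upwards [hlog.eventually h1, eventually_ge_atTop 8, eventually_one_le_iota hq]
    with n hn hn8 hi1 w hw
  -- Now `2^{D-1} ≤ n < 2^D`: the block `[0, 2^D)` contains `n`, and `dyadicRate`, evaluated at
  -- `2^{D-1}`, does not exceed `ι_q(n)`.
  set D := Nat.log 2 n + 1 with hD
  have hlt : n < 2 ^ D := Nat.lt_pow_succ_log_self (by norm_num) n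
  have hle : 2 ^ (D - 1) ≤ n := by
    rw [hD, Nat.add_sub_cancel]; exact Nat.pow_log_le_self 2 (by omega)
  have hchain := enorm_sub_le_chainMax hw D 0 n hlt.le
  rw [zero_add] at hchain
  have hdr := one_le_dyadicRate q D
  have hpos : 0 < Real.sqrt (2 ^ D) * dyadicRate q D := by positivity
  rw [ENNReal.div_le_iff (by simpa using hpos) ENNReal.ofReal_ne_top,
    ← ENNReal.ofReal_mul (by positivity)] at hn
  have hfin := hchain.trans hn
  rw [← ofReal_norm, ENNReal.ofReal_le_ofReal_iff (by positivity), Real.norm_eq_abs] at hfin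
  have h3 : 3 ≤ 2 ^ (D - 1) := by
    have : 3 ≤ Nat.log 2 n := Nat.le_log_of_pow_le (by norm_num) (by simpa using hn8)
    calc 3 ≤ 2 ^ 3 := by norm_num
      _ ≤ 2 ^ (D - 1) := Nat.pow_le_pow_right (by norm_num) (by omega)
  have h4 : dyadicRate q D ≤ iota q n := max_le hi1 (iota_mono hq h3 hle)
  have h5 : Real.sqrt (2 ^ D) ≤ 2 * Real.sqrt n := by
    rw [show (2:ℝ) * Real.sqrt n = Real.sqrt (4 * n) by
      rw [Real.sqrt_mul (by norm_num), show (4:ℝ) = 2 ^ 2 by norm_num,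
        Real.sqrt_sq (by norm_num)]]
    apply Real.sqrt_le_sqrt
    have h6 : 2 ^ D ≤ 2 * n := by
      rw [show D = D - 1 + 1 by omega, pow_succ]; omega
    have h7 : ((2:ℝ) ^ D) ≤ 2 * n := by exact_mod_cast h6
    have h8 : (0:ℝ) ≤ n := Nat.cast_nonneg n
    linarith
  calc |w n - w 0| ≤ δ / 2 * (Real.sqrt (2 ^ D) * dyadicRate q D) := hfin
    _ ≤ δ / 2 * (2 * Real.sqrt n * iota q n) := by gcongr
    _ = _ := by ring

end AlmostSure

/-! ### The martingale part, uniformly on compacts -/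

section MartingalePart

variable {Ω : Type*} {m0 : MeasurableSpace Ω} {μ : Measure Ω} [IsProbabilityMeasure μ]

lemma integral_indicator_sub_real {P : Measure ℝ} [IsProbabilityMeasure P] {A : Set ℝ}
    (hA : MeasurableSet A) :
    ∫ e, (A.indicator 1 e - P.real A) ∂P = 0 ∧
      ∫ e, (A.indicator 1 e - P.real A) ^ 2 ∂P ≤ P.real A := by
  have hi : Integrable (A.indicator (1 : ℝ → ℝ)) P := (integrable_const (1:ℝ)).indicator hA
  have h1 : ∫ e, A.indicator (1 : ℝ → ℝ) e ∂P = P.real A := by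
    rw [integral_indicator_one hA]
  constructor
  · rw [integral_sub hi (integrable_const _), h1]; simp
  · have h2 : ∀ e, (A.indicator (1 : ℝ → ℝ) e - P.real A) ^ 2
        = (1 - 2 * P.real A) * A.indicator (1 : ℝ → ℝ) e + P.real A ^ 2 := by
      intro e
      by_cases he : e ∈ A
      · simp [he]; ring
      · simp [he]
    simp only [h2]
    rw [integral_add (hi.const_mul _) (integrable_const _), integral_const_mul, h1]
    simp only [integral_const, probReal_univ, smul_eq_mul, one_mul]
    nlinarith [sq_nonneg (P.real A)]

lemma abs_indicator_sub_real_le {P : Measure ℝ} [IsProbabilityMeasure P] (A : Set ℝ) (e : ℝ) :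
    |A.indicator (1 : ℝ → ℝ) e - P.real A| ≤ 1 := by
  have h0 : 0 ≤ P.real A := measureReal_nonneg
  have h1 : P.real A ≤ 1 := measureReal_le_one
  by_cases he : e ∈ A
  · simp only [he, Set.indicator_of_mem, Pi.one_apply]; rw [abs_le]; constructor <;> linarith
  · simp only [he, not_false_eq_true, Set.indicator_of_notMem]; rw [abs_le]; constructor <;> linarith

/-- A process whose innovations are independent of the past, with innovation distribution
function `G`, Lipschitz with constant `C`. -/
structure IsInnovationModel (μ : Measure Ω) (ε Y : ℤ → Ω → ℝ) (G : ℝ → ℝ) (C : ℝ) : Prop where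
  measurable : ∀ k, Measurable (ε k)
  indep : iIndepFun ε μ
  ident : ∀ k, IdentDistrib (ε k) (ε 0) μ μ
  past : ∀ i, Measurable[sigmaOf ε {l | l < i}] (Y i)
  cdf : ∀ x, (μ.map (ε 0)).real (Set.Iic x) = G x
  lipschitz : ∀ x y, x ≤ y → G y - G x ≤ C * (y - x)
  nonneg : 0 ≤ C

/-- The martingale difference `1_{X_i ≤ x} - P(X_i ≤ x ∣ past)`. -/
def cdfInnovation (G : ℝ → ℝ) (ε Y : ℤ → Ω → ℝ) (i : ℤ) (x : ℝ) (ω : Ω) : ℝ :=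
  Set.indicator {y : ℝ | y ≤ x} 1 (Y i ω + ε i ω) - G (x - Y i ω)

/-- Sums of `cdfInnovation` over the block `[s, s + n)`. -/
def cdfInnovationSum (G : ℝ → ℝ) (ε Y : ℤ → Ω → ℝ) (s n : ℕ) (x : ℝ) (ω : Ω) : ℝ :=
  ∑ j ∈ Finset.range n, cdfInnovation G ε Y ((s + j : ℕ) : ℤ) x ω

variable {ε Y : ℤ → Ω → ℝ} {G : ℝ → ℝ} {C : ℝ}

namespace IsInnovationModel

lemma monotone (h : IsInnovationModel μ ε Y G C) : Monotone G := by
  intro x y hxy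
  have : IsProbabilityMeasure (μ.map (ε 0)) :=
    Measure.isProbabilityMeasure_map (h.measurable 0).aemeasurable
  rw [← h.cdf, ← h.cdf]
  exact measureReal_mono (Set.Iic_subset_Iic.2 hxy)

lemma measurable_past (h : IsInnovationModel μ ε Y G C) (i : ℤ) : Measurable (Y i) :=
  (h.past i).mono (sigmaOf_le h.measurable _) le_rfl

lemma measurable_cdfInnovationSum (h : IsInnovationModel μ ε Y G C) (s n : ℕ) (x : ℝ) :
    Measurable (cdfInnovationSum G ε Y s n x) := by
  refine Finset.measurable_fun_sum _ fun j _ => Measurable.sub ?_ ?_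
  · exact (measurable_one.indicator measurableSet_Iic).comp
      ((h.measurable_past _).add (h.measurable _))
  · exact h.monotone.measurable.comp (measurable_const.sub (h.measurable_past _))

lemma real_Ioc (h : IsInnovationModel μ ε Y G C) {x y : ℝ} (hxy : x ≤ y) :
    (μ.map (ε 0)).real (Set.Ioc x y) = G y - G x := by
  have : IsProbabilityMeasure (μ.map (ε 0)) :=
    Measure.isProbabilityMeasure_map (h.measurable 0).aemeasurable
  rw [← h.cdf, ← h.cdf, ← Set.Iic_sdiff_Iic, measureReal_sdiff (Set.Iic_subset_Iic.2 hxy)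
    measurableSet_Iic]

lemma isInnovation_point (h : IsInnovationModel μ ε Y G C) (x : ℝ) :
    IsInnovation (μ.map (ε 0)) 1
      (fun e y => Set.indicator {z : ℝ | z ≤ x} 1 (y + e) - G (x - y)) := by
  have : IsProbabilityMeasure (μ.map (ε 0)) :=
    Measure.isProbabilityMeasure_map (h.measurable 0).aemeasurable
  have key : ∀ e y, Set.indicator {z : ℝ | z ≤ x} (1 : ℝ → ℝ) (y + e) - G (x - y)
      = (Set.Iic (x - y)).indicator (1 : ℝ → ℝ) e - (μ.map (ε 0)).real (Set.Iic (x - y)) := by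
    intro e y
    rw [h.cdf]
    congr 1
    simp only [Set.indicator_apply, Set.mem_ofPred_eq, Set.mem_Iic, Pi.one_apply]
    congr 1
    rw [eq_iff_iff]
    constructor <;> intro h <;> linarith
  refine ⟨?_, fun e y => ?_, fun y => ?_, fun y => ?_⟩
  · refine Measurable.sub ?_ ?_
    · exact (measurable_one.indicator measurableSet_Iic).comp (measurable_snd.add measurable_fst)
    · exact h.monotone.measurable.comp (measurable_const.sub measurable_snd)
  · rw [key]; exact abs_indicator_sub_real_le _ _
  · simp only [key]; exact (integral_indicator_sub_real measurableSet_Iic).1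
  · simp only [key]
    exact (integral_indicator_sub_real measurableSet_Iic).2.trans measureReal_le_one

/-- Given the past `y`, the increment is a centred indicator of `(x - y, x' - y]`; its variance is
at most the probability of that interval, which the Lipschitz bound controls uniformly in `y`. -/
lemma isInnovation_interval (h : IsInnovationModel μ ε Y G C) {x x' : ℝ} (hx : x ≤ x') :
    IsInnovation (μ.map (ε 0)) (C * (x' - x))
      (fun e y => (Set.indicator {z : ℝ | z ≤ x'} 1 (y + e) - G (x' - y))
        - (Set.indicator {z : ℝ | z ≤ x} 1 (y + e) - G (x - y))) := by
  have : IsProbabilityMeasure (μ.map (ε 0)) :=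
    Measure.isProbabilityMeasure_map (h.measurable 0).aemeasurable
  have key : ∀ e y, (Set.indicator {z : ℝ | z ≤ x'} (1 : ℝ → ℝ) (y + e) - G (x' - y))
        - (Set.indicator {z : ℝ | z ≤ x} (1 : ℝ → ℝ) (y + e) - G (x - y))
      = (Set.Ioc (x - y) (x' - y)).indicator (1 : ℝ → ℝ) e
        - (μ.map (ε 0)).real (Set.Ioc (x - y) (x' - y)) := by
    intro e y
    rw [h.real_Ioc (by linarith)]
    simp only [Set.indicator_apply, Set.mem_ofPred_eq, Set.mem_Ioc, Pi.one_apply]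
    split_ifs <;> first | ring1 | (exfalso; grind)
  refine ⟨?_, fun e y => ?_, fun y => ?_, fun y => ?_⟩
  · exact (h.isInnovation_point x').measurable.sub (h.isInnovation_point x).measurable
  · rw [key]; exact abs_indicator_sub_real_le _ _
  · simp only [key]; exact (integral_indicator_sub_real measurableSet_Ioc).1
  · simp only [key]
    refine (integral_indicator_sub_real measurableSet_Ioc).2.trans ?_
    rw [h.real_Ioc (by linarith)]
    refine (h.lipschitz _ _ (by linarith)).trans (le_of_eq ?_)
    ring

lemma lintegral_exp_point_le (h : IsInnovationModel μ ε Y G C) (s n : ℕ) (x : ℝ) {u : ℝ}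
    (hu : |u| ≤ 1) :
    ∫⁻ ω, ENNReal.ofReal (Real.exp (u * cdfInnovationSum G ε Y s n x ω)) ∂μ
      ≤ ENNReal.ofReal (Real.exp (u ^ 2 * n)) := by
  have := lintegral_exp_sum_le h.measurable h.indep h.ident h.past (h.isInnovation_point x) hu s n
  rw [mul_one] at this
  exact this

lemma lintegral_exp_interval_le (h : IsInnovationModel μ ε Y G C) (s n : ℕ) {x x' : ℝ}
    (hx : x ≤ x') {u : ℝ} (hu : |u| ≤ 1) :
    ∫⁻ ω, ENNReal.ofReal (Real.exp (u * (cdfInnovationSum G ε Y s n x' ω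
      - cdfInnovationSum G ε Y s n x ω))) ∂μ
      ≤ ENNReal.ofReal (Real.exp (u ^ 2 * (C * (x' - x) * n))) := by
  have := lintegral_exp_sum_le h.measurable h.indep h.ident h.past (h.isInnovation_interval hx)
    hu s n
  rw [mul_assoc] at this
  refine le_trans (le_of_eq ?_) this
  refine lintegral_congr fun ω => ?_
  rw [Finset.sum_sub_distrib]
  rfl

lemma eLpNorm_point_le (h : IsInnovationModel μ ε Y G C) (s n : ℕ) (x : ℝ) {Q : ℕ}
    (hQ : 1 ≤ Q) :
    eLpNorm (cdfInnovationSum G ε Y s n x) (ENNReal.ofReal Q) μ ≤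
      ENNReal.ofReal (2 * Real.exp 1 * Q.factorial * (Real.sqrt n + 1)) :=
  eLpNorm_le_of_lintegral_exp (h.measurable_cdfInnovationSum s n x) (Nat.cast_nonneg n)
    (fun _ hu => h.lintegral_exp_point_le s n x hu) hQ

lemma eLpNorm_interval_le (h : IsInnovationModel μ ε Y G C) (s n : ℕ) {x x' : ℝ} (hx : x ≤ x')
    {Q : ℕ} (hQ : 1 ≤ Q) :
    eLpNorm (fun ω => cdfInnovationSum G ε Y s n x' ω - cdfInnovationSum G ε Y s n x ω)
      (ENNReal.ofReal Q) μ ≤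
      ENNReal.ofReal (2 * Real.exp 1 * Q.factorial * (Real.sqrt (C * (x' - x) * n) + 1)) := by
  have := h.nonneg
  exact eLpNorm_le_of_lintegral_exp
    ((h.measurable_cdfInnovationSum s n x').sub (h.measurable_cdfInnovationSum s n x))
    (by have : 0 ≤ x' - x := by linarith
        positivity)
    (fun _ hu => h.lintegral_exp_interval_le s n hx hu) hQ

/-- Tail bound for the increments of the martingale part. -/
lemma measure_interval_le (h : IsInnovationModel μ ε Y G C) (s n : ℕ) {x x' : ℝ} (hx : x ≤ x')
    {t : ℝ} (ht0 : 0 ≤ t) (ht : t ≤ 1) (lam : ℝ) :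
    μ {ω | lam ≤ |cdfInnovationSum G ε Y s n x' ω - cdfInnovationSum G ε Y s n x ω|} ≤
      ENNReal.ofReal (2 * Real.exp (t ^ 2 * (C * (x' - x) * n) - t * lam)) :=
  measure_le_abs_le_of_lintegral_exp
    ((h.measurable_cdfInnovationSum s n x').sub (h.measurable_cdfInnovationSum s n x))
    (fun _ hu => h.lintegral_exp_interval_le s n hx hu) ht0 ht lam

/-- Control of the martingale part between two grid points. -/
lemma abs_sub_le_of_mem_Icc (h : IsInnovationModel μ ε Y G C) (s n : ℕ) {g g' x : ℝ}
    (hg : g ≤ x) (hg' : x ≤ g') (ω : Ω) :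
    |cdfInnovationSum G ε Y s n x ω - cdfInnovationSum G ε Y s n g ω| ≤
      |cdfInnovationSum G ε Y s n g' ω - cdfInnovationSum G ε Y s n g ω| + n * (C * (g' - g)) := by
  have hind : ∀ (a b z : ℝ), a ≤ b → Set.indicator {y : ℝ | y ≤ a} (1 : ℝ → ℝ) z
      ≤ Set.indicator {y : ℝ | y ≤ b} 1 z := by
    intro a b z hab
    exact Set.indicator_le_indicator_of_subset (fun y hy => le_trans hy hab)
      (fun _ => zero_le_one) z
  have h1 : cdfInnovationSum G ε Y s n x ω - cdfInnovationSum G ε Y s n g ω ≤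
      (cdfInnovationSum G ε Y s n g' ω - cdfInnovationSum G ε Y s n g ω) + n * (C * (g' - g)) := by
    have : ∀ j ∈ Finset.range n, cdfInnovation G ε Y ((s + j : ℕ) : ℤ) x ω
        ≤ cdfInnovation G ε Y ((s + j : ℕ) : ℤ) g' ω + C * (g' - g) := by
      intro j _
      unfold cdfInnovation
      set y := Y ((s + j : ℕ) : ℤ) ω
      have h1 := hind x g' (y + ε ((s + j : ℕ) : ℤ) ω) hg'
      have h2 := h.lipschitz (x - y) (g' - y) (by linarith)
      have h3 := mul_le_mul_of_nonneg_left hg h.nonneg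
      linarith
    have h2 := Finset.sum_le_sum this
    rw [Finset.sum_add_distrib, Finset.sum_const, Finset.card_range, nsmul_eq_mul] at h2
    unfold cdfInnovationSum
    linarith
  have h2 : -(n * (C * (g' - g))) ≤
      cdfInnovationSum G ε Y s n x ω - cdfInnovationSum G ε Y s n g ω := by
    have : ∀ j ∈ Finset.range n, cdfInnovation G ε Y ((s + j : ℕ) : ℤ) g ω
        ≤ cdfInnovation G ε Y ((s + j : ℕ) : ℤ) x ω + C * (g' - g) := by
      intro j _
      unfold cdfInnovation
      set y := Y ((s + j : ℕ) : ℤ) ω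
      have h1 := hind g x (y + ε ((s + j : ℕ) : ℤ) ω) hg
      have h2 := h.lipschitz (g - y) (x - y) (by linarith)
      have h3 := mul_le_mul_of_nonneg_left hg' h.nonneg
      linarith
    have h2 := Finset.sum_le_sum this
    rw [Finset.sum_add_distrib, Finset.sum_const, Finset.card_range, nsmul_eq_mul] at h2
    unfold cdfInnovationSum
    linarith
  have h3 := le_abs_self (cdfInnovationSum G ε Y s n g' ω - cdfInnovationSum G ε Y s n g ω)
  have h4 := abs_nonneg (cdfInnovationSum G ε Y s n g' ω - cdfInnovationSum G ε Y s n g ω)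
  rw [abs_le]
  constructor <;> linarith

end IsInnovationModel

/-- The equidistant grid on `[-A, A]` with `N` cells. -/
def grid (A : ℝ) (N j : ℕ) : ℝ := -A + j * (2 * A / N)

lemma grid_sub (A : ℝ) (N i j : ℕ) : grid A N j - grid A N i = ((j:ℝ) - i) * (2 * A / N) := by
  unfold grid; ring

lemma grid_mono {A : ℝ} (hA : 0 ≤ A) (N : ℕ) {i j : ℕ} (hij : i ≤ j) :
    grid A N i ≤ grid A N j := by
  have h : (i:ℝ) ≤ j := by exact_mod_cast hij
  unfold grid
  gcongr

lemma exists_grid_cell {A x : ℝ} (hA : 0 < A) {N : ℕ} (hN : 0 < N) (hx : x ∈ Set.Icc (-A) A) :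
    ∃ j < N, grid A N j ≤ x ∧ x ≤ grid A N (j + 1) := by
  have hN' : (0:ℝ) < N := by exact_mod_cast hN
  have hη : 0 < 2 * A / N := by positivity
  set z := (x + A) / (2 * A / N) with hz
  have hz0 : 0 ≤ z := div_nonneg (by linarith [hx.1]) hη.le
  have hxz : x = -A + z * (2 * A / N) := by rw [hz]; field_simp; ring
  have hzN : z ≤ N := by
    rw [hz, div_le_iff₀ hη]; field_simp; linarith [hx.2]
  rcases hzN.lt_or_eq with hlt | heq
  · refine ⟨⌊z⌋₊, (Nat.floor_lt hz0).2 hlt, ?_, ?_⟩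
    · rw [hxz]; unfold grid
      have := Nat.floor_le hz0
      gcongr
    · rw [hxz]; unfold grid
      have := (Nat.lt_floor_add_one z).le
      push_cast
      gcongr
  · refine ⟨N - 1, by omega, ?_, ?_⟩
    · have h1 : ((N - 1 : ℕ) : ℝ) ≤ z := by rw [heq]; exact_mod_cast Nat.sub_le N 1
      rw [hxz]; unfold grid
      gcongr
    · rw [Nat.sub_add_cancel hN, hxz, heq]; rfl

/-- The random majorant for the supremum over `[-A, A]` of the martingale part on a dyadic
block. -/
def blockMajorant (G : ℝ → ℝ) (ε Y : ℤ → Ω → ℝ) (C A : ℝ) (d s : ℕ) (ω : Ω) : ℝ≥0∞ :=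
  ‖cdfInnovationSum G ε Y s (2 ^ d) (-A) ω‖ₑ
    + (3 * chainMax (fun l j ω => ‖cdfInnovationSum G ε Y s (2 ^ d) (grid A (2 ^ d) (j + 2 ^ l)) ω
        - cdfInnovationSum G ε Y s (2 ^ d) (grid A (2 ^ d) j) ω‖ₑ) d 0 ω
    + ENNReal.ofReal (2 * A * C))

namespace IsInnovationModel

lemma measurable_blockMajorant (h : IsInnovationModel μ ε Y G C) (A : ℝ) (d s : ℕ) :
    Measurable (blockMajorant G ε Y C A d s) := by
  refine (h.measurable_cdfInnovationSum _ _ _).enorm.add (Measurable.add ?_ measurable_const)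
  refine (measurable_chainMax (fun l j => ?_) d 0).const_mul 3
  exact ((h.measurable_cdfInnovationSum _ _ _).sub (h.measurable_cdfInnovationSum _ _ _)).enorm

/-- Compare `x` with the endpoints of its grid cell by monotonicity, and reach both endpoints from
`-A` by chaining; the left one is used twice, whence the factor `3`. With `2^d` cells for a block of
length `2^d`, the discretisation error is the constant `2AC`. -/
lemma enorm_le_blockMajorant (h : IsInnovationModel μ ε Y G C) {A : ℝ} (hA : 0 < A) (d s : ℕ)
    {x : ℝ} (hx : x ∈ Set.Icc (-A) A) (ω : Ω) :
    ‖cdfInnovationSum G ε Y s (2 ^ d) x ω‖ₑ ≤ blockMajorant G ε Y C A d s ω := by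
  set M := fun x => cdfInnovationSum G ε Y s (2 ^ d) x ω with hM
  obtain ⟨j, hj, hjx, hxj⟩ := exists_grid_cell hA (N := 2 ^ d) (by positivity) hx
  set T := chainMax (fun l j ω => ‖cdfInnovationSum G ε Y s (2 ^ d) (grid A (2 ^ d) (j + 2 ^ l)) ω
        - cdfInnovationSum G ε Y s (2 ^ d) (grid A (2 ^ d) j) ω‖ₑ) d 0 ω with hT
  have hch : ∀ i, i ≤ 2 ^ d → ‖M (grid A (2 ^ d) i) - M (-A)‖ₑ ≤ T := by
    intro i hi
    have := enorm_sub_le_chainMax (ω := ω)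
      (B := fun l j ω => ‖cdfInnovationSum G ε Y s (2 ^ d) (grid A (2 ^ d) (j + 2 ^ l)) ω
        - cdfInnovationSum G ε Y s (2 ^ d) (grid A (2 ^ d) j) ω‖ₑ)
      (w := fun j => M (grid A (2 ^ d) j)) (fun _ _ => le_rfl) d 0 i hi
    have h0 : grid A (2 ^ d) 0 = -A := by simp [grid]
    simpa [h0] using this
  have h1 := hch j hj.le
  have h2 := hch (j + 1) hj
  have h3 := h.abs_sub_le_of_mem_Icc s (2 ^ d) hjx hxj ω
  have h4 : ((2 ^ d : ℕ) : ℝ) * (C * (grid A (2 ^ d) (j + 1) - grid A (2 ^ d) j)) = 2 * A * C := by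
    rw [grid_sub]
    push_cast
    field_simp
    ring
  rw [h4] at h3
  have h5 : |M x| ≤ |M (-A)| + (2 * |M (grid A (2 ^ d) j) - M (-A)|
      + |M (grid A (2 ^ d) (j + 1)) - M (-A)| + 2 * A * C) := by
    have e1 : M x = M (-A) + (M (grid A (2 ^ d) j) - M (-A)) + (M x - M (grid A (2 ^ d) j)) := by
      ring
    have e2 : M (grid A (2 ^ d) (j + 1)) - M (grid A (2 ^ d) j)
      = (M (grid A (2 ^ d) (j + 1)) - M (-A)) - (M (grid A (2 ^ d) j) - M (-A)) := by ring
    have a1 := abs_add_le (M (-A) + (M (grid A (2 ^ d) j) - M (-A))) (M x - M (grid A (2 ^ d) j))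
    have a2 := abs_add_le (M (-A)) (M (grid A (2 ^ d) j) - M (-A))
    have a3 := abs_sub (M (grid A (2 ^ d) (j + 1)) - M (-A)) (M (grid A (2 ^ d) j) - M (-A))
    rw [← e1] at a1
    rw [← e2] at a3
    change |M x - M (grid A (2 ^ d) j)| ≤ _ at h3
    change _ ≤ |M (grid A (2 ^ d) (j + 1)) - M (grid A (2 ^ d) j)| + _ at h3
    linarith
  have h6 : ‖M x‖ₑ ≤ ‖M (-A)‖ₑ + (2 * ‖M (grid A (2 ^ d) j) - M (-A)‖ₑ
      + ‖M (grid A (2 ^ d) (j + 1)) - M (-A)‖ₑ + ENNReal.ofReal (2 * A * C)) := by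
    have hC := h.nonneg
    simp only [← ofReal_norm, Real.norm_eq_abs]
    rw [show (2 : ℝ≥0∞) = ENNReal.ofReal 2 by simp, ← ENNReal.ofReal_mul (by norm_num),
      ← ENNReal.ofReal_add (by positivity) (by positivity),
      ← ENNReal.ofReal_add (by positivity) (by positivity),
      ← ENNReal.ofReal_add (by positivity) (by positivity)]
    exact ENNReal.ofReal_le_ofReal h5
  refine h6.trans ?_
  unfold blockMajorant
  rw [← hT]
  refine add_le_add le_rfl (add_le_add ?_ le_rfl)
  calc 2 * ‖M (grid A (2 ^ d) j) - M (-A)‖ₑ + ‖M (grid A (2 ^ d) (j + 1)) - M (-A)‖ₑ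
      ≤ 2 * T + T := by gcongr
    _ = 3 * T := by ring

/-- Crossing `2^l` cells has variance proxy `2AC · 2^l`, so the grid increments satisfy the square
root law that chaining requires, now with space in place of time. As `Q > 2`, the chaining factor
does not depend on `d`. -/
lemma exists_eLpNorm_blockMajorant_le (h : IsInnovationModel μ ε Y G C) {A : ℝ} (hA : 0 < A)
    {Q : ℕ} (hQ : 2 < Q) : ∃ K : ℝ, 0 ≤ K ∧ ∀ d s,
    eLpNorm (blockMajorant G ε Y C A d s) (ENNReal.ofReal Q) μ
      ≤ ENNReal.ofReal (K * Real.sqrt (2 ^ d)) := by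
  have hC := h.nonneg
  have hQ2 : (2:ℝ) < Q := by exact_mod_cast hQ
  have hp1 : 1 ≤ ENNReal.ofReal Q := by
    rw [← ENNReal.ofReal_one]; exact ENNReal.ofReal_le_ofReal (by linarith)
  set c : ℝ := 2 * Real.exp 1 * Q.factorial with hc
  have hc0 : 0 ≤ c := by positivity
  set K' : ℝ := c * (Real.sqrt (2 * A * C) + 1) with hK'
  set cf := chainFactor Q 0 with hcf
  have hcf1 : 1 ≤ cf := one_le_chainFactor hQ2.le 0
  refine ⟨c * 2 + (3 * (K' * cf) + 2 * A * C), by positivity, fun d s => ?_⟩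
  set R := Real.sqrt (2 ^ d) with hR
  have hR1 : 1 ≤ R := Real.one_le_sqrt.2 (one_le_pow₀ (by norm_num))
  set T := chainMax (fun l j ω => ‖cdfInnovationSum G ε Y s (2 ^ d) (grid A (2 ^ d) (j + 2 ^ l)) ω
        - cdfInnovationSum G ε Y s (2 ^ d) (grid A (2 ^ d) j) ω‖ₑ) d 0 with hT
  have hmsp : ∀ l j : ℕ, Measurable fun ω : Ω =>
      ‖cdfInnovationSum G ε Y s (2 ^ d) (grid A (2 ^ d) (j + 2 ^ l)) ω
        - cdfInnovationSum G ε Y s (2 ^ d) (grid A (2 ^ d) j) ω‖ₑ := fun l j =>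
    ((h.measurable_cdfInnovationSum _ _ _).sub (h.measurable_cdfInnovationSum _ _ _)).enorm
  have hTm : Measurable T := measurable_chainMax hmsp d 0
  have hTn : eLpNorm T (ENNReal.ofReal Q) μ ≤ ENNReal.ofReal (K' * cf * R) := by
    have h0 := eLpNorm_chainMax_le (μ := μ) hQ2.le (by positivity : 0 ≤ K') hmsp ?_ d 0
    · have : chainFactor Q d = cf := by
        rw [hcf, chainFactor, chainFactor, if_neg hQ2.ne', if_neg hQ2.ne']
      rwa [this] at h0
    · intro l j
      rw [eLpNorm_enorm]
      refine (h.eLpNorm_interval_le s (2 ^ d) (grid_mono hA.le _ (Nat.le_add_right j _))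
        (by omega : 1 ≤ Q)).trans (ENNReal.ofReal_le_ofReal ?_)
      have h1 : C * (grid A (2 ^ d) (j + 2 ^ l) - grid A (2 ^ d) j) * ((2 ^ d : ℕ) : ℝ)
          = 2 * A * C * 2 ^ l := by
        rw [grid_sub]; push_cast; field_simp; ring
      have h2 : 1 ≤ Real.sqrt (2 ^ l) := Real.one_le_sqrt.2 (one_le_pow₀ (by norm_num))
      rw [h1, Real.sqrt_mul (by positivity), hK', mul_assoc c]
      apply mul_le_mul_of_nonneg_left _ hc0
      rw [add_mul, one_mul]
      linarith
  have hsplit : eLpNorm (blockMajorant G ε Y C A d s) (ENNReal.ofReal Q) μ ≤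
      eLpNorm (fun ω => ‖cdfInnovationSum G ε Y s (2 ^ d) (-A) ω‖ₑ) (ENNReal.ofReal Q) μ
      + (eLpNorm (fun ω => 3 * T ω) (ENNReal.ofReal Q) μ
        + eLpNorm (fun _ : Ω => ENNReal.ofReal (2 * A * C)) (ENNReal.ofReal Q) μ) := by
    refine (eLpNorm_add_le (h.measurable_cdfInnovationSum _ _ _).enorm.aestronglyMeasurable
      ((hTm.const_mul 3).add measurable_const).aestronglyMeasurable hp1).trans ?_
    refine add_le_add le_rfl ?_
    exact eLpNorm_add_le (hTm.const_mul 3).aestronglyMeasurable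
      measurable_const.aestronglyMeasurable hp1
  refine hsplit.trans ?_
  have e1 : eLpNorm (fun ω => ‖cdfInnovationSum G ε Y s (2 ^ d) (-A) ω‖ₑ) (ENNReal.ofReal Q) μ
      ≤ ENNReal.ofReal (c * 2 * R) := by
    rw [eLpNorm_enorm]
    refine (h.eLpNorm_point_le s (2 ^ d) (-A) (by omega : 1 ≤ Q)).trans
      (ENNReal.ofReal_le_ofReal ?_)
    push_cast
    rw [mul_assoc c 2]
    apply mul_le_mul_of_nonneg_left _ hc0
    linarith
  have e2 : eLpNorm (fun ω => 3 * T ω) (ENNReal.ofReal Q) μ ≤ ENNReal.ofReal (3 * (K' * cf) * R) := by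
    have hQ0 : (0:ℝ) < Q := by linarith
    rw [eLpNorm_ennreal_le_iff hQ0] at hTn ⊢
    simp only [ENNReal.mul_rpow_of_nonneg _ _ hQ0.le]
    rw [lintegral_const_mul _ (hTm.pow_const _), mul_assoc 3, ENNReal.ofReal_mul (by norm_num),
      ENNReal.mul_rpow_of_nonneg _ _ hQ0.le]
    simp only [ENNReal.ofReal_ofNat]
    gcongr
  have e3 : eLpNorm (fun _ : Ω => ENNReal.ofReal (2 * A * C)) (ENNReal.ofReal Q) μ
      ≤ ENNReal.ofReal (2 * A * C * R) := by
    have hQ0 : (0:ℝ) < Q := by linarith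
    rw [eLpNorm_ennreal_le_iff hQ0]
    simp only [lintegral_const, measure_univ, mul_one]
    refine ENNReal.rpow_le_rpow (ENNReal.ofReal_le_ofReal ?_) hQ0.le
    have : 0 ≤ 2 * A * C := by positivity
    nlinarith
  refine (add_le_add e1 (add_le_add e2 e3)).trans (le_of_eq ?_)
  rw [← ENNReal.ofReal_add (by positivity) (by positivity),
    ← ENNReal.ofReal_add (by positivity) (by positivity)]
  congr 1; ring

/-- The martingale part is `o(√n ι_q(n))`, uniformly on compact intervals. -/
lemma ae_martingale_part (h : IsInnovationModel μ ε Y G C) {A q : ℝ} (hA : 0 < A) (hq : 2 ≤ q) :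
    ∀ᵐ ω ∂μ, ∀ δ : ℝ, 0 < δ → ∀ᶠ n : ℕ in atTop, ∀ x ∈ Set.Icc (-A) A,
      |cdfInnovationSum G ε Y 1 n x ω| ≤ δ * (Real.sqrt n * iota q n) := by
  -- An integer, as the moment bounds require, at least `q`, and strictly above `2` even when `q =
  -- 2`, so that no logarithm is lost.
  set Q : ℕ := ⌈q⌉₊ + 1 with hQdef
  have hqQ : q ≤ Q := (Nat.le_ceil q).trans (by rw [hQdef]; push_cast; linarith)
  have hQ2' : (2:ℝ) < Q := by
    have := Nat.le_ceil q
    rw [hQdef]; push_cast; linarith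
  have hQ2 : 2 < Q := by exact_mod_cast hQ2'
  obtain ⟨K, hK, hB⟩ := h.exists_eLpNorm_blockMajorant_le hA hQ2
  have key := ae_eventually_abs_sub_le (B := fun d s => blockMajorant G ε Y C A d (1 + s)) hq
    hQ2'.le hK (fun d s => h.measurable_blockMajorant A d _) (fun d s => hB d _)
    (summable_chainFactor_div_of_le hq hQ2' hqQ)
  filter_upwards [key] with ω hω δ hδ
  filter_upwards [hω δ hδ] with n hn x hx
  -- The exceptional null set depends only on the majorant, so the uncountable family of `x` is
  -- covered at once.
  have := hn (fun n => cdfInnovationSum G ε Y 1 n x ω) ?_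
  · simpa [cdfInnovationSum] using this
  · intro d s
    have e : cdfInnovationSum G ε Y 1 (s + 2 ^ d) x ω - cdfInnovationSum G ε Y 1 s x ω
        = cdfInnovationSum G ε Y (1 + s) (2 ^ d) x ω := by
      unfold cdfInnovationSum
      rw [Finset.sum_range_add]
      simp only [add_assoc]
      ring
    rw [e]
    exact h.enorm_le_blockMajorant hA d (1 + s) hx ω

end IsInnovationModel

end MartingalePart

/-! ### Oscillation of the martingale part -/

section Oscillation

variable {Ω : Type*} {m0 : MeasurableSpace Ω} {μ : Measure Ω} [IsProbabilityMeasure μ]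
  {ε Y : ℤ → Ω → ℝ} {G : ℝ → ℝ} {C : ℝ}

lemma IsInnovationModel.measure_interval_le_of_log (h : IsInnovationModel μ ε Y G C) (s n : ℕ)
    {x x' V C' : ℝ} (hn : 2 ≤ n) (hx : x ≤ x') (hV : Real.log n ≤ V)
    (hC' : C * (x' - x) * n ≤ C' * V) :
    μ {ω | (C' + 4) * Real.sqrt (V * Real.log n) ≤
      |cdfInnovationSum G ε Y s n x' ω - cdfInnovationSum G ε Y s n x ω|} ≤
      ENNReal.ofReal (2 / (n:ℝ) ^ 4) := by
  have hn' : (1:ℝ) < n := by exact_mod_cast hn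
  have hl : 0 < Real.log n := Real.log_pos hn'
  have hV0 : 0 < V := hl.trans_le hV
  -- This `t` balances the two terms of the exponent: the variance term is at most `C' log n` and
  -- the linear term equals `(C' + 4) log n`, leaving `n^{-4}`. The hypothesis `log n ≤ V` is
  -- exactly `t ≤ 1`.
  set t := Real.sqrt (Real.log n / V) with ht
  have ht2 : t ^ 2 = Real.log n / V := Real.sq_sqrt (by positivity)
  have ht1 : t ≤ 1 := Real.sqrt_le_one.2 ((div_le_one hV0).2 hV)
  refine (h.measure_interval_le s n hx (Real.sqrt_nonneg _) ht1 _).trans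
    (ENNReal.ofReal_le_ofReal ?_)
  have h1 : t * Real.sqrt (V * Real.log n) = Real.log n := by
    rw [ht, ← Real.sqrt_mul (by positivity), show Real.log n / V * (V * Real.log n)
      = Real.log n ^ 2 by field_simp, Real.sqrt_sq hl.le]
  have h2 : t ^ 2 * (C * (x' - x) * n) ≤ C' * Real.log n := by
    refine (mul_le_mul_of_nonneg_left hC' (sq_nonneg t)).trans (le_of_eq ?_)
    rw [ht2]; field_simp
  have h3 : t ^ 2 * (C * (x' - x) * n) - t * ((C' + 4) * Real.sqrt (V * Real.log n))
      ≤ -(4 * Real.log n) := by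
    have : t * ((C' + 4) * Real.sqrt (V * Real.log n)) = (C' + 4) * Real.log n := by
      calc _ = (C' + 4) * (t * Real.sqrt (V * Real.log n)) := by ring
        _ = _ := by rw [h1]
    linarith
  have h4 : Real.exp (-(4 * Real.log n)) = ((n:ℝ) ^ 4)⁻¹ := by
    rw [Real.exp_neg, show 4 * Real.log n = Real.log ((n:ℝ) ^ 4) by rw [Real.log_pow]; norm_num,
      Real.exp_log (by positivity)]
  calc 2 * Real.exp _ ≤ 2 * Real.exp (-(4 * Real.log n)) := by
        have := Real.exp_le_exp.2 h3
        linarith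
    _ = _ := by rw [h4]; ring

/-- Uniform modulus of continuity of the martingale part at scale `b n`. -/
lemma IsInnovationModel.ae_oscillation (h : IsInnovationModel μ ε Y G C) {A : ℝ} (hA : 0 < A)
    {b : ℕ → ℝ} (hb : ∀ᶠ n : ℕ in atTop, Real.log n ≤ n * b n) :
    ∃ K : ℝ, 0 ≤ K ∧ ∀ᵐ ω ∂μ, ∀ᶠ n : ℕ in atTop, ∀ x ∈ Set.Icc (-A) A, ∀ y ∈ Set.Icc (-A) A,
      |x - y| ≤ b n →
      |cdfInnovationSum G ε Y 1 n x ω - cdfInnovationSum G ε Y 1 n y ω|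
        ≤ K * Real.sqrt (n * b n * Real.log n) := by
  have hC := h.nonneg
  obtain ⟨n0, hn0⟩ := eventually_atTop.1 hb
  -- Replacing two points by their left grid points lengthens the gap by at most two meshes, and `n
  -- (b + 4A/n) ≤ (1 + 4A) n b` once `n b ≥ log n ≥ 1`.
  set C' := C * (1 + 4 * A) with hC'
  have hC'0 : 0 ≤ C' := by positivity
  set lam : ℕ → ℝ := fun n => (C' + 4) * Real.sqrt (n * b n * Real.log n) with hlam
  set E : ℕ → ℕ → ℕ → Set Ω := fun n j k => {ω | (n0 + 3 ≤ n ∧ j ≤ k ∧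
    grid A n k - grid A n j ≤ b n + 2 * (2 * A / n)) ∧ lam n ≤
      |cdfInnovationSum G ε Y 1 n (grid A n k) ω - cdfInnovationSum G ε Y 1 n (grid A n j) ω|}
    with hE
  have hlog1 : ∀ n : ℕ, n0 + 3 ≤ n → 1 ≤ Real.log n := by
    intro n hn
    have hn' : (3:ℝ) ≤ n := by exact_mod_cast (by omega : 3 ≤ n)
    rw [Real.le_log_iff_exp_le (by linarith)]
    exact Real.exp_one_lt_three.le.trans hn'
  have hEle : ∀ n j k, μ (E n j k) ≤ ENNReal.ofReal (2 / (n:ℝ) ^ 4) := by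
    intro n j k
    by_cases hc : n0 + 3 ≤ n ∧ j ≤ k ∧ grid A n k - grid A n j ≤ b n + 2 * (2 * A / n)
    · have hV := hn0 n (by omega)
      have hn' : (0:ℝ) < n := by exact_mod_cast (by omega : 0 < n)
      have h1 := hlog1 n hc.1
      refine (measure_mono fun ω hω => ?_).trans (h.measure_interval_le_of_log 1 n
        (V := n * b n) (C' := C') (by omega) (grid_mono hA.le n hc.2.1) hV ?_)
      · exact hω.2
      · have h2 : (grid A n k - grid A n j) * n ≤ n * b n + 4 * A := by
          calc _ ≤ (b n + 2 * (2 * A / n)) * n := mul_le_mul_of_nonneg_right hc.2.2 hn'.le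
            _ = _ := by field_simp; ring
        have h3 : (grid A n k - grid A n j) * n ≤ (1 + 4 * A) * (n * b n) := by nlinarith
        rw [mul_assoc, hC', mul_assoc]
        exact mul_le_mul_of_nonneg_left h3 hC
    · have : E n j k = ∅ := by
        ext ω; simp only [hE, Set.mem_ofPred_eq, Set.mem_empty_iff_false, iff_false]
        exact fun hh => hc hh.1
      rw [this]; simp
  set bad : ℕ → Set Ω := fun n => ⋃ j ∈ Finset.range (n + 1), ⋃ k ∈ Finset.range (n + 1), E n j k
    with hbad
  -- There are `(n + 1)²` grid pairs, each of probability at most `2 / n⁴`; the result is summable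
  -- for Borel–Cantelli.
  have hbadle : ∀ n, μ (bad n) ≤ ENNReal.ofReal (8 * (1 / (n:ℝ) ^ 2)) := by
    intro n
    have h1 : μ (bad n) ≤ ∑ j ∈ Finset.range (n + 1), ∑ k ∈ Finset.range (n + 1),
        ENNReal.ofReal (2 / (n:ℝ) ^ 4) :=
      (measure_biUnion_finset_le _ _).trans (Finset.sum_le_sum fun j _ =>
        (measure_biUnion_finset_le _ _).trans (Finset.sum_le_sum fun k _ => hEle n j k))
    refine h1.trans ?_
    simp only [Finset.sum_const, Finset.card_range, nsmul_eq_mul]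
    rw [← ENNReal.ofReal_natCast, ← ENNReal.ofReal_mul (by positivity),
      ← ENNReal.ofReal_mul (by positivity)]
    apply ENNReal.ofReal_le_ofReal
    rcases Nat.eq_zero_or_pos n with rfl | hn
    · simp
    · have hn' : (1:ℝ) ≤ n := by exact_mod_cast hn
      have e : 8 * (1 / (n:ℝ) ^ 2) = (2 * n) * ((2 * n) * (2 / (n:ℝ) ^ 4)) := by
        field_simp; norm_num
      rw [e]
      push_cast
      gcongr <;> linarith
  have hsum : ∑' n, μ (bad n) ≠ ∞ := by
    refine ne_top_of_le_ne_top ?_ (ENNReal.tsum_le_tsum hbadle)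
    exact ((Real.summable_one_div_nat_pow.2 (by norm_num)).mul_left 8).tsum_ofReal_ne_top
  -- Three grid increments: the two cells containing `x` and `y`, and the passage between their left
  -- ends. The two cell errors `2AC` are absorbed because the square root is at least one.
  refine ⟨3 * (C' + 4) + 4 * A * C, by positivity, ?_⟩
  filter_upwards [ae_eventually_notMem hsum] with ω hω
  filter_upwards [hω, eventually_ge_atTop (n0 + 3)] with n hn hn3 x hx y hy hxy
  have hnpos : 0 < n := by omega
  have hn' : (0:ℝ) < n := by exact_mod_cast hnpos
  have hη : 0 < 2 * A / n := by positivity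
  have hlog := hlog1 n hn3
  have hV := hn0 n (by omega)
  have hgood : ∀ j ≤ n, ∀ k ≤ n, |grid A n k - grid A n j| ≤ b n + 2 * (2 * A / n) →
      |cdfInnovationSum G ε Y 1 n (grid A n k) ω - cdfInnovationSum G ε Y 1 n (grid A n j) ω|
        ≤ lam n := by
    have aux : ∀ j ≤ n, ∀ k ≤ n, j ≤ k → grid A n k - grid A n j ≤ b n + 2 * (2 * A / n) →
      |cdfInnovationSum G ε Y 1 n (grid A n k) ω - cdfInnovationSum G ε Y 1 n (grid A n j) ω|
        ≤ lam n := by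
      intro j hj k hk hjk hg
      by_contra hcon
      apply hn
      simp only [hbad, Set.mem_iUnion, Finset.mem_range]
      exact ⟨j, by omega, k, by omega, ⟨hn3, hjk, hg⟩, (not_le.1 hcon).le⟩
    intro j hj k hk hg
    rcases le_total j k with hjk | hjk
    · exact aux j hj k hk hjk ((le_abs_self _).trans hg)
    · rw [abs_sub_comm]
      refine aux k hk j hj hjk (le_trans ?_ hg)
      rw [abs_sub_comm]; exact le_abs_self _
  obtain ⟨j, hj, hjx, hxj⟩ := exists_grid_cell hA hnpos hx
  obtain ⟨k, hk, hky, hyk⟩ := exists_grid_cell hA hnpos hy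
  have step : ∀ i, grid A n (i + 1) - grid A n i = 2 * A / n := by
    intro i; rw [grid_sub]; push_cast; ring
  have cell : ∀ i, n * (C * (grid A n (i + 1) - grid A n i)) = 2 * A * C := by
    intro i; rw [step]; field_simp
  have hb0 : 0 ≤ b n := (abs_nonneg _).trans hxy
  have hstep : ∀ i, |grid A n (i + 1) - grid A n i| ≤ b n + 2 * (2 * A / n) := by
    intro i; rw [step, abs_of_pos hη]; linarith
  have a1 := h.abs_sub_le_of_mem_Icc 1 n hjx hxj ω
  have a2 := h.abs_sub_le_of_mem_Icc 1 n hky hyk ω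
  rw [cell] at a1 a2
  have b1 := hgood j hj.le (j + 1) hj (hstep j)
  have b2 := hgood k hk.le (k + 1) hk (hstep k)
  have b3 := hgood k hk.le j hj.le (by
    have s1 := step j
    have s2 := step k
    have := abs_le.1 hxy
    rw [abs_le]; constructor <;> linarith)
  have hsq : 1 ≤ Real.sqrt (n * b n * Real.log n) := Real.one_le_sqrt.2 (by nlinarith)
  have e : cdfInnovationSum G ε Y 1 n x ω - cdfInnovationSum G ε Y 1 n y ω
      = (cdfInnovationSum G ε Y 1 n x ω - cdfInnovationSum G ε Y 1 n (grid A n j) ω)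
      + (cdfInnovationSum G ε Y 1 n (grid A n j) ω - cdfInnovationSum G ε Y 1 n (grid A n k) ω)
      - (cdfInnovationSum G ε Y 1 n y ω - cdfInnovationSum G ε Y 1 n (grid A n k) ω) := by ring
  have t1 := abs_sub (cdfInnovationSum G ε Y 1 n x ω - cdfInnovationSum G ε Y 1 n (grid A n j) ω
      + (cdfInnovationSum G ε Y 1 n (grid A n j) ω - cdfInnovationSum G ε Y 1 n (grid A n k) ω))
      (cdfInnovationSum G ε Y 1 n y ω - cdfInnovationSum G ε Y 1 n (grid A n k) ω)
  have t2 := abs_add_le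
    (cdfInnovationSum G ε Y 1 n x ω - cdfInnovationSum G ε Y 1 n (grid A n j) ω)
    (cdfInnovationSum G ε Y 1 n (grid A n j) ω - cdfInnovationSum G ε Y 1 n (grid A n k) ω)
  rw [← e] at t1
  have hAC : 0 ≤ 4 * A * C := by positivity
  have hfin := mul_le_mul_of_nonneg_left hsq hAC
  simp only [hlam] at b1 b2 b3
  linarith

end Oscillation

/-! ### The smooth part, uniformly on compacts -/

section SmoothPart

variable {Ω : Type*} {m0 : MeasurableSpace Ω} {μ : Measure Ω} [IsProbabilityMeasure μ]
  {Y : ℤ → Ω → ℝ}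

/-- `Y` satisfies the square root law in `L^q` for bounded Lipschitz functionals. -/
def HasMomentBound (μ : Measure Ω) (Y : ℤ → Ω → ℝ) (q : ℝ) : Prop :=
  ∀ H : ℝ, 0 ≤ H → ∃ K : ℝ, 0 ≤ K ∧ ∀ h : ℝ → ℝ, Continuous h → (∀ x, |h x| ≤ H) →
    (∀ x y, |h x - h y| ≤ H * |x - y|) → ∀ s n : ℕ,
    eLpNorm (fun ω => ∑ j ∈ Finset.range n, (h (Y ((s + j : ℕ) : ℤ) ω) - ∫ ω', h (Y 0 ω') ∂μ))
      (ENNReal.ofReal q) μ ≤ ENNReal.ofReal (K * Real.sqrt n)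

/-- Centred sums of `g (x - Y_i)` over the block `[s, s + n)`. -/
def smoothSum (μ : Measure Ω) (Y : ℤ → Ω → ℝ) (g : ℝ → ℝ) (s n : ℕ) (x : ℝ) (ω : Ω) : ℝ :=
  ∑ j ∈ Finset.range n, (g (x - Y ((s + j : ℕ) : ℤ) ω) - ∫ ω', g (x - Y 0 ω') ∂μ)

/-- Minkowski's integral inequality in the form needed here, from Hölder on the finite measure `ν`
and Tonelli. -/
lemma eLpNorm_lintegral_le {ν : Measure ℝ} [IsFiniteMeasure ν] {q : ℝ} (hq : 1 ≤ q)
    {φ : ℝ → Ω → ℝ≥0∞} (hφ : Measurable (Function.uncurry φ)) {u : ℝ≥0∞}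
    (hu : ∀ x, eLpNorm (φ x) (ENNReal.ofReal q) μ ≤ u) :
    eLpNorm (fun ω => ∫⁻ x, φ x ω ∂ν) (ENNReal.ofReal q) μ ≤ ν Set.univ * u := by
  have hq0 : 0 < q := by linarith
  rw [eLpNorm_ennreal_le_iff hq0]
  have h1 : ∀ ω, (∫⁻ x, φ x ω ∂ν) ^ q ≤ ν Set.univ ^ (q - 1) * ∫⁻ x, φ x ω ^ q ∂ν := by
    intro ω
    have hm : Measurable fun x => φ x ω := hφ.comp (measurable_id.prodMk measurable_const)
    have h2 := eLpNorm_le_eLpNorm_mul_rpow_measure_univ (μ := ν) (f := fun x => φ x ω)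
      (p := 1) (q := ENNReal.ofReal q)
      (by rw [← ENNReal.ofReal_one]; exact ENNReal.ofReal_le_ofReal hq) hm.aestronglyMeasurable
    rw [eLpNorm_one_eq_lintegral_enorm, eLpNorm_eq_lintegral_rpow_enorm_toReal (by simpa using hq0)
      ENNReal.ofReal_ne_top, ENNReal.toReal_ofReal hq0.le] at h2
    simp only [enorm_eq_self, ENNReal.toReal_one, div_one] at h2
    refine (ENNReal.rpow_le_rpow h2 hq0.le).trans (le_of_eq ?_)
    rw [ENNReal.mul_rpow_of_nonneg _ _ hq0.le, ← ENNReal.rpow_mul, ← ENNReal.rpow_mul,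
      one_div_mul_cancel hq0.ne', ENNReal.rpow_one, mul_comm]
    congr 2
    field_simp
  calc ∫⁻ ω, (∫⁻ x, φ x ω ∂ν) ^ q ∂μ ≤ ∫⁻ ω, ν Set.univ ^ (q - 1) * ∫⁻ x, φ x ω ^ q ∂ν ∂μ :=
        lintegral_mono h1
    _ = ν Set.univ ^ (q - 1) * ∫⁻ x, ∫⁻ ω, φ x ω ^ q ∂μ ∂ν := by
        rw [lintegral_const_mul' _ _ (ENNReal.rpow_ne_top_of_nonneg (by linarith)
          (measure_ne_top _ _)), lintegral_lintegral_swap]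
        exact ((hφ.comp measurable_swap).pow_const q).aemeasurable
    _ ≤ ν Set.univ ^ (q - 1) * ∫⁻ x, u ^ q ∂ν := by
        refine mul_le_mul_right (lintegral_mono fun x => ?_) _
        exact (eLpNorm_ennreal_le_iff hq0 _ _).1 (hu x)
    _ = (ν Set.univ * u) ^ q := by
        rw [lintegral_const, ENNReal.mul_rpow_of_nonneg _ _ hq0.le, mul_comm (u ^ q), ← mul_assoc]
        congr 1
        rcases eq_or_ne (ν Set.univ) 0 with h0 | h0
        · rw [h0, mul_zero, ENNReal.zero_rpow_of_pos hq0]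
        · nth_rewrite 2 [← ENNReal.rpow_one (ν Set.univ)]
          rw [← ENNReal.rpow_add _ _ h0 (measure_ne_top _ _), sub_add_cancel]

/-- `g` is bounded, with bounded Lipschitz derivative `g'`. -/
structure IsSmooth (g g' : ℝ → ℝ) (H : ℝ) : Prop where
  nonneg : 0 ≤ H
  hasDerivAt : ∀ x, HasDerivAt g (g' x) x
  bound : ∀ x, |g x| ≤ H
  bound' : ∀ x, |g' x| ≤ H
  lipschitz' : ∀ x y, |g' x - g' y| ≤ H * |x - y|

namespace IsSmooth

variable {g g' : ℝ → ℝ} {H : ℝ}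

lemma continuous (hg : IsSmooth g g' H) : Continuous g :=
  continuous_iff_continuousAt.2 fun x => (hg.hasDerivAt x).continuousAt

lemma continuous' (hg : IsSmooth g g' H) : Continuous g' := by
  have : LipschitzWith H.toNNReal g' := by
    refine LipschitzWith.of_dist_le_mul fun x y => ?_
    rw [Real.dist_eq, Real.dist_eq, Real.coe_toNNReal _ hg.nonneg]
    exact hg.lipschitz' x y
  exact this.continuous

lemma lipschitz (hg : IsSmooth g g' H) (x y : ℝ) : |g x - g y| ≤ H * |x - y| := by
  have := Convex.norm_image_sub_le_of_norm_hasDerivWithin_le (f := g) (f' := g') (C := H)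
    (s := Set.univ) (x := y) (y := x) (fun z _ => (hg.hasDerivAt z).hasDerivWithinAt)
    (fun z _ => hg.bound' z) convex_univ (Set.mem_univ _) (Set.mem_univ _)
  simpa [Real.norm_eq_abs] using this

lemma hasDerivAt_integral (hg : IsSmooth g g' H) {Z : Ω → ℝ} (hZ : Measurable Z) (x : ℝ) :
    HasDerivAt (fun x => ∫ ω, g (x - Z ω) ∂μ) (∫ ω, g' (x - Z ω) ∂μ) x := by
  refine (hasDerivAt_integral_of_dominated_loc_of_deriv_le (F := fun x ω => g (x - Z ω))
    (F' := fun x ω => g' (x - Z ω)) (bound := fun _ => H) (s := Set.univ) univ_mem ?_ ?_ ?_ ?_ ?_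
    ?_).2
  · exact Eventually.of_forall fun y =>
      (hg.continuous.measurable.comp (measurable_const.sub hZ)).aestronglyMeasurable
  · exact Integrable.of_bound (C := H)
      (hg.continuous.measurable.comp (measurable_const.sub hZ)).aestronglyMeasurable
      (Eventually.of_forall fun ω => hg.bound _)
  · exact (hg.continuous'.measurable.comp (measurable_const.sub hZ)).aestronglyMeasurable
  · exact Eventually.of_forall fun ω y _ => hg.bound' _
  · exact integrable_const _
  · refine Eventually.of_forall fun ω y _ => ?_
    simpa using (hg.hasDerivAt (y - Z ω)).comp_sub_const y (Z ω)

lemma continuous_integral' (hg : IsSmooth g g' H) {Z : Ω → ℝ} (hZ : Measurable Z) :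
    Continuous (fun x => ∫ ω, g' (x - Z ω) ∂μ) := by
  refine continuous_of_dominated (bound := fun _ => H) (fun x => ?_) (fun x => ?_)
    (integrable_const _) ?_
  · exact (hg.continuous'.measurable.comp (measurable_const.sub hZ)).aestronglyMeasurable
  · exact Eventually.of_forall fun ω => hg.bound' _
  · exact Eventually.of_forall fun ω => hg.continuous'.comp (continuous_id.sub continuous_const)

lemma hasDerivAt_smoothSum (hg : IsSmooth g g' H) (hY : ∀ i, Measurable (Y i)) (s n : ℕ) (ω : Ω)
    (x : ℝ) : HasDerivAt (fun x => smoothSum μ Y g s n x ω) (smoothSum μ Y g' s n x ω) x := by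
  unfold smoothSum
  refine HasDerivAt.fun_sum fun j _ => ?_
  exact ((hg.hasDerivAt _).comp_sub_const x _).sub (hg.hasDerivAt_integral (hY 0) x)

lemma continuous_smoothSum' (hg : IsSmooth g g' H) (hY : ∀ i, Measurable (Y i)) (s n : ℕ) (ω : Ω) :
    Continuous (fun x => smoothSum μ Y g' s n x ω) := by
  unfold smoothSum
  exact continuous_finsetSum _ fun j _ =>
    (hg.continuous'.comp (continuous_id.sub continuous_const)).sub (hg.continuous_integral' (hY 0))

lemma measurable_smoothSum (hg : Continuous g) (hY : ∀ i, Measurable (Y i)) (s n : ℕ) (x : ℝ) :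
    Measurable (smoothSum μ Y g s n x) := by
  unfold smoothSum
  exact Finset.measurable_fun_sum _ fun j _ =>
    (hg.measurable.comp (measurable_const.sub (hY _))).sub measurable_const

lemma measurable_uncurry_smoothSum' (hg : IsSmooth g g' H) (hY : ∀ i, Measurable (Y i))
    (s n : ℕ) : Measurable (Function.uncurry fun x ω => smoothSum μ Y g' s n x ω) := by
  unfold smoothSum
  refine Finset.measurable_fun_sum _ fun j _ => Measurable.sub ?_ ?_
  · exact hg.continuous'.measurable.comp (measurable_fst.sub ((hY _).comp measurable_snd))
  · exact (hg.continuous_integral' (hY 0)).measurable.comp measurable_fst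

/-- Centred sums of smooth functions are `o(√n ι_q(n))`, uniformly on compact intervals. -/
lemma ae_smoothSum (hg : IsSmooth g g' H) (hY : ∀ i, Measurable (Y i)) {q : ℝ} (hq : 2 ≤ q)
    (hMB : HasMomentBound μ Y q) {A : ℝ} (hA : 0 < A) :
    ∀ᵐ ω ∂μ, ∀ δ : ℝ, 0 < δ → ∀ᶠ n : ℕ in atTop, ∀ x ∈ Set.Icc (-A) A,
      |smoothSum μ Y g 1 n x ω| ≤ δ * (Real.sqrt n * iota q n) := by
  obtain ⟨K, hK, hKb⟩ := hMB H hg.nonneg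
  have hp1 : 1 ≤ ENNReal.ofReal q := by
    rw [← ENNReal.ofReal_one]; exact ENNReal.ofReal_le_ofReal (by linarith)
  have hshift : ∀ x a b : ℝ, |x - a - (x - b)| = |a - b| := fun x a b => by
    rw [show x - a - (x - b) = -(a - b) by ring, abs_neg]
  have h0 : ∀ s n x, eLpNorm (smoothSum μ Y g s n x) (ENNReal.ofReal q) μ
      ≤ ENNReal.ofReal (K * Real.sqrt n) := fun s n x =>
    hKb (fun y => g (x - y)) (hg.continuous.comp (continuous_const.sub continuous_id))
      (fun y => hg.bound _) (fun a b => by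
        rw [← hshift x a b]; exact hg.lipschitz _ _) s n
  have h1 : ∀ s n x, eLpNorm (smoothSum μ Y g' s n x) (ENNReal.ofReal q) μ
      ≤ ENNReal.ofReal (K * Real.sqrt n) := fun s n x =>
    hKb (fun y => g' (x - y)) (hg.continuous'.comp (continuous_const.sub continuous_id))
      (fun y => hg.bound' _) (fun a b => by
        rw [← hshift x a b]; exact hg.lipschitz' _ _) s n
  set ν : Measure ℝ := volume.restrict (Set.Icc (-A) A) with hν
  have hνu : ν Set.univ = ENNReal.ofReal (2 * A) := by
    rw [hν, Measure.restrict_apply_univ, Real.volume_Icc]; congr 1; ring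
  -- By the fundamental theorem of calculus this dominates the block sum at every `x` in the
  -- interval. Both pieces obey the square root law, since `g` and `g'` are each bounded and
  -- Lipschitz.
  set B : ℕ → ℕ → Ω → ℝ≥0∞ := fun d s ω => ‖smoothSum μ Y g (1 + s) (2 ^ d) 0 ω‖ₑ
    + ∫⁻ x, ‖smoothSum μ Y g' (1 + s) (2 ^ d) x ω‖ₑ ∂ν with hB
  have hm2 : ∀ s n, Measurable (Function.uncurry fun x ω => ‖smoothSum μ Y g' s n x ω‖ₑ) :=
    fun s n => (hg.measurable_uncurry_smoothSum' hY s n).enorm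
  have hm3 : ∀ s n, Measurable fun ω => ∫⁻ x, ‖smoothSum μ Y g' s n x ω‖ₑ ∂ν :=
    fun s n => ((hm2 s n).comp measurable_swap).lintegral_prod_right'
  have hBm : ∀ d s, Measurable (B d s) := fun d s =>
    (measurable_smoothSum hg.continuous hY _ _ _).enorm.add (hm3 _ _)
  have hBn : ∀ d s, eLpNorm (B d s) (ENNReal.ofReal q) μ
      ≤ ENNReal.ofReal (K * (1 + 2 * A) * Real.sqrt (2 ^ d)) := by
    intro d s
    have e1 := h0 (1 + s) (2 ^ d) 0
    have e2 := eLpNorm_lintegral_le (ν := ν) (μ := μ) (q := q) (by linarith) (hm2 (1 + s) (2 ^ d))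
      (u := ENNReal.ofReal (K * Real.sqrt ((2 ^ d : ℕ) : ℝ)))
      (fun x => by rw [eLpNorm_enorm]; exact h1 _ _ x)
    rw [← eLpNorm_enorm] at e1
    refine (eLpNorm_add_le (measurable_smoothSum hg.continuous hY _ _ _).enorm.aestronglyMeasurable
      (hm3 _ _).aestronglyMeasurable hp1).trans ((add_le_add e1 e2).trans (le_of_eq ?_))
    rw [hνu, ← ENNReal.ofReal_mul (by positivity), ← ENNReal.ofReal_add (by positivity)
      (by positivity)]
    congr 1
    push_cast
    ring
  have key := ae_eventually_abs_sub_le hq hq (by positivity) hBm hBn (summable_chainFactor_div hq)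
  filter_upwards [key] with ω hω δ hδ
  filter_upwards [hω δ hδ] with n hn x hx
  have := hn (fun n => smoothSum μ Y g 1 n x ω) ?_
  · simpa [smoothSum] using this
  · intro d s
    have e : smoothSum μ Y g 1 (s + 2 ^ d) x ω - smoothSum μ Y g 1 s x ω
        = smoothSum μ Y g (1 + s) (2 ^ d) x ω := by
      unfold smoothSum
      rw [Finset.sum_range_add]
      simp only [add_assoc]
      ring
    rw [e]
    have hftc := intervalIntegral.integral_eq_sub_of_hasDerivAt (a := 0) (b := x)
      (fun y _ => hg.hasDerivAt_smoothSum (μ := μ) hY (1 + s) (2 ^ d) ω y)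
      ((hg.continuous_smoothSum' hY (1 + s) (2 ^ d) ω).intervalIntegrable _ _)
    have e2 : smoothSum μ Y g (1 + s) (2 ^ d) x ω = smoothSum μ Y g (1 + s) (2 ^ d) 0 ω
        + ∫ y in (0:ℝ)..x, smoothSum μ Y g' (1 + s) (2 ^ d) y ω := by rw [hftc]; ring
    rw [e2]
    refine (enorm_add_le _ _).trans (add_le_add le_rfl ?_)
    have e3 : ‖∫ y in (0:ℝ)..x, smoothSum μ Y g' (1 + s) (2 ^ d) y ω‖ₑ
        = ‖∫ y in Set.uIoc 0 x, smoothSum μ Y g' (1 + s) (2 ^ d) y ω‖ₑ := by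
      rw [← ofReal_norm, ← ofReal_norm, intervalIntegral.norm_intervalIntegral_eq]
    rw [e3]
    refine (enorm_integral_le_lintegral_enorm _).trans (lintegral_mono_set ?_)
    refine Set.uIoc_subset_uIcc.trans (Set.uIcc_subset_Icc ?_ hx)
    constructor <;> linarith

end IsSmooth

end SmoothPart

/-! ### The linear process: past part, moments and marginal law -/

section Setup

variable {Ω : Type*} {m0 : MeasurableSpace Ω} {μ : Measure Ω} [IsProbabilityMeasure μ]
  {a : ℕ → ℝ} {ε X : ℤ → Ω → ℝ}

/-- The predictable part `X_i - ε_i = ∑_{m ≥ 0} a_{m+1} ε_{i-1-m}` of a linear process. -/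
def pastPart (a : ℕ → ℝ) (ε : ℤ → Ω → ℝ) (i : ℤ) (ω : Ω) : ℝ :=
  limUnder atTop fun J : ℕ => ∑ m ∈ Finset.range J, a (m + 1) * ε (i - 1 - m) ω

/-- Defining the past part as a pointwise limit, with a default value where the series diverges,
makes it measurable for the strict past itself; `X_i - ε_i` agrees with it only almost surely. -/
lemma measurable_pastPart (i : ℤ) : Measurable[sigmaOf ε {l | l < i}] (pastPart a ε i) := by
  let _ : MeasurableSpace Ω := sigmaOf ε {l | l < i}
  refine StronglyMeasurable.measurable (StronglyMeasurable.limUnder (l := atTop)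
    (f := fun (J : ℕ) ω => ∑ m ∈ Finset.range J, a (m + 1) * ε (i - 1 - m) ω) fun J => ?_)
  refine Measurable.stronglyMeasurable (Finset.measurable_fun_sum _ fun m _ => ?_)
  exact (measurable_sigmaOf ε (by simp only [Set.mem_ofPred_eq]; omega)).const_mul _

namespace IsLinearProcess

lemma ae_tendsto_sub (h : IsLinearProcess μ a ε X) (k : ℤ) :
    ∀ᵐ ω ∂μ, Tendsto (fun J : ℕ => ∑ m ∈ Finset.range J, a (m + 1) * ε (k - 1 - m) ω)
      atTop (𝓝 (X k ω - ε k ω)) := by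
  filter_upwards [h.series k] with ω hω
  have h1 := ((tendsto_add_atTop_iff_nat 1).2 hω).sub_const (ε k ω)
  refine h1.congr fun N => ?_
  rw [Finset.sum_range_succ', h.coeff_zero]
  simp only [Nat.cast_add, Nat.cast_one, Nat.cast_zero, sub_zero, one_mul, add_sub_cancel_right]
  refine Finset.sum_congr rfl fun m _ => ?_
  rw [show k - ((m:ℤ) + 1) = k - 1 - m by ring]

lemma ae_pastPart_eq (h : IsLinearProcess μ a ε X) (k : ℤ) :
    ∀ᵐ ω ∂μ, pastPart a ε k ω = X k ω - ε k ω := by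
  filter_upwards [h.ae_tendsto_sub k] with ω hω using hω.limUnder_eq

lemma ae_tendsto_pastPart (h : IsLinearProcess μ a ε X) (k : ℤ) :
    ∀ᵐ ω ∂μ, Tendsto (fun J : ℕ => ∑ m ∈ Finset.range J, a (m + 1) * ε (k - 1 - m) ω)
      atTop (𝓝 (pastPart a ε k ω)) := by
  filter_upwards [h.ae_tendsto_sub k, h.ae_pastPart_eq k] with ω h1 h2
  rwa [h2]

/-- Each past part is the same measurable functional of a sequence of i.i.d. innovations read
backwards in time. -/
lemma identDistrib_pastPart (h : IsLinearProcess μ a ε X) (i : ℤ) :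
    IdentDistrib (pastPart a ε i) (pastPart a ε 0) μ μ := by
  set L : (ℕ → ℝ) → ℝ := fun z =>
    limUnder atTop fun J : ℕ => ∑ m ∈ Finset.range J, a (m + 1) * z m with hL
  have hLm : Measurable L := by
    refine StronglyMeasurable.measurable (StronglyMeasurable.limUnder (l := atTop)
      (f := fun (J : ℕ) (z : ℕ → ℝ) => ∑ m ∈ Finset.range J, a (m + 1) * z m) fun J => ?_)
    exact Measurable.stronglyMeasurable (Finset.measurable_fun_sum _ fun m _ =>
      (measurable_pi_apply m).const_mul _)
  have hinj : ∀ k : ℤ, Function.Injective fun m : ℕ => k - 1 - (m : ℤ) := fun k x y hxy => by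
    simp only at hxy; omega
  have hpi : IdentDistrib (fun ω (m : ℕ) => ε (i - 1 - m) ω) (fun ω (m : ℕ) => ε (0 - 1 - m) ω)
      μ μ :=
    IdentDistrib.pi (X := fun (m : ℕ) ω => ε (i - 1 - m) ω)
      (Y := fun (m : ℕ) ω => ε (0 - 1 - m) ω)
      (fun m => (h.ident _).trans (h.ident _).symm) (h.indep.precomp (hinj i))
      (h.indep.precomp (hinj 0))
  exact hpi.comp hLm

/-- The `L^q` square root law for bounded Lipschitz functionals of the past of a short-range
dependent linear process. -/
lemma hasMomentBound (h : IsLinearProcess μ a ε X) {α q : ℝ} (hα : 0 < α) (hq : 2 ≤ q)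
    (hmoment : Integrable (fun ω => |ε 0 ω| ^ α) μ)
    (hcoeff : Summable (fun i : ℕ => |a (i + 1)| ^ min (α / q) 1)) :
    HasMomentBound μ (pastPart a ε) q := by
  intro H hH
  set γ := min (α / q) 1 with hγ
  have hq0 : 0 < q := by linarith
  have hγ0 : 0 < γ := lt_min (by positivity) one_pos
  have hγ1 : γ ≤ 1 := min_le_right _ _
  -- The reason for the exponent `min(α/q, 1)`: the assumed moment of `ε` puts `|ε|^γ` in `L^q`.
  have hγα : γ * q ≤ α := by
    calc γ * q ≤ α / q * q := mul_le_mul_of_nonneg_right (min_le_left _ _) hq0.le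
      _ = α := div_mul_cancel₀ _ hq0.ne'
  have hfin : eLpNorm (fun ω => |ε 0 ω| ^ γ) (ENNReal.ofReal q) μ < ∞ := by
    rw [eLpNorm_lt_top_iff_lintegral_rpow_enorm_lt_top (by simpa using hq0) ENNReal.ofReal_ne_top,
      ENNReal.toReal_ofReal hq0.le]
    have hi : Integrable (fun ω => 1 + |ε 0 ω| ^ α) μ := (integrable_const 1).add hmoment
    refine lt_of_le_of_lt (lintegral_mono fun ω => ?_) hi.lintegral_lt_top
    have h0 := Real.rpow_nonneg (abs_nonneg (ε 0 ω)) γ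
    rw [Real.enorm_of_nonneg h0, ENNReal.ofReal_rpow_of_nonneg h0 hq0.le, ← Real.rpow_mul
      (abs_nonneg _)]
    apply ENNReal.ofReal_le_ofReal
    rcases le_total |ε 0 ω| 1 with h1 | h1
    · have := Real.rpow_le_one (abs_nonneg _) h1 (by positivity : 0 ≤ γ * q)
      have := Real.rpow_nonneg (abs_nonneg (ε 0 ω)) α
      linarith
    · have := Real.rpow_le_rpow_of_exponent_le h1 hγα
      linarith
  set A := (eLpNorm (fun ω => |ε 0 ω| ^ γ) (ENNReal.ofReal q) μ).toReal with hA
  have hεA : ∀ k, eLpNorm (fun ω => |ε k ω| ^ γ) (ENNReal.ofReal q) μ ≤ ENNReal.ofReal A := by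
    intro k
    have hm : Measurable fun x : ℝ => |x| ^ γ := (measurable_norm (α := ℝ)).pow_const γ
    have : eLpNorm (fun ω => |ε k ω| ^ γ) (ENNReal.ofReal q) μ
        = eLpNorm (fun ω => |ε 0 ω| ^ γ) (ENNReal.ofReal q) μ :=
      ((h.ident k).comp hm).eLpNorm_eq _
    rw [this, hA, ENNReal.ofReal_toReal hfin.ne]
  refine ⟨momentConst q (2 * H * A) (∑' m, |a (m + 1)| ^ γ), Real.sqrt_nonneg _,
    fun g hgc hgH hgL s n => ?_⟩
  -- Use the Lipschitz bound when `|x - y| ≤ 1` and boundedness otherwise.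
  have hholder : ∀ x y, |g x - g y| ≤ 2 * H * |x - y| ^ γ := by
    intro x y
    rcases le_total |x - y| 1 with h1 | h1
    · have h2 : |x - y| ≤ |x - y| ^ γ := by
        have := Real.rpow_le_rpow_of_exponent_ge' (abs_nonneg (x - y)) h1 hγ0.le hγ1
        rwa [Real.rpow_one] at this
      have h3 := hgL x y
      have h4 := mul_le_mul_of_nonneg_left h2 hH
      have h5 : 0 ≤ H * |x - y| ^ γ := by positivity
      linarith
    · have h2 : 1 ≤ |x - y| ^ γ := Real.one_le_rpow h1 hγ0.le
      have h3 := abs_sub (g x) (g y)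
      have h4 := mul_le_mul_of_nonneg_left h2 hH
      linarith [hgH x, hgH y]
  have key := eLpNorm_sum_comp_linear_le hq (by positivity : 0 ≤ 2 * H) ENNReal.toReal_nonneg
    h.measurable h.indep hεA hcoeff h.ae_tendsto_pastPart hgc
    (fun x => (hgH x).trans (by linarith)) hholder s n
  have hint : ∀ i, ∫ ω, g (pastPart a ε i ω) ∂μ = ∫ ω, g (pastPart a ε 0 ω) ∂μ := fun i =>
    ((h.identDistrib_pastPart i).comp hgc.measurable).integral_eq
  have hpm : ∀ i, Measurable (pastPart a ε i) := fun i =>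
    (measurable_pastPart i).mono (sigmaOf_le h.measurable _) le_rfl
  refine le_trans (le_of_eq ?_) key
  congr 1
  ext ω
  have hi : ∀ i, Integrable (fun ω => g (pastPart a ε i ω)) μ := fun i =>
    Integrable.of_bound (C := H) (hgc.measurable.comp (hpm _)).aestronglyMeasurable
      (Eventually.of_forall fun ω => hgH _)
  rw [integral_finsetSum _ fun j _ => hi _]
  rw [Finset.sum_sub_distrib]
  simp only [hint]

end IsLinearProcess

/-- The distribution function of the innovations. -/
def innovCDF (μ : Measure Ω) (ε : ℤ → Ω → ℝ) (x : ℝ) : ℝ := (μ.map (ε 0)).real (Set.Iic x)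

lemma hasDerivAt_innovCDF (hε : Measurable (ε 0)) {g : ℝ → ℝ} (hg : IsDensity μ (ε 0) g)
    (hc : Continuous g) (x : ℝ) : HasDerivAt (innovCDF μ ε) (g x) x := by
  obtain ⟨-, hg0, hmap⟩ := hg
  have hP : IsProbabilityMeasure (μ.map (ε 0)) := Measure.isProbabilityMeasure_map hε.aemeasurable
  have hdiff : ∀ u v : ℝ, u ≤ v → innovCDF μ ε v - innovCDF μ ε u = ∫ y in u..v, g y := by
    intro u v huv
    rw [innovCDF, innovCDF, ← measureReal_sdiff (Set.Iic_subset_Iic.2 huv) measurableSet_Iic,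
      Set.Iic_sdiff_Iic, intervalIntegral.integral_of_le huv, measureReal_def, hmap,
      withDensity_apply _ measurableSet_Ioc,
      integral_eq_lintegral_of_nonneg_ae (Eventually.of_forall hg0)
        hc.aestronglyMeasurable]
  have heq : ∀ y, innovCDF μ ε y = innovCDF μ ε 0 + ∫ z in (0:ℝ)..y, g z := by
    intro y
    rcases le_total 0 y with h | h
    · rw [← hdiff 0 y h]; ring
    · rw [intervalIntegral.integral_symm, ← hdiff y 0 h]; ring
  have h1 : HasDerivAt (fun y => innovCDF μ ε 0 + ∫ z in (0:ℝ)..y, g z) (g x) x :=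
    (intervalIntegral.integral_hasDerivAt_right (hc.intervalIntegrable _ _)
      (hc.stronglyMeasurableAtFilter _ _) hc.continuousAt).const_add _
  exact h1.congr_of_eventuallyEq (Eventually.of_forall heq)

/-- Two levels of smoothness are needed: that of the distribution function bounds the smooth part,
and that of the density bounds its derivative, hence its oscillation. -/
lemma exists_isSmooth (hε : Measurable (ε 0)) {g : ℝ → ℝ} (hg : IsDensity μ (ε 0) g)
    (hdiff : Differentiable ℝ g) (hbound : ∃ C : ℝ, ∀ x, g x + |deriv g x| ≤ C)
    (hdiff' : Differentiable ℝ (deriv g)) (hbound' : ∃ C : ℝ, ∀ x, |deriv (deriv g) x| ≤ C) :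
    ∃ H : ℝ, IsSmooth (innovCDF μ ε) g H ∧ IsSmooth g (deriv g) H := by
  obtain ⟨C, hC⟩ := hbound
  obtain ⟨C', hC'⟩ := hbound'
  have hP : IsProbabilityMeasure (μ.map (ε 0)) := Measure.isProbabilityMeasure_map hε.aemeasurable
  have lip : ∀ (f : ℝ → ℝ) (K : ℝ), Differentiable ℝ f → (∀ x, |deriv f x| ≤ K) →
      ∀ x y, |f x - f y| ≤ K * |x - y| := by
    intro f K hf hK x y
    have := Convex.norm_image_sub_le_of_norm_deriv_le (f := f) (C := K) (s := Set.univ)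
      (x := y) (y := x) (fun z _ => hf z) (fun z _ => hK z) convex_univ (Set.mem_univ _)
      (Set.mem_univ _)
    simpa [Real.norm_eq_abs] using this
  set H := max 1 (max C C') with hH
  have h1 : 1 ≤ H := le_max_left _ _
  have hCH : C ≤ H := (le_max_left _ _).trans (le_max_right _ _)
  have hCH' : C' ≤ H := (le_max_right _ _).trans (le_max_right _ _)
  have hgH : ∀ x, |g x| ≤ H := fun x => by
    rw [abs_of_nonneg (hg.2.1 x)]
    linarith [hC x, abs_nonneg (deriv g x)]
  have hgH' : ∀ x, |deriv g x| ≤ H := fun x => by linarith [hC x, hg.2.1 x]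
  refine ⟨H, ⟨by linarith, hasDerivAt_innovCDF hε hg hdiff.continuous, fun x => ?_, hgH,
    lip g H hdiff hgH'⟩, ⟨by linarith, fun x => (hdiff x).hasDerivAt, hgH, hgH',
    lip _ H hdiff' fun x => (hC' x).trans hCH'⟩⟩
  rw [innovCDF, abs_of_nonneg measureReal_nonneg]
  exact measureReal_le_one.trans h1

namespace IsLinearProcess

lemma isInnovationModel (h : IsLinearProcess μ a ε X) {g : ℝ → ℝ} {H : ℝ}
    (hs : IsSmooth (innovCDF μ ε) g H) :
    IsInnovationModel μ ε (pastPart a ε) (innovCDF μ ε) H where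
  measurable := h.measurable
  indep := h.indep
  ident := h.ident
  past := measurable_pastPart
  cdf _ := rfl
  lipschitz x y hxy := by
    have := (le_abs_self _).trans (hs.lipschitz y x)
    rwa [abs_of_nonneg (by linarith : 0 ≤ y - x)] at this
  nonneg := hs.nonneg

lemma measurable_pastPart' (h : IsLinearProcess μ a ε X) (i : ℤ) : Measurable (pastPart a ε i) :=
  (measurable_pastPart i).mono (sigmaOf_le h.measurable _) le_rfl

lemma ae_eq_add (h : IsLinearProcess μ a ε X) :
    ∀ᵐ ω ∂μ, ∀ k, X k ω = pastPart a ε k ω + ε k ω := by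
  rw [ae_all_iff]
  intro k
  filter_upwards [h.ae_pastPart_eq k] with ω hω
  rw [hω]; ring

/-- `X` is not assumed measurable, so its law is taken through the measurable version `Y_0 + ε_0`;
monotonicity and the limits at `±∞` then come from `cdf`. -/
lemma margCDF_eq_cdf (h : IsLinearProcess μ a ε X) (x : ℝ) :
    margCDF μ X x = cdf (μ.map fun ω => pastPart a ε 0 ω + ε 0 ω) x := by
  have hm : Measurable fun ω => pastPart a ε 0 ω + ε 0 ω :=
    (h.measurable_pastPart' 0).add (h.measurable 0)
  have : IsProbabilityMeasure (μ.map fun ω => pastPart a ε 0 ω + ε 0 ω) :=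
    Measure.isProbabilityMeasure_map hm.aemeasurable
  rw [cdf_eq_real, map_measureReal_apply hm measurableSet_Iic, margCDF]
  refine measureReal_congr ?_
  filter_upwards [h.ae_eq_add] with ω hω
  refine propext ?_
  change X 0 ω ≤ x ↔ pastPart a ε 0 ω + ε 0 ω ≤ x
  rw [hω 0]

/-- The innovation is independent of the past part, so Tonelli applies to their joint law. The
marginal distribution function thereby inherits the smoothness of the innovation distribution
function. -/
lemma margCDF_eq_integral (h : IsLinearProcess μ a ε X) (x : ℝ) :
    margCDF μ X x = ∫ ω, innovCDF μ ε (x - pastPart a ε 0 ω) ∂μ := by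
  have hY := h.measurable_pastPart' 0
  have hP : IsProbabilityMeasure (μ.map (ε 0)) :=
    Measure.isProbabilityMeasure_map (h.measurable 0).aemeasurable
  have hmono : Monotone (innovCDF μ ε) := fun u v huv =>
    measureReal_mono (Set.Iic_subset_Iic.2 huv)
  have hind : IndepFun (pastPart a ε 0) (ε 0) μ := by
    have h1 : Indep (sigmaOf ε {l | l < 0}) (sigmaOf ε {0}) μ :=
      indep_sigmaOf h.measurable h.indep (by simp)
    rw [IndepFun_iff_Indep]
    refine indep_of_indep_of_le_right (indep_of_indep_of_le_left h1 ?_) ?_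
    · exact (measurable_pastPart 0).comap_le
    · exact (measurable_sigmaOf ε (Set.mem_singleton 0)).comap_le
  have hmap := (indepFun_iff_map_prod_eq_prod_map_map hY.aemeasurable
    (h.measurable 0).aemeasurable).1 hind
  set s : Set (ℝ × ℝ) := {p | p.1 + p.2 ≤ x} with hs
  have hsm : MeasurableSet s := measurableSet_le (measurable_fst.add measurable_snd) measurable_const
  have hμs : μ {ω | X 0 ω ≤ x} = ∫⁻ ω, (μ.map (ε 0)) (Set.Iic (x - pastPart a ε 0 ω)) ∂μ := by
    have e1 : μ {ω | X 0 ω ≤ x} = μ ((fun ω => (pastPart a ε 0 ω, ε 0 ω)) ⁻¹' s) := by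
      refine measure_congr ?_
      filter_upwards [h.ae_eq_add] with ω hω
      refine propext ?_
      change X 0 ω ≤ x ↔ pastPart a ε 0 ω + ε 0 ω ≤ x
      rw [hω 0]
    have hm : Measurable fun u => (μ.map (ε 0)) (Prod.mk u ⁻¹' s) := measurable_measure_prodMk_left hsm
    rw [e1, ← Measure.map_apply (hY.prodMk (h.measurable 0)) hsm, hmap, Measure.prod_apply hsm,
      lintegral_map hm hY]
    refine lintegral_congr fun ω => ?_
    congr 1
    ext e
    simp only [hs, Set.mem_preimage, Set.mem_ofPred_eq, Set.mem_Iic]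
    constructor <;> intro h <;> linarith
  have hms : AEStronglyMeasurable (fun ω => innovCDF μ ε (x - pastPart a ε 0 ω)) μ :=
    (hmono.measurable.comp (measurable_const.sub hY)).aestronglyMeasurable
  have hnn : 0 ≤ᵐ[μ] fun ω => innovCDF μ ε (x - pastPart a ε 0 ω) :=
    Eventually.of_forall fun ω => measureReal_nonneg
  rw [margCDF, measureReal_def, hμs, integral_eq_lintegral_of_nonneg_ae hnn hms]
  congr 1
  refine lintegral_congr fun ω => ?_
  rw [innovCDF, ofReal_measureReal]

lemma hasDerivAt_margCDF (h : IsLinearProcess μ a ε X) {g : ℝ → ℝ} {H : ℝ}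
    (hs : IsSmooth (innovCDF μ ε) g H) (x : ℝ) :
    HasDerivAt (margCDF μ X) (∫ ω, g (x - pastPart a ε 0 ω) ∂μ) x := by
  have : margCDF μ X = fun x => ∫ ω, innovCDF μ ε (x - pastPart a ε 0 ω) ∂μ :=
    funext h.margCDF_eq_integral
  rw [this]
  exact hs.hasDerivAt_integral (h.measurable_pastPart' 0) x

/-- The mean value inequality for `F` minus its tangent slope, whose derivative on the segment is at
most `H |y - x|` because the marginal density is `H`-Lipschitz. -/
lemma abs_margCDF_sub_le (h : IsLinearProcess μ a ε X) {g : ℝ → ℝ} {H : ℝ}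
    (hs : IsSmooth (innovCDF μ ε) g H) (x y : ℝ) :
    |margCDF μ X y - margCDF μ X x - margDensity μ X x * (y - x)| ≤ H * (y - x) ^ 2 := by
  set f : ℝ → ℝ := fun x => ∫ ω, g (x - pastPart a ε 0 ω) ∂μ with hf
  have hd : margDensity μ X x = f x := (h.hasDerivAt_margCDF hs x).deriv
  have hY := h.measurable_pastPart' 0
  have hgi : ∀ z, Integrable (fun ω => g (z - pastPart a ε 0 ω)) μ := fun z =>
    Integrable.of_bound (C := H)
      (hs.continuous'.measurable.comp (measurable_const.sub hY)).aestronglyMeasurable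
      (Eventually.of_forall fun ω => hs.bound' _)
  have hlip : ∀ u v, |f u - f v| ≤ H * |u - v| := by
    intro u v
    simp only [hf]
    rw [← integral_sub (hgi u) (hgi v)]
    have := norm_integral_le_of_norm_le_const (μ := μ)
      (f := fun ω => g (u - pastPart a ε 0 ω) - g (v - pastPart a ε 0 ω)) (C := H * |u - v|)
      (Eventually.of_forall fun ω => by
        have := hs.lipschitz' (u - pastPart a ε 0 ω) (v - pastPart a ε 0 ω)
        rwa [sub_sub_sub_cancel_right] at this)
    simpa using this
  rw [hd]
  have hder : ∀ z, HasDerivAt (fun z => margCDF μ X z - f x * z) (f z - f x) z := fun z => by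
    have h1 := (h.hasDerivAt_margCDF hs z).sub ((hasDerivAt_id z).const_mul (f x))
    rw [mul_one] at h1
    exact h1
  have := Convex.norm_image_sub_le_of_norm_hasDerivWithin_le
    (f := fun z => margCDF μ X z - f x * z) (f' := fun z => f z - f x) (C := H * |y - x|)
    (s := Set.uIcc x y) (x := x) (y := y) (fun z _ => (hder z).hasDerivWithinAt)
    (fun z hz => (hlip z x).trans (mul_le_mul_of_nonneg_left
      (Set.abs_sub_left_of_mem_uIcc hz) hs.nonneg)) (convex_uIcc x y)
    Set.left_mem_uIcc Set.right_mem_uIcc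
  rw [Real.norm_eq_abs, Real.norm_eq_abs] at this
  refine le_trans (le_of_eq ?_) (this.trans (le_of_eq ?_))
  · congr 1; ring
  · rw [mul_assoc, abs_mul_abs_self, sq]

lemma empCDF_sub_margCDF (h : IsLinearProcess μ a ε X) {ω : Ω}
    (hω : ∀ k, X k ω = pastPart a ε k ω + ε k ω) {n : ℕ} (hn : 0 < n) (x : ℝ) :
    empCDF X n ω x - margCDF μ X x
      = (1 / (n:ℝ)) * (cdfInnovationSum (innovCDF μ ε) ε (pastPart a ε) 1 n x ω
        + smoothSum μ (pastPart a ε) (innovCDF μ ε) 1 n x ω) := by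
  have hn' : (n:ℝ) ≠ 0 := by exact_mod_cast hn.ne'
  have e1 : ∑ i ∈ Finset.Icc 1 n, Set.indicator {y : ℝ | y ≤ x} (1 : ℝ → ℝ) (X (i : ℤ) ω)
      = ∑ j ∈ Finset.range n, Set.indicator {y : ℝ | y ≤ x} 1
        (pastPart a ε ((1 + j : ℕ) : ℤ) ω + ε ((1 + j : ℕ) : ℤ) ω) := by
    rw [← Finset.Ico_add_one_right_eq_Icc, Finset.sum_Ico_eq_sum_range, Nat.add_sub_cancel]
    exact Finset.sum_congr rfl fun j _ => by rw [hω]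
  have e2 : cdfInnovationSum (innovCDF μ ε) ε (pastPart a ε) 1 n x ω
        + smoothSum μ (pastPart a ε) (innovCDF μ ε) 1 n x ω
      = ∑ j ∈ Finset.range n, Set.indicator {y : ℝ | y ≤ x} 1
        (pastPart a ε ((1 + j : ℕ) : ℤ) ω + ε ((1 + j : ℕ) : ℤ) ω) - n * margCDF μ X x := by
    unfold cdfInnovationSum smoothSum cdfInnovation
    rw [← Finset.sum_add_distrib, ← h.margCDF_eq_integral]
    have : (n:ℝ) * margCDF μ X x = ∑ j ∈ Finset.range n, margCDF μ X x := by simp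
    rw [this, ← Finset.sum_sub_distrib]
    exact Finset.sum_congr rfl fun j _ => by ring
  rw [empCDF, e1, e2]
  field_simp

end IsLinearProcess

end Setup

/-! ### Deterministic quantile estimates -/

section Quantile

variable {F f G : ℝ → ℝ} {L c A p ξ δ D R b : ℝ}

/-- The two inequalities also show that the superlevel set is bounded below and nonempty, so the
infimum is a genuine one. -/
lemma abs_quantile_sub_le (hG : Monotone G) (h1 : G (ξ - δ) < p) (h2 : p ≤ G (ξ + δ)) :
    |quantile G p - ξ| ≤ δ := by
  have hlb : ∀ x ∈ {x | p ≤ G x}, ξ - δ ≤ x := fun x hx => by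
    by_contra! hlt
    exact absurd ((le_trans hx (hG hlt.le)).trans_lt h1) (lt_irrefl _)
  have hmem : ξ + δ ∈ {x | p ≤ G x} := h2
  have h3 : quantile G p ≤ ξ + δ := csInf_le ⟨_, hlb⟩ hmem
  have h4 : ξ - δ ≤ quantile G p := le_csInf ⟨_, hmem⟩ hlb
  rw [abs_le]
  constructor <;> linarith

lemma apply_lt_of_lt_quantile (hG : Monotone G) {u y : ℝ} (h1 : G u < p)
    (hy : y < quantile G p) : G y < p := by
  have hlb : ∀ x ∈ {x | p ≤ G x}, u ≤ x := fun x hx => by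
    by_contra! hlt
    exact absurd ((le_trans hx (hG hlt.le)).trans_lt h1) (lt_irrefl _)
  by_contra! hle
  exact absurd (csInf_le ⟨u, hlb⟩ (show y ∈ {x | p ≤ G x} from hle)) (not_le.2 hy)

lemma le_apply_of_quantile_lt (hG : Monotone G) {v y : ℝ} (h2 : p ≤ G v)
    (hy : quantile G p < y) : p ≤ G y := by
  obtain ⟨z, hz, hzy⟩ := exists_lt_of_csInf_lt (s := {x | p ≤ G x}) ⟨v, h2⟩ hy
  exact le_trans hz (hG hzy.le)

lemma apply_quantile (hF : Monotone F) (hFc : Continuous F) {u v : ℝ} (h1 : F u < p)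
    (h2 : p ≤ F v) : F (quantile F p) = p := by
  apply le_antisymm
  · refine le_of_tendsto (hFc.continuousAt.tendsto.mono_left nhdsWithin_le_nhds :
      Tendsto F (𝓝[<] (quantile F p)) _) ?_
    filter_upwards [self_mem_nhdsWithin] with y hy
    exact (apply_lt_of_lt_quantile hF h1 hy).le
  · refine ge_of_tendsto (hFc.continuousAt.tendsto.mono_left nhdsWithin_le_nhds :
      Tendsto F (𝓝[>] (quantile F p)) _) ?_
    filter_upwards [self_mem_nhdsWithin] with y hy
    exact le_apply_of_quantile_lt hF h2 hy

/-- If `G` is uniformly close to a distribution function `F` with derivative bounded below at its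
`p`-th quantile `ξ`, then `G` crosses the level `p` near `ξ`. -/
lemma lt_and_le_of_uniform_close (hT : ∀ x y, |F y - F x - f x * (y - x)| ≤ L * (y - x) ^ 2)
    (hFξ : F ξ = p) (hfξ : c ≤ f ξ) (hξA : |ξ| ≤ A - 1) (hδ : 0 < δ) (hδ1 : δ ≤ 1)
    (hLδ : L * δ ≤ c / 2) (hD : D < c * δ / 2)
    (hGF : ∀ x ∈ Set.Icc (-A) A, |G x - F x| ≤ D) : G (ξ - δ) < p ∧ p ≤ G (ξ + δ) := by
  obtain ⟨hξ1, hξ2⟩ := abs_le.1 hξA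
  have h1 := abs_le.1 (hT ξ (ξ + δ))
  have h2 := abs_le.1 (hT ξ (ξ - δ))
  have h3 := abs_le.1 (hGF (ξ + δ) ⟨by linarith, by linarith⟩)
  have h4 := abs_le.1 (hGF (ξ - δ) ⟨by linarith, by linarith⟩)
  have h5 : c * δ ≤ f ξ * δ := mul_le_mul_of_nonneg_right hfξ hδ.le
  have h6 : L * δ * δ ≤ c / 2 * δ := mul_le_mul_of_nonneg_right hLδ hδ.le
  rw [hFξ] at h1 h2
  ring_nf at h1 h2 h3 h4 h5 h6 hD ⊢
  constructor <;> linarith [h1.1, h2.2, h3.1, h4.2]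

/-- A deterministic Bahadur representation. -/
lemma abs_quantile_sub_sub_le (hFc : Continuous F)
    (hT : ∀ x y, |F y - F x - f x * (y - x)| ≤ L * (y - x) ^ 2) (hL : 0 ≤ L) (hc : 0 < c)
    (hFξ : F ξ = p) (hfξ : c ≤ f ξ) (hξA : |ξ| ≤ A - 1) (hδ1 : δ < 1) (hδb : δ < b)
    (hG : Monotone G) (h1 : G (ξ - δ) < p) (h2 : p ≤ G (ξ + δ))
    (hosc : ∀ x ∈ Set.Icc (-A) A, ∀ y ∈ Set.Icc (-A) A, |x - y| ≤ b →
      |G x - G y - (F x - F y)| ≤ R) :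
    |quantile G p - ξ - (p - G ξ) / f ξ| ≤ (R + L * δ ^ 2) / c := by
  obtain ⟨hξ1, hξ2⟩ := abs_le.1 hξA
  set z := quantile G p with hz
  have hzξ : |z - ξ| ≤ δ := abs_quantile_sub_le hG h1 h2
  have hξmem : ξ ∈ Set.Icc (-A) A := ⟨by linarith, by linarith⟩
  -- `G` may jump at `z`, so `G z = p` is unavailable. The strict bounds `δ < 1` and `δ < b` leave
  -- room for points on both sides of `z`, where `G y < p` or `p ≤ G y` holds; continuity of `F`
  -- then carries the two estimates to `z`.
  have hnear : ∀ᶠ y in 𝓝 z, |G y - G ξ - (F y - p)| ≤ R := by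
    have hd : ∀ᶠ y in 𝓝 z, |y - ξ| < min 1 b :=
      ((continuous_id.sub continuous_const).abs.continuousAt.tendsto).eventually_lt_const
        (hzξ.trans_lt (lt_min hδ1 hδb))
    filter_upwards [hd] with y hy
    have hy1 := abs_lt.1 (hy.trans_le (min_le_left _ _))
    rw [← hFξ]
    exact hosc y ⟨by linarith [hy1.1], by linarith [hy1.2]⟩ ξ hξmem
      (hy.le.trans (min_le_right _ _))
  have hu : F z ≤ 2 * p - G ξ + R := by
    refine le_of_tendsto (hFc.continuousAt.tendsto.mono_left nhdsWithin_le_nhds :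
      Tendsto F (𝓝[<] z) _) ?_
    filter_upwards [self_mem_nhdsWithin, nhdsWithin_le_nhds hnear] with y hy hy'
    have := apply_lt_of_lt_quantile hG h1 hy
    linarith [(abs_le.1 hy').1]
  have hl : 2 * p - G ξ - R ≤ F z := by
    refine ge_of_tendsto (hFc.continuousAt.tendsto.mono_left nhdsWithin_le_nhds :
      Tendsto F (𝓝[>] z) _) ?_
    filter_upwards [self_mem_nhdsWithin, nhdsWithin_le_nhds hnear] with y hy hy'
    have := le_apply_of_quantile_lt hG h2 hy
    linarith [(abs_le.1 hy').2]
  have hTz := hT ξ z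
  rw [hFξ] at hTz
  have hsq : L * (z - ξ) ^ 2 ≤ L * δ ^ 2 := by
    refine mul_le_mul_of_nonneg_left ?_ hL
    rw [← sq_abs]
    exact pow_le_pow_left₀ (abs_nonneg _) hzξ 2
  have hnum : |f ξ * (z - ξ) - (p - G ξ)| ≤ R + L * δ ^ 2 := by
    have := abs_le.1 (hTz.trans hsq)
    rw [abs_le]
    constructor <;> linarith [this.1, this.2]
  have hf0 : 0 < f ξ := hc.trans_le hfξ
  have heq : z - ξ - (p - G ξ) / f ξ = (f ξ * (z - ξ) - (p - G ξ)) / f ξ := by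
    field_simp
  rw [heq, abs_div, abs_of_pos hf0]
  exact div_le_div₀ ((abs_nonneg _).trans hnum) hnum hc hfξ

/-- Rates for the quantile process from rates for the empirical process and its oscillation. -/
lemma eventually_quantile_rates {K : ℝ} (hFc : Continuous F)
    (hT : ∀ x y, |F y - F x - f x * (y - x)| ≤ L * (y - x) ^ 2) (hL : 0 ≤ L) (hc : 0 < c)
    {Q : ℝ → ℝ} {P : Set ℝ} (hQ : ∀ p ∈ P, F (Q p) = p ∧ |Q p| ≤ A - 1 ∧ c ≤ f (Q p))
    {G : ℕ → ℝ → ℝ} (hG : ∀ n, Monotone (G n)) {b r : ℕ → ℝ} (hb0 : ∀ᶠ n in atTop, 0 < b n)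
    (hb : Tendsto b atTop (𝓝 0)) (hbr : ∀ᶠ n in atTop, b n ^ 2 ≤ r n)
    (hGF : ∀ κ, 0 < κ → ∀ᶠ n in atTop, ∀ x ∈ Set.Icc (-A) A, |G n x - F x| ≤ κ * b n)
    (hosc : ∀ᶠ n in atTop, ∀ x ∈ Set.Icc (-A) A, ∀ y ∈ Set.Icc (-A) A, |x - y| ≤ b n →
      |G n x - G n y - (F x - F y)| ≤ K * r n) :
    (∀ η, 0 < η → ∀ᶠ n in atTop, ∀ p ∈ P, |quantile (G n) p - Q p| ≤ η * b n) ∧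
    ∀ᶠ n in atTop, ∀ p ∈ P, |quantile (G n) p - Q p - (p - G n (Q p)) / f (Q p)|
      ≤ (K + L) / c * r n := by
  have hcross : ∀ η, 0 < η → ∀ᶠ n in atTop, ∀ p ∈ P,
      G n (Q p - η * b n) < p ∧ p ≤ G n (Q p + η * b n) := by
    intro η hη
    have hηb : Tendsto (fun n => η * b n) atTop (𝓝 0) := by simpa using hb.const_mul η
    have hLb : Tendsto (fun n => L * (η * b n)) atTop (𝓝 0) := by simpa using hηb.const_mul L
    filter_upwards [hb0, hηb.eventually_lt_const one_pos, hLb.eventually_lt_const (half_pos hc),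
      -- The crossing criterion requires the uniform distance to be strictly below `c (η b) / 2`;
      -- half of that is taken.
      hGF (c * η / 4) (by positivity)] with n h0 h1 h2 h3 p hp
    obtain ⟨e1, e2, e3⟩ := hQ p hp
    refine lt_and_le_of_uniform_close hT e1 e3 e2 (mul_pos hη h0) h1.le h2.le ?_ h3
    have : 0 < c * (η * b n) := by positivity
    linarith
  refine ⟨fun η hη => ?_, ?_⟩
  · filter_upwards [hcross η hη] with n hn p hp
    exact abs_quantile_sub_le (hG n) (hn p hp).1 (hn p hp).2
  · filter_upwards [hcross (1 / 2) (by norm_num), hb0, hb.eventually_lt_const one_pos, hbr, hosc]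
      with n h1 h2 h3 h4 h5 p hp
    obtain ⟨e1, e2, e3⟩ := hQ p hp
    refine (abs_quantile_sub_sub_le hFc hT hL hc e1 e3 e2 (by linarith) (by linarith) (hG n)
      (h1 p hp).1 (h1 p hp).2 h5).trans ?_
    rw [div_mul_eq_mul_div (K + L)]
    refine div_le_div_of_nonneg_right ?_ hc.le
    have h6 : L * (1 / 2 * b n) ^ 2 ≤ L * r n :=
      mul_le_mul_of_nonneg_left (by nlinarith [sq_nonneg (b n)]) hL
    linarith

end Quantile

/-! ### Comparison of the rates -/

section Rates

variable {q : ℝ}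

/-- `ι_q(n) ≤ (log n)³` eventually, and any power of the logarithm is negligible. The exponent `1/8`
is chosen so that `ι_q(n)²/n ≤ n^{-3/4}`, which makes the quadratic error fit into the Bahadur rate.
-/
lemma eventually_iota_le_rpow (hq : 2 ≤ q) :
    ∀ᶠ n : ℕ in atTop, iota q n ≤ (n:ℝ) ^ (1 / 8 : ℝ) := by
  have hlog : ∀ᶠ n : ℕ in atTop, Real.log n ^ 24 ≤ n := by
    have := (Real.isLittleO_pow_log_id_atTop (n := 24)).bound one_pos
    filter_upwards [tendsto_natCast_atTop_atTop.eventually this] with n hn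
    simpa [abs_of_nonneg, pow_abs] using (le_abs_self _).trans hn
  filter_upwards [hlog, tendsto_log_nat.eventually_ge_atTop 1,
    tendsto_log_log_nat.eventually_ge_atTop 1] with n h1 h2 h3
  set l := Real.log n with hl
  have hll : Real.log l ≤ l := Real.log_le_self (by linarith)
  have hle : iota q n ≤ l ^ 3 := by
    unfold iota
    split_ifs with h
    · calc l ^ (3 / 2 : ℝ) * Real.log l ≤ l ^ (2 : ℝ) * l :=
            mul_le_mul (Real.rpow_le_rpow_of_exponent_le h2 (by norm_num)) hll (by linarith)
              (by positivity)
        _ = l ^ 3 := by rw [Real.rpow_two]; ring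
    · calc l ^ (1 / q) * Real.log l ^ (2 / q) ≤ l ^ (2 : ℝ) * l ^ (1 : ℝ) := by
            refine mul_le_mul (Real.rpow_le_rpow_of_exponent_le h2 ?_)
              ((Real.rpow_le_rpow (by linarith) hll (by positivity)).trans
                (Real.rpow_le_rpow_of_exponent_le h2 ?_)) (by positivity) (by positivity)
            · rw [div_le_iff₀ (by linarith)]; linarith
            · rw [div_le_iff₀ (by linarith)]; linarith
        _ = l ^ 3 := by rw [Real.rpow_two, Real.rpow_one]; ring
  refine hle.trans ?_
  have : l ^ 3 = (l ^ 24) ^ (1 / 8 : ℝ) := by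
    rw [← Real.rpow_natCast l 24, ← Real.rpow_mul (by linarith), ← Real.rpow_natCast l 3]
    norm_num
  rw [this]
  exact Real.rpow_le_rpow (by positivity) h1 (by norm_num)

lemma tendsto_iota_div_sqrt (hq : 2 ≤ q) :
    Tendsto (fun n : ℕ => iota q n / Real.sqrt n) atTop (𝓝 0) := by
  have h0 : Tendsto (fun n : ℕ => (n:ℝ) ^ (-(3 / 8) : ℝ)) atTop (𝓝 0) :=
    (tendsto_rpow_neg_atTop (by norm_num)).comp tendsto_natCast_atTop_atTop
  refine tendsto_of_tendsto_of_tendsto_of_le_of_le' tendsto_const_nhds h0 ?_ ?_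
  · filter_upwards [eventually_one_le_iota hq] with n hn
    positivity
  · filter_upwards [eventually_iota_le_rpow hq, eventually_gt_atTop 0] with n hn hn0
    have : (0:ℝ) < n := by exact_mod_cast hn0
    rw [div_le_iff₀ (Real.sqrt_pos.2 this), Real.sqrt_eq_rpow, ← Real.rpow_add this]
    norm_num at hn ⊢
    exact hn

lemma eventually_log_le_sqrt_mul_iota (hq : 2 ≤ q) :
    ∀ᶠ n : ℕ in atTop, Real.log n ≤ Real.sqrt n * iota q n := by
  have h1 := (isLittleO_log_rpow_atTop (r := 1 / 2) (by norm_num)).bound one_pos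
  filter_upwards [tendsto_natCast_atTop_atTop.eventually h1, eventually_one_le_iota hq] with n hn h2
  have h3 := (le_abs_self _).trans hn
  rw [one_mul, ← Real.sqrt_eq_rpow, Real.norm_of_nonneg (Real.sqrt_nonneg _)] at h3
  nlinarith [Real.sqrt_nonneg n]

lemma eventually_sq_le_rate (hq : 2 ≤ q) : ∀ᶠ n : ℕ in atTop, (iota q n / Real.sqrt n) ^ 2
    ≤ (n:ℝ) ^ (-(3 / 4) : ℝ) * (iota q n * Real.log n) ^ (1 / 2 : ℝ) := by
  filter_upwards [eventually_iota_le_rpow hq, eventually_one_le_iota hq,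
    tendsto_log_nat.eventually_ge_atTop 1, eventually_gt_atTop 0] with n h1 h2 h3 h4
  have hn : (0:ℝ) < n := by exact_mod_cast h4
  have h5 : (iota q n / Real.sqrt n) ^ 2 ≤ (n:ℝ) ^ (-(3 / 4) : ℝ) := by
    rw [div_pow, Real.sq_sqrt hn.le, div_le_iff₀ hn]
    calc iota q n ^ 2 ≤ ((n:ℝ) ^ (1 / 8 : ℝ)) ^ 2 := pow_le_pow_left₀ (by linarith) h1 2
      _ = (n:ℝ) ^ (1 / 4 : ℝ) := by
        rw [← Real.rpow_natCast, ← Real.rpow_mul hn.le]; norm_num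
      _ = (n:ℝ) ^ (-(3 / 4) : ℝ) * (n:ℝ) ^ (1 : ℝ) := by rw [← Real.rpow_add hn]; norm_num
      _ = _ := by rw [Real.rpow_one]
  refine h5.trans (le_mul_of_one_le_right (by positivity) ?_)
  exact Real.one_le_rpow (one_le_mul_of_one_le_of_one_le h2 h3) (by norm_num)

lemma sqrt_div_eq_rate {n : ℕ} (hn : 0 < n) (u v : ℝ) :
    1 / (n:ℝ) * Real.sqrt (n * (u / Real.sqrt n) * v)
      = (n:ℝ) ^ (-(3 / 4) : ℝ) * (u * v) ^ (1 / 2 : ℝ) := by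
  have hn0 : (0:ℝ) < n := by exact_mod_cast hn
  have h1 : n * (u / Real.sqrt n) * v = Real.sqrt n * (u * v) := by
    have := Real.sqrt_pos.2 hn0
    field_simp
    rw [Real.sq_sqrt hn0.le]
    ring
  rw [h1, Real.sqrt_mul (Real.sqrt_nonneg _), Real.sqrt_eq_rpow (u * v), ← mul_assoc]
  congr 1
  rw [Real.sqrt_eq_rpow, Real.sqrt_eq_rpow, ← Real.rpow_mul hn0.le, one_div, ← Real.rpow_neg_one,
    ← Real.rpow_add hn0]
  norm_num

end Rates

lemma monotone_empCDF {Ω : Type*} (X : ℤ → Ω → ℝ) (n : ℕ) (ω : Ω) : Monotone (empCDF X n ω) := by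
  intro x y hxy
  refine mul_le_mul_of_nonneg_left (Finset.sum_le_sum fun i _ => ?_) (by positivity)
  exact Set.indicator_le_indicator_of_subset (fun z (hz : z ≤ x) => hz.trans hxy)
    (fun _ => zero_le_one) _

/-! ### The empirical process -/

section EmpiricalProcess

variable {Ω : Type*} {m0 : MeasurableSpace Ω} {μ : Measure Ω} [IsProbabilityMeasure μ]
  {a : ℕ → ℝ} {ε X : ℤ → Ω → ℝ}

namespace IsLinearProcess

lemma monotone_margCDF (h : IsLinearProcess μ a ε X) : Monotone (margCDF μ X) := by
  rw [show margCDF μ X = _ from funext h.margCDF_eq_cdf]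
  exact monotone_cdf _

lemma exists_margCDF_lt (h : IsLinearProcess μ a ε X) {p : ℝ} (hp : 0 < p) :
    ∃ u, margCDF μ X u < p := by
  rw [show margCDF μ X = _ from funext h.margCDF_eq_cdf]
  exact ((tendsto_cdf_atBot _).eventually_lt_const hp).exists

lemma exists_le_margCDF (h : IsLinearProcess μ a ε X) {p : ℝ} (hp : p < 1) :
    ∃ v, p ≤ margCDF μ X v := by
  rw [show margCDF μ X = _ from funext h.margCDF_eq_cdf]
  exact ((tendsto_cdf_atTop _).eventually_const_le hp).exists

lemma margCDF_popQuantile (h : IsLinearProcess μ a ε X) (hc : Continuous (margCDF μ X)) {p : ℝ}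
    (hp0 : 0 < p) (hp1 : p < 1) : margCDF μ X (popQuantile μ X p) = p := by
  obtain ⟨u, hu⟩ := h.exists_margCDF_lt hp0
  obtain ⟨v, hv⟩ := h.exists_le_margCDF hp1
  exact apply_quantile h.monotone_margCDF hc hu hv

lemma exists_abs_popQuantile_le (h : IsLinearProcess μ a ε X) {p₀ p₁ : ℝ} (hp₀ : 0 < p₀)
    (hp₁ : p₁ < 1) : ∃ B, ∀ p ∈ Set.Icc p₀ p₁, |popQuantile μ X p| ≤ B := by
  obtain ⟨u, hu⟩ := h.exists_margCDF_lt hp₀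
  obtain ⟨v, hv⟩ := h.exists_le_margCDF hp₁
  refine ⟨max |u| |v|, fun p hp => ?_⟩
  have hlb : ∀ x ∈ {x | p ≤ margCDF μ X x}, u ≤ x := fun x hx => by
    by_contra! hlt
    have h1 : p ≤ margCDF μ X x := hx
    linarith [h.monotone_margCDF hlt.le, hp.1]
  have hmem : v ∈ {x | p ≤ margCDF μ X x} := hp.2.trans hv
  exact abs_le_max_abs_abs (le_csInf ⟨v, hmem⟩ hlb) (csInf_le ⟨u, hlb⟩ hmem)

end IsLinearProcess

lemma abs_smoothSum_sub_le {g g' : ℝ → ℝ} {H : ℝ} {Y : ℤ → Ω → ℝ} (hg : IsSmooth g g' H)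
    (hY : ∀ i, Measurable (Y i)) {s n : ℕ} {ω : Ω} {A C : ℝ}
    (hC : ∀ x ∈ Set.Icc (-A) A, |smoothSum μ Y g' s n x ω| ≤ C) {x y : ℝ}
    (hx : x ∈ Set.Icc (-A) A) (hy : y ∈ Set.Icc (-A) A) :
    |smoothSum μ Y g s n x ω - smoothSum μ Y g s n y ω| ≤ C * |x - y| :=
  Convex.norm_image_sub_le_of_norm_hasDerivWithin_le
    (f := fun x => smoothSum μ Y g s n x ω)
    (fun z _ => (hg.hasDerivAt_smoothSum hY s n ω z).hasDerivWithinAt) (fun z hz => hC z hz)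
    (convex_Icc _ _) hy hx

/-- The empirical process of a short-range dependent linear process: uniform rate and oscillation
on compact intervals. -/
lemma IsLinearProcess.ae_empirical_rates (h : IsLinearProcess μ a ε X) {g : ℝ → ℝ} {H q A : ℝ}
    (hs : IsSmooth (innovCDF μ ε) g H) (hs' : IsSmooth g (deriv g) H) (hq : 2 ≤ q)
    (hMB : HasMomentBound μ (pastPart a ε) q) (hA : 0 < A) :
    ∃ K, 0 ≤ K ∧ ∀ᵐ ω ∂μ,
      (∀ κ, 0 < κ → ∀ᶠ n : ℕ in atTop, ∀ x ∈ Set.Icc (-A) A,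
        |empCDF X n ω x - margCDF μ X x| ≤ κ * (iota q n / Real.sqrt n)) ∧
      ∀ᶠ n : ℕ in atTop, ∀ x ∈ Set.Icc (-A) A, ∀ y ∈ Set.Icc (-A) A,
        |x - y| ≤ iota q n / Real.sqrt n →
        |empCDF X n ω x - empCDF X n ω y - (margCDF μ X x - margCDF μ X y)|
          ≤ K * ((n:ℝ) ^ (-(3 / 4) : ℝ) * (iota q n * Real.log n) ^ (1 / 2 : ℝ)) := by
  have hm := h.isInnovationModel hs
  have hY := h.measurable_pastPart'
  have hb : ∀ᶠ n : ℕ in atTop, Real.log n ≤ n * (iota q n / Real.sqrt n) := by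
    filter_upwards [eventually_log_le_sqrt_mul_iota hq] with n hn
    rwa [mul_div_left_comm, Real.div_sqrt, mul_comm]
  obtain ⟨K, hK, hosc⟩ := hm.ae_oscillation hA hb
  refine ⟨K + 1, by linarith, ?_⟩
  filter_upwards [h.ae_eq_add, hm.ae_martingale_part hA hq, hs.ae_smoothSum hY hq hMB hA,
    hs'.ae_smoothSum hY hq hMB hA, hosc] with ω hω h1 h2 h3 h4
  refine ⟨fun κ hκ => ?_, ?_⟩
  · filter_upwards [h1 (κ / 2) (by positivity), h2 (κ / 2) (by positivity), eventually_gt_atTop 0]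
      with n e1 e2 hn x hx
    have hn0 : (0:ℝ) < n := by exact_mod_cast hn
    rw [h.empCDF_sub_margCDF hω hn, abs_mul, abs_of_pos (by positivity : 0 < 1 / (n:ℝ))]
    have e3 := (abs_add_le _ _).trans (add_le_add (e1 x hx) (e2 x hx))
    refine (mul_le_mul_of_nonneg_left e3 (by positivity)).trans (le_of_eq ?_)
    have e4 := Real.sqrt_pos.2 hn0
    have e5 := Real.sq_sqrt hn0.le
    field_simp
    rw [e5]
    ring
  · filter_upwards [h3 1 one_pos, h4, eventually_sq_le_rate hq, eventually_one_le_iota hq,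
      tendsto_log_nat.eventually_ge_atTop 1, eventually_gt_atTop 0]
      with n e1 e2 e3 e4 e5 hn x hx y hy hxy
    have hn0 : (0:ℝ) < n := by exact_mod_cast hn
    have hsq := Real.sqrt_pos.2 hn0
    have hsq2 := Real.sq_sqrt hn0.le
    have f1 := e2 x hx y hy hxy
    have f2 := (abs_smoothSum_sub_le hs hY e1 hx hy).trans
      (mul_le_mul_of_nonneg_left hxy (by positivity))
    have f3 := (abs_add_le _ _).trans (add_le_add f1 f2)
    have f4 : empCDF X n ω x - empCDF X n ω y - (margCDF μ X x - margCDF μ X y)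
        = (empCDF X n ω x - margCDF μ X x) - (empCDF X n ω y - margCDF μ X y) := by ring
    rw [f4, h.empCDF_sub_margCDF hω hn, h.empCDF_sub_margCDF hω hn, ← mul_sub, abs_mul,
      abs_of_pos (by positivity : 0 < 1 / (n:ℝ)), add_sub_add_comm]
    refine (mul_le_mul_of_nonneg_left f3 (by positivity)).trans ?_
    have f5 := sqrt_div_eq_rate hn (iota q n) (Real.log n)
    -- The smooth part contributes the bound on its derivative sum times the distance `b_n`, that is
    -- `b_n²` after division by `n`.
    have f6 : 1 / (n:ℝ) * (1 * (Real.sqrt n * iota q n) * (iota q n / Real.sqrt n))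
        = (iota q n / Real.sqrt n) ^ 2 := by
      field_simp
      rw [hsq2]
    rw [mul_add, f6, mul_left_comm, f5]
    linarith

end EmpiricalProcess

end Bahadur

end

theorem theorem2 {Ω : Type*} [MeasurableSpace Ω] (μ : Measure Ω) [IsProbabilityMeasure μ]
    (a : ℕ → ℝ) (ε X : ℤ → Ω → ℝ) (hX : Bahadur.IsLinearProcess μ a ε X)
    (fε : ℝ → ℝ) (hdens : Bahadur.IsDensity μ (ε 0) fε)
    (hdiff : Differentiable ℝ fε)
    (hbound : ∃ C : ℝ, ∀ x, fε x + |deriv fε x| ≤ C)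
    (hdiff' : Differentiable ℝ (deriv fε))
    (hbound' : ∃ C : ℝ, ∀ x, |deriv (deriv fε) x| ≤ C)
    (α q : ℝ) (hα : 0 < α) (hq : 2 ≤ q)
    (hmoment : Integrable (fun ω => |ε 0 ω| ^ α) μ)
    (hcoeff : Summable (fun i : ℕ => |a (i + 1)| ^ min (α / q) 1))
    (p₀ p₁ : ℝ) (hp₀ : 0 < p₀) (hp₀₁ : p₀ < p₁) (hp₁ : p₁ < 1)
    (hpos : ∃ c : ℝ, 0 < c ∧
      ∀ p ∈ Set.Icc p₀ p₁, c ≤ Bahadur.margDensity μ X (Bahadur.popQuantile μ X p)) :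
    Bahadur.IsLittleOAS μ
      (fun n ω => ⨆ p ∈ Set.Icc p₀ p₁,
        ENNReal.ofReal |Bahadur.sampleQuantile X n p ω - Bahadur.popQuantile μ X p|)
      (fun n => Bahadur.iota q n / Real.sqrt n) ∧
    Bahadur.IsBigOAS μ
      (fun n ω => ⨆ p ∈ Set.Icc p₀ p₁,
        ENNReal.ofReal |Bahadur.sampleQuantile X n p ω - Bahadur.popQuantile μ X p
          - (p - Bahadur.empCDF X n ω (Bahadur.popQuantile μ X p))
            / Bahadur.margDensity μ X (Bahadur.popQuantile μ X p)|)
      (fun n => (n : ℝ) ^ (-(3 / 4) : ℝ) * (Bahadur.iota q n * Real.log n) ^ (1 / 2 : ℝ)) := by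
  obtain ⟨c, hc, hcf⟩ := hpos
  obtain ⟨H, hs, hs'⟩ := Bahadur.exists_isSmooth (hX.measurable 0) hdens hdiff hbound hdiff' hbound'
  have hMB := hX.hasMomentBound hα hq hmoment hcoeff
  have hFc : Continuous (Bahadur.margCDF μ X) :=
    continuous_iff_continuousAt.2 fun x => (hX.hasDerivAt_margCDF hs x).continuousAt
  obtain ⟨B, hB⟩ := hX.exists_abs_popQuantile_le hp₀ hp₁
  have hB0 : 0 ≤ B := (abs_nonneg _).trans (hB p₀ ⟨le_rfl, hp₀₁.le⟩)
  -- The interval extends one unit beyond all the quantiles, leaving room for the perturbations `ξ ±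
  -- δ` with `δ ≤ 1`.
  have hA : 0 < B + 1 := by linarith
  obtain ⟨K, hK, hae⟩ := hX.ae_empirical_rates hs hs' hq hMB hA
  have hb0 : ∀ᶠ n : ℕ in atTop, 0 < Bahadur.iota q n / Real.sqrt n := by
    filter_upwards [Bahadur.eventually_one_le_iota hq, eventually_gt_atTop 0] with n h1 h2
    have : (0:ℝ) < n := by exact_mod_cast h2
    positivity
  have hrates := hae.mono fun ω hω =>
    Bahadur.eventually_quantile_rates hFc (fun x y => hX.abs_margCDF_sub_le hs x y)
      hs.nonneg hc (Q := Bahadur.popQuantile μ X) (P := Set.Icc p₀ p₁)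
      (fun p hp => ⟨hX.margCDF_popQuantile hFc (hp₀.trans_le hp.1) (hp.2.trans_lt hp₁),
        by linarith [hB p hp], hcf p hp⟩)
      (fun n => Bahadur.monotone_empCDF X n ω) hb0 (Bahadur.tendsto_iota_div_sqrt hq)
      (Bahadur.eventually_sq_le_rate hq) hω.1 hω.2
  constructor
  · filter_upwards [hrates] with ω hω
    rw [ENNReal.tendsto_nhds_zero]
    intro δ hδ
    obtain ⟨η, hη0, hηδ⟩ := ENNReal.lt_iff_exists_nnreal_btwn.1 hδ
    filter_upwards [hω.1 η (by exact_mod_cast hη0)] with n hn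
    refine le_trans (ENNReal.div_le_of_le_mul ?_) hηδ.le
    refine iSup₂_le fun p hp => ?_
    rw [← ENNReal.ofReal_coe_nnreal, ← ENNReal.ofReal_mul η.coe_nonneg]
    exact ENNReal.ofReal_le_ofReal (hn p hp)
  · filter_upwards [hrates] with ω hω
    have hC : 0 ≤ (K + H) / c := div_nonneg (add_nonneg hK hs.nonneg) hc.le
    refine ⟨((K + H) / c).toNNReal, ?_⟩
    filter_upwards [hω.2] with n hn
    refine iSup₂_le fun p hp => ?_
    change _ ≤ ENNReal.ofReal ((K + H) / c) * _
    rw [← ENNReal.ofReal_mul hC]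
    exact ENNReal.ofReal_le_ofReal (hn p hp)
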